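/- Setting. Fix integers $d,p\ge 1$, a level $\alpha\in(0,1)$, and a sequence $\gamma_n\in(0,\alpha/2)$ (constant or varying). The design points $X_1,X_2,\dots\in\mathbb R^d$ are nonstochastic. For each $n$ one observes $Y_i=f(X_i)+\varepsilon_i\in\mathbb R^p$, $i=1,\dots,n$. For a kernel $K:\mathbb R^d\to[0,\infty)$ put $K_h(x)=K(x/h)/h^d$, $w_h(X_i,X_j)=K_h(X_i-X_j)/\sum_{k=1}^nK_h(X_i-X_k)$. Let $H_n=\{h=h_{\max}a^k:\ h\ge h_{\min},\ k=0,1,\dots\}$, where $a\in(0,1)$, $h_{\max}>0$ is fixed, and $h_{\min}=h_{\min,n}>0$. For $h\in H_n$ let $I_{h,n}\subset\{1,\dots,n\}$ be the set of test points and put $S_n=\{(i,m,h):h\in H_n,\ i\in I_{h,n},\ 1\le m\le p\}$. Let $\hat\Sigma_1,\dots,\hat\Sigma_n$ be positive semidefinite matrices that are functions of $Y_1,\dots,Y_n$. For $s=(i,m,h)\in S_n$ put $\hat f_s=\sum_jw_h(X_i,X_j)Y_{j,m}$, $\hat V_s^2=\sum_jw_h(X_i,X_j)^2\hat\Sigma_{j,mm}$,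 and let $\hat T=\max_{s\in S_n}\hat f_s/\hat V_s$. Deterministic critical values. Conditionally on the data let $\tilde Y_j\sim N(0,\hat\Sigma_j)$ be independent. For $A\subset S_n$ let $T^A=\max_{(i,m,h)\in A}\sum_jw_h(X_i,X_j)\tilde Y_{j,m}/\hat V_{i,m,h}$ (with $\max\emptyset=0$). Let $c^{PIA}_q$ be the conditional $q$-quantile of $T^{S_n}$ given the data, let $S_n^{RMS}=\{s\in S_n:\hat f_s/\hat V_s>-2c^{PIA}_{1-\gamma_n}\}$, and let $c^{RMS}_q$ be the conditional $q$-quantile of $T^{S_n^{RMS}}$ given the data. The plug-in test accepts iff $\hat T\le c^{PIA}_{1-\alpha}$; the RMS test accepts iff $\hat T\le c^{RMS}_{1-\alpha+2\gamma_n}$. Models. Fix constants $\delta,C_{mom},C_{Lip},C_{var},L,C_{der}>0$, $\tau\ge1/4$, and an integer $\varsigma$; let $[\tau]$ be the largest integer strictly smaller than $\tau$, and let $\varsigma=0$ if $\tau\le1$ and $1\le\varsigma\le[\tau]$ if $\tau>1$. At sample size $n$, $\mathcal G$ is the class of all models $w$ (a function $f=f^w$ and a law of $(\varepsilon_1,\dots,\varepsilon_n)$)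 such that the following hold. (a) $\varepsilon_1,\dots,\varepsilon_n$ are independent with mean zero, $E|\varepsilon_{i,m}|^{4+\delta}\le C_{mom}$, the entries of $\Sigma_i=E[\varepsilon_i\varepsilon_i^T]$ and all mixed fourth moments $E[\varepsilon_{i,m_1}\varepsilon_{i,m_2}\varepsilon_{i,m_3}\varepsilon_{i,m_4}]$ differ between $i$ and $j$ by at most $C_{Lip}\|X_i-X_j\|$, and $\Sigma_{i,mm}\ge C_{var}$. (b) Each component $g=f_m:\mathbb R^d\to\mathbb R$ either is identically zero or satisfies the following: $g$ is $C^{[\tau]}$ with $|D^\beta g(x)-D^\beta g(y)|\le L\|x-y\|^{\tau-[\tau]}$ for $|\beta|=[\tau]$; if $\tau>1$, then, wherever the first derivative of $g$ in a unit direction vanishes, so do those of orders $2,\dots,\varsigma$ in that direction, and at some point and in some unit direction for which the first derivative vanishes the one of order $\varsigma+1$ is not zero (does not exist or is nonzero); if $\varsigma<[\tau]$, then $|D^\beta g|\le C_{der}$ for $|\beta|=\varsigma+1$. Let $\mathcal G_0$ be the class of $w\in\mathcal G$ with $f^w_m(X_i)\le0$ for all $i\le n$ and $m$. Assumptions. (1)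 $\|X_i\|<h_{\max}$ for all $i$, and with $M_h(X_i)=\#\{j\le n:\|X_j-X_i\|\le h\}$ there are constants $0<C_1<C_2$ such that for all large $n$, all $i\in\mathbb N$ and all $h\in H_n$: $C_1nh^d\le M_h(X_i)\le C_2nh^d$ and $M_{h/2}(X_i)\ge C_1n(h/2)^d$. (2) $h_{\min}\to0$ and, for some constant $C$ and all large $n$, $|H_n|\le C\log n$. (3) For some $\phi\in(0,1/(2+d))$, which may be arbitrarily small, and with $\kappa=1/(2+d)-\phi$, $\max_{i\le n}\|\hat\Sigma_i-\Sigma_i\|_o=o_p(n^{-\kappa})$ uniformly over $w\in\mathcal G_0$, where $\|\cdot\|_o$ is the spectral norm. (4) $0\le K\le1$, $K(x)=0$ for $\|x\|>1$, and $K(x)\ge C$ for $\|x\|\le1/2$, for some constant $C\in(0,1)$. (5) For all $h\in H_n$: $\|X_i-X_j\|>2h$ for distinct $i,j\in I_{h,n}$, and every $i\le n$ has some $j\in I_{h,n}$ with $\|X_i-X_j\|\le2h$. (6) $(\log n)^{19}/(h_{\min}^{3d}\,n)\to0$ as $n\to\infty$. Conclusion. For the deterministic critical values, as $n\to\infty$,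 $$\inf_{w\in\mathcal G_0}P_w\{\hat T\le c^{PIA}_{1-\alpha}\}\ge1-\alpha+o(1),\qquad \inf_{w\in\mathcal G_0}P_w\{\hat T\le c^{RMS}_{1-\alpha+2\gamma_n}\}\ge1-\alpha+o(1).$$ In addition (along those $n$ for which a model in $\mathcal G_0$ with $f^w\equiv0$ exists), $$\sup_{w\in\mathcal G_0,\,f^w\equiv0}P_w\{\hat T\le c^{PIA}_{1-\alpha}\}=1-\alpha+o(1),$$ and if $\gamma_n\to0$, then also $$\sup_{w\in\mathcal G_0,\,f^w\equiv0}P_w\{\hat T\le c^{RMS}_{1-\alpha+2\gamma_n}\}=1-\alpha+o(1).$$ -/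

import Mathlib

open MeasureTheory ProbabilityTheory Filter Topology

noncomputable section

namespace CMITest

/-- `ℝ^d` with the Euclidean norm. -/
abbrev Vec (d : ℕ) : Type := EuclideanSpace ℝ (Fin d)

/-! ### Smoothness classes of regression functions -/

/-- The largest integer strictly smaller than `τ` (for `τ > 0`). -/
def strictFloor (τ : ℝ) : ℕ := ⌈τ⌉₊ - 1

/-- The partial derivative of order `k` of `g` at `x` in the coordinate directions
`idx 0, …, idx (k-1)`. The multi-indices `α` with `|α| = k` are listed, with repetitions, by the
functions `idx : Fin k → Fin d`. -/
def partialDeriv {d : ℕ} (g : Vec d → ℝ) {k : ℕ} (idx : Fin k → Fin d) (x : Vec d) : ℝ :=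
  iteratedFDeriv ℝ k g x (fun j => EuclideanSpace.single (idx j) (1 : ℝ))

/-- `g` along the line through `x` with direction `l`. -/
def alongLine {d : ℕ} (g : Vec d → ℝ) (x l : Vec d) : ℝ → ℝ := fun t => g (x + t • l)

/-- The `k`-th derivative `g^{(k,l)}(x)` of `g` in direction `l` at `x`. -/
def dirDeriv {d : ℕ} (g : Vec d → ℝ) (k : ℕ) (l x : Vec d) : ℝ :=
  iteratedDeriv k (alongLine g x l) 0

/-- The Hölder class `𝓕(τ, L)`. -/
def HolderClass (d : ℕ) (τ L : ℝ) : Set (Vec d → ℝ) :=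
  {g | ContDiff ℝ (strictFloor τ : ℕ) g ∧
    ∀ (idx : Fin (strictFloor τ) → Fin d) (x y : Vec d),
      |partialDeriv g idx x - partialDeriv g idx y| ≤ L * ‖x - y‖ ^ (τ - (strictFloor τ : ℝ))}

/-- The class `𝓕_ς(τ, L)`. It is `𝓕(τ, L)` if `τ ≤ 1`. Otherwise it consists of the `g ∈ 𝓕(τ, L)`
whose directional derivatives of orders `1, …, ς` vanish wherever the first one does, where in at
least one case the one of order `ς + 1` does not vanish as well (that is, it is not a derivative
that exists and equals `0`). -/
def FlatHolderClass (d : ℕ) (ς : ℕ) (τ L : ℝ) : Set (Vec d → ℝ) :=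
  {g | g ∈ HolderClass d τ L ∧ (1 < τ →
    (∀ x l : Vec d, ‖l‖ = 1 → dirDeriv g 1 l x = 0 → ∀ k, 1 ≤ k → k ≤ ς → dirDeriv g k l x = 0) ∧
    (∃ x l : Vec d, ‖l‖ = 1 ∧ dirDeriv g 1 l x = 0 ∧
      ¬ HasDerivAt (iteratedDeriv ς (alongLine g x l)) 0 0))}

/-! ### Models -/

/-- The fixed constants of a class of models. -/
structure ClassConstants where
  /-- excess over the fourth moment -/
  δ : ℝ
  /-- moment bound -/
  Cmom : ℝ
  /-- Lipschitz constant of second and fourth moments -/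
  CLip : ℝ
  /-- lower bound on variances -/
  Cvar : ℝ
  /-- order of smoothness -/
  τ : ℝ
  /-- Hölder constant -/
  L : ℝ
  /-- order of flatness -/
  ς : ℕ
  /-- bound on the partial derivatives of order `ς + 1` -/
  Cder : ℝ
  δ_pos : 0 < δ
  Cmom_pos : 0 < Cmom
  CLip_pos : 0 < CLip
  Cvar_pos : 0 < Cvar
  τ_ge : 1 / 4 ≤ τ
  L_pos : 0 < L
  ς_range : (τ ≤ 1 ∧ ς = 0) ∨ (1 < τ ∧ 1 ≤ ς ∧ ς ≤ strictFloor τ)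
  Cder_pos : 0 < Cder

/-- A model at sample size `n`: the regression function `f = (f_1, …, f_p)` on `ℝ^d`, and the laws
on `ℝ^p` of the disturbances `ε_1, …, ε_n`. -/
structure Model (d p n : ℕ) where
  f : Fin p → Vec d → ℝ
  law : Fin n → Measure (Vec p)
  prob : ∀ i, IsProbabilityMeasure (law i)

namespace Model

variable {d p n : ℕ} (w : Model d p n)

/-- `Σ_i = E[ε_i ε_iᵀ]`. -/
def cov (i : Fin n) : Matrix (Fin p) (Fin p) ℝ :=
  fun m₁ m₂ => ∫ e, e m₁ * e m₂ ∂(w.law i)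

/-- Mixed fourth moments of the components of `ε_i`. -/
def fourth (i : Fin n) (m₁ m₂ m₃ m₄ : Fin p) : ℝ :=
  ∫ e, e m₁ * e m₂ * e m₃ * e m₄ ∂(w.law i)

/-- The law of the responses `Y_i = f(X_i) + ε_i`, `i = 1, …, n`, with `ε_1, …, ε_n`
independent. -/
def dataLaw (X : ℕ → Vec d) : Measure (Fin n → Vec p) :=
  (Measure.pi w.law).map
    (fun e i => WithLp.toLp 2 (fun m => w.f m (X i)) + e i)

/-- Conditions on the disturbances. The moment bound implies that all the moments of order at most
`4` below are finite. -/
structure DisturbanceConditions (c : ClassConstants) (X : ℕ → Vec d) : Prop where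
  mean_zero : ∀ i m, ∫ e, e m ∂(w.law i) = 0
  moment : ∀ i m, ∫⁻ e, ENNReal.ofReal (|e m| ^ (4 + c.δ)) ∂(w.law i) ≤ ENNReal.ofReal c.Cmom
  cov_lip : ∀ i j m₁ m₂,
    |w.cov i m₁ m₂ - w.cov j m₁ m₂| ≤ c.CLip * ‖X i - X j‖
  fourth_lip : ∀ i j m₁ m₂ m₃ m₄,
    |w.fourth i m₁ m₂ m₃ m₄ - w.fourth j m₁ m₂ m₃ m₄| ≤ c.CLip * ‖X i - X j‖
  var_lower : ∀ i m, c.Cvar ≤ w.cov i m m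

/-- Conditions on the regression functions: each component belongs to `𝓕_ς(τ, L)`, with bounded
derivatives of order `ς + 1` if `ς < [τ]`, or is the zero function. -/
def RegressionConditions (c : ClassConstants) : Prop :=
  ∀ m, (w.f m = 0) ∨ (w.f m ∈ FlatHolderClass d c.ς c.τ c.L ∧
    (c.ς < strictFloor c.τ →
      ∀ (idx : Fin (c.ς + 1) → Fin d) (x : Vec d), |partialDeriv (w.f m) idx x| ≤ c.Cder))

end Model

/-- The class `𝓖` of models, at sample size `n`. -/
def modelClass {d : ℕ} (p : ℕ) (c : ClassConstants) (X : ℕ → Vec d) (n : ℕ) :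
    Set (Model d p n) :=
  {w | w.DisturbanceConditions c X ∧ w.RegressionConditions c}

/-- The class `𝓖₀` of models in `𝓖` that satisfy the null hypothesis `f ≤ 0` at the design
points. -/
def nullClass {d : ℕ} (p : ℕ) (c : ClassConstants) (X : ℕ → Vec d) (n : ℕ) :
    Set (Model d p n) :=
  {w | w ∈ modelClass p c X n ∧ ∀ (i : Fin n) (m : Fin p), w.f m (X i) ≤ 0}

/-- The models in `𝓖₀` with `f ≡ 0`. -/
def zeroClass {d : ℕ} (p : ℕ) (c : ClassConstants) (X : ℕ → Vec d) (n : ℕ) :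
    Set (Model d p n) :=
  {w | w ∈ nullClass p c X n ∧ ∀ m, w.f m = 0}

/-! ### The test -/

/-- The ingredients of the test: design points, kernel, bandwidth parameters, sets of test points,
and estimators `Σ̂_1, …, Σ̂_n` (functions of the responses) of the covariance matrices. The sample
of size `n` has the design points `X 0, …, X (n - 1)`. -/
structure TestSetup (d p : ℕ) where
  X : ℕ → Vec d
  K : Vec d → ℝ
  hmax : ℝ
  a : ℝ
  hmin : ℕ → ℝ
  I : (n : ℕ) → ℝ → Set (Fin n)
  sigmaHat : (n : ℕ) → (Fin n → Vec p) → Fin n → Matrix (Fin p) (Fin p) ℝ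

namespace TestSetup

variable {d p : ℕ} (D : TestSetup d p)

/-- The set `H_n` of bandwidth values. -/
def H (n : ℕ) : Set ℝ := {h | D.hmin n ≤ h ∧ ∃ k : ℕ, h = D.hmax * D.a ^ k}

/-- The index set `S_n` of triples `(i, m, h)`. -/
def S (n : ℕ) : Set (Fin n × Fin p × ℝ) := {s | s.2.2 ∈ D.H n ∧ s.1 ∈ D.I n s.2.2}

/-- `M_h(X_i)`: the number of design points among the first `n` at distance at most `h` from
`X_i`. -/
def M (n : ℕ) (h : ℝ) (i : ℕ) : ℕ := Set.ncard {j : Fin n | ‖D.X j - D.X i‖ ≤ h}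

/-- `K_h(x) = K(x/h)/h^d`. -/
def Kh (h : ℝ) (x : Vec d) : ℝ := D.K (h⁻¹ • x) / h ^ d

/-- The weight `w_h(X_i, X_j)`. -/
def weight {n : ℕ} (h : ℝ) (i j : Fin n) : ℝ :=
  D.Kh h (D.X i - D.X j) / ∑ k : Fin n, D.Kh h (D.X i - D.X k)

/-- The kernel estimator `∑_j w_h(X_i, X_j) y_{j,m}`, for `s = (i, m, h)`. -/
def smooth {n : ℕ} (y : Fin n → Vec p) (s : Fin n × Fin p × ℝ) : ℝ :=
  ∑ j : Fin n, D.weight s.2.2 s.1 j * y j s.2.1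

/-- The estimated standard deviation `V̂_s`. -/
def VHat {n : ℕ} (y : Fin n → Vec p) (s : Fin n × Fin p × ℝ) : ℝ :=
  √(∑ j : Fin n, D.weight s.2.2 s.1 j ^ 2 * D.sigmaHat n y j s.2.1 s.2.1)

/-- `max_{s ∈ A} (∑_j w_h(X_i, X_j) z_{j,m}) / V̂_s`, where `V̂_s` is calculated from `y`; the sets
`A` that are used are finite, and the maximum over the empty set is `0`. -/
def maxStat {n : ℕ} (y z : Fin n → Vec p) (A : Set (Fin n × Fin p × ℝ)) : ℝ :=
  sSup ((fun s => D.smooth z s / D.VHat y s) '' A)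

/-- The test statistic `T̂ = max_{s ∈ S} f̂_s / V̂_s`. -/
def testStat {n : ℕ} (y : Fin n → Vec p) : ℝ := D.maxStat y y (D.S n)

/-- The bootstrap law, given `y`, of `Ỹ_1, …, Ỹ_n`: independent, `Ỹ_j ∼ N(0, Σ̂_j)`. -/
def bootLaw {n : ℕ} (y : Fin n → Vec p) : Measure (Fin n → Vec p) :=
  Measure.pi (fun j => multivariateGaussian 0 (D.sigmaHat n y j))

/-- The quantile of level `q`, given `y`, of the bootstrap statistic that is the maximum over
`A`. -/
def bootQuantile {n : ℕ} (y : Fin n → Vec p) (A : Set (Fin n × Fin p × ℝ)) (q : ℝ) : ℝ :=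
  sInf {t : ℝ | q ≤ (D.bootLaw y).real {z | D.maxStat y z A ≤ t}}

/-- The deterministic plug-in critical value `c_q^{PIA}`. -/
def critPIA {n : ℕ} (q : ℝ) (y : Fin n → Vec p) : ℝ := D.bootQuantile y (D.S n) q

/-- The set `S^{RMS}` of triples that survive the pretest of level `γ`. -/
def SRMS {n : ℕ} (γ : ℝ) (y : Fin n → Vec p) : Set (Fin n × Fin p × ℝ) :=
  {s ∈ D.S n | -2 * D.critPIA (1 - γ) y < D.smooth y s / D.VHat y s}

/-- The deterministic refined moment selection critical value `c_q^{RMS}`, with a pretest of level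
`γ`. -/
def critRMS {n : ℕ} (γ q : ℝ) (y : Fin n → Vec p) : ℝ := D.bootQuantile y (D.SRMS γ y) q

/-- The probability, under `w`, that the plug-in test of size `α` accepts. -/
def acceptPIA {n : ℕ} (α : ℝ) (w : Model d p n) : ℝ :=
  (w.dataLaw D.X).real {y | D.testStat y ≤ D.critPIA (1 - α) y}

/-- The probability, under `w`, that the refined moment selection test of size `α` accepts. -/
def acceptRMS {n : ℕ} (α γ : ℝ) (w : Model d p n) : ℝ :=
  (w.dataLaw D.X).real {y | D.testStat y ≤ D.critRMS γ (1 - α + 2 * γ) y}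

/-! ### Assumptions on the ingredients of the test -/

/-- Design points. -/
structure DesignConditions : Prop where
  bounded : ∀ i, ‖D.X i‖ < D.hmax
  counts : ∃ C₁ C₂ : ℝ, 0 < C₁ ∧ C₁ < C₂ ∧ ∀ᶠ n : ℕ in atTop, ∀ i : ℕ, ∀ h ∈ D.H n,
    C₁ * n * h ^ d ≤ D.M n h i ∧ (D.M n h i : ℝ) ≤ C₂ * n * h ^ d ∧
    C₁ * n * (h / 2) ^ d ≤ D.M n (h / 2) i

/-- Bandwidth values. -/
structure BandwidthConditions : Prop where
  a_pos : 0 < D.a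
  a_lt : D.a < 1
  hmax_pos : 0 < D.hmax
  hmin_pos : ∀ n, 0 < D.hmin n
  hmin_lim : Tendsto D.hmin atTop (𝓝 0)
  card : ∃ C : ℝ, 0 < C ∧ ∀ᶠ n : ℕ in atTop, ((D.H n).ncard : ℝ) ≤ C * Real.log n

/-- Kernel. -/
structure KernelConditions : Prop where
  nonneg : ∀ x, 0 ≤ D.K x
  support : ∀ x, 1 < ‖x‖ → D.K x = 0
  le_one : ∀ x, D.K x ≤ 1
  lower : ∃ C : ℝ, 0 < C ∧ C < 1 ∧ ∀ x, ‖x‖ ≤ 1 / 2 → C ≤ D.K x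

/-- Sets of test points. -/
def TestPointConditions : Prop :=
  ∀ n, ∀ h ∈ D.H n,
    (∀ i ∈ D.I n h, ∀ j ∈ D.I n h, i ≠ j → 2 * h < ‖D.X i - D.X j‖) ∧
    (∀ i : Fin n, ∃ j ∈ D.I n h, ‖D.X i - D.X j‖ ≤ 2 * h)

/-- Estimators of the covariance matrices: statistics with values in the positive semidefinite
matrices such that `max_i ‖Σ̂_i - Σ_i‖ = o_p(n^{-κ})` in the spectral norm, uniformly over the
models of the class `𝓖₀`. -/
structure VarianceEstimatorConditions (c : ClassConstants) (κ : ℝ) : Prop where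
  measurable : ∀ n i m₁ m₂, Measurable (fun y : Fin n → Vec p => D.sigmaHat n y i m₁ m₂)
  posSemidef : ∀ n y i, (D.sigmaHat n y i).PosSemidef
  consistent : ∀ η : ℝ, 0 < η → ∀ ε : ℝ, 0 < ε → ∀ᶠ n : ℕ in atTop,
    ∀ w ∈ nullClass p c D.X n,
      (w.dataLaw D.X).real {y | ∃ i : Fin n,
        η * (n : ℝ) ^ (-κ) < ‖Matrix.toEuclideanCLM (𝕜 := ℝ) (D.sigmaHat n y i - w.cov i)‖} ≤ ε

end TestSetup

end CMITest

end

noncomputable section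

namespace CMITest

/-! ### Replacing independent summands one at a time -/

/-! Both tests compare a maximum of standardized kernel averages with a quantile of a Gaussian
analogue. For a set `A` of triples, `gaussCDF w A` is the distribution function of the maximum over
`A` when the errors are replaced by normal vectors with the true covariance matrices. Three facts,
uniform over models and over nonempty `A`, tie everything to it. (1) Errors. Lindeberg replacement
with the smooth indicator `exp (-∑ exp (β (u_s - t)))`, whose third-order remainder does not involve
the number of indices (`softInd_taylor`, `measure_forall_linForm_le`). The total error is of order
`n (β B)^3`, where `B` is of order `(n hmin^d)^(-1/2)`; for `β` of order `(log n)^3` the rate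
condition makes it vanish. (2) Bootstrap. Normal vectors with true and with estimated covariance
matrices are coupled through square roots; `‖√S - √S'‖² ≤ ‖S - S'‖` (`norm_sqrtCLM_sub_le`) makes
the coupling close (`gaussPi_forall_le_of_close`). (3) Anti-concentration. The law of a maximum of
jointly normal variables with unit variances has a nondecreasing density with respect to the
standard normal law, so it puts little mass on short intervals (`measure_forall_le_ratio`,
`measureReal_forall_le_add`). Shifts by `η = (log n)^(-2)` are therefore harmless. `Approx` records
these facts at one sample size with a common error `ε`. Since the null hypothesis makes the mean
part of each statistic nonpositive, the level of the plug-in test follows, and for `f = 0` the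
reverse inequality. For moment selection let `l` be close to the `1 - γ` quantile of the full
maximum. Outside an event of probability about `2γ` all standardized errors lie in `[-l, l]`; then
every triple with standardized mean above `-l` survives the pretest, and the maximum over these
triples exceeds the critical value with probability at most about `α - 2γ`. The other triples have
statistics at most `0`, but the critical value may be negative when few triples survive. This is
settled by a dichotomy (`exists_event_critRMS`) on the triples with mean above `-l - 2M`. If `N` of
them share component and bandwidth, these `N` independent statistics survive with high probability
and push the critical value up to `0`. If not, there are at most `p N |H_n|` of them. The number of
test points grows exponentially in `|H_n|`, which forces `|H_n| = O(l²)`, so the errors of these few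
triples stay below `l - 2M`; the relevant statistics are then at most `-M`, while the critical value
is at least `-M`. -/

theorem integrable_of_abs_le_one {Ω : Type*} [MeasurableSpace Ω] {μ : Measure Ω}
    [IsFiniteMeasure μ] {Φ : Ω → ℝ} (hΦ : Measurable Φ) (hb : ∀ x, |Φ x| ≤ 1) : Integrable Φ μ :=
  Integrable.of_bound hΦ.aestronglyMeasurable 1 (ae_of_all _ hb)

theorem abs_integral_le_of_abs_le {Ω : Type*} [MeasurableSpace Ω] {μ : Measure Ω}
    [IsProbabilityMeasure μ] {f : Ω → ℝ} {C : ℝ} (h : ∀ x, |f x| ≤ C) : |∫ x, f x ∂μ| ≤ C := by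
  simpa using norm_integral_le_of_norm_le_const (μ := μ) (f := f) (C := C) (ae_of_all _ h)

theorem integral_pi_succ {n : ℕ} {E : Type*} [MeasurableSpace E]
    (μ : Fin (n + 1) → Measure E) [∀ i, IsProbabilityMeasure (μ i)]
    {Φ : (Fin (n + 1) → E) → ℝ} (hΦ : Measurable Φ) (hb : ∀ x, |Φ x| ≤ 1) :
    ∫ x, Φ x ∂(Measure.pi μ)
      = ∫ e, ∫ y, Φ (Fin.cons e y) ∂(Measure.pi fun i : Fin n => μ i.succ) ∂(μ 0) := by
  have h := (measurePreserving_piFinSuccAbove μ 0).symm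
  rw [← h.integral_comp' (g := Φ), integral_prod]
  · simp only [MeasurableEquiv.piFinSuccAbove_symm_apply, Fin.insertNthEquiv, Fin.insertNth_zero,
      Equiv.coe_fn_mk, Fin.succAbove_zero]
    rfl
  · exact integrable_of_abs_le_one (hΦ.comp (MeasurableEquiv.measurable _)) fun x => hb _

/-- Lindeberg's replacement argument on a product space. -/
theorem abs_integral_pi_sub_le {E : Type*} [MeasurableSpace E] (δ : ℝ) :
    ∀ {n : ℕ} (μ ν : Fin n → Measure E) [∀ i, IsProbabilityMeasure (μ i)]
    [∀ i, IsProbabilityMeasure (ν i)] (Φ : (Fin n → E) → ℝ), Measurable Φ → (∀ x, |Φ x| ≤ 1) →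
    (∀ j x, |∫ e, Φ (Function.update x j e) ∂(μ j) - ∫ e, Φ (Function.update x j e) ∂(ν j)| ≤ δ) →
    |∫ x, Φ x ∂(Measure.pi μ) - ∫ x, Φ x ∂(Measure.pi ν)| ≤ n * δ := by
  intro n
  induction n with
  | zero =>
    intro μ ν _ _ Φ _ _ _
    have : Measure.pi μ = Measure.pi ν := by
      rw [Measure.pi_of_empty μ isEmptyElim, Measure.pi_of_empty ν isEmptyElim]
    simp [this]
  | succ n ih =>
    intro μ ν _ _ Φ hΦ hb h
    have hcons : Measurable fun q : E × (Fin n → E) => Φ (Fin.cons q.1 q.2) := by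
      refine hΦ.comp (measurable_pi_iff.2 fun i => ?_)
      refine Fin.cases ?_ (fun i => ?_) i
      · exact measurable_fst
      · exact (measurable_pi_apply i).comp measurable_snd
    set μ' := fun i : Fin n => μ i.succ
    set ν' := fun i : Fin n => ν i.succ
    have hI : ∀ (ρ : Measure E) [IsProbabilityMeasure ρ] (σ : Measure (Fin n → E))
        [IsProbabilityMeasure σ],
        Integrable (fun q : E × (Fin n → E) => Φ (Fin.cons q.1 q.2)) (ρ.prod σ) := fun ρ _ σ _ =>
      integrable_of_abs_le_one hcons fun x => hb _
    rw [integral_pi_succ μ hΦ hb, integral_pi_succ ν hΦ hb]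
    have h1 : |∫ e, ∫ y, Φ (Fin.cons e y) ∂(Measure.pi μ') ∂(μ 0)
        - ∫ e, ∫ y, Φ (Fin.cons e y) ∂(Measure.pi ν') ∂(μ 0)| ≤ n * δ := by
      rw [← integral_sub (hI (μ 0) (Measure.pi μ')).integral_prod_left
        (hI (μ 0) (Measure.pi ν')).integral_prod_left]
      refine abs_integral_le_of_abs_le fun e => ?_
      refine ih μ' ν' (fun y => Φ (Fin.cons e y)) (hcons.comp measurable_prodMk_left)
        (fun y => hb _) fun j y => ?_
      have hc : ∀ x, (Fin.cons e (Function.update y j x) : Fin (n + 1) → E)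
          = Function.update (Fin.cons e y) j.succ x := fun x => Fin.cons_update _ _ _ _
      simpa only [hc] using h j.succ (Fin.cons e y)
    have h2 : |∫ e, ∫ y, Φ (Fin.cons e y) ∂(Measure.pi ν') ∂(μ 0)
        - ∫ e, ∫ y, Φ (Fin.cons e y) ∂(Measure.pi ν') ∂(ν 0)| ≤ δ := by
      rw [integral_integral_swap (f := fun e y => Φ (Fin.cons e y)) (hI (μ 0) (Measure.pi ν')),
        integral_integral_swap (f := fun e y => Φ (Fin.cons e y)) (hI (ν 0) (Measure.pi ν')),
        ← integral_sub (hI (μ 0) (Measure.pi ν')).integral_prod_right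
        (hI (ν 0) (Measure.pi ν')).integral_prod_right]
      refine abs_integral_le_of_abs_le fun y => ?_
      -- The hypothesis concerns updates of a full vector, so some element is needed in the slot
      -- that gets overwritten.
      rcases isEmpty_or_nonempty E with hE | ⟨⟨e0⟩⟩
      · exact absurd (IsProbabilityMeasure.measure_univ (μ := μ 0))
          (by simp [Measure.eq_zero_of_isEmpty (μ 0)])
      · have hc : ∀ x, Function.update (Fin.cons e0 y : Fin (n + 1) → E) 0 x = Fin.cons x y :=
          fun x => Fin.update_cons_zero _ _ _
        simpa only [hc] using h 0 (Fin.cons e0 y)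
    have := abs_sub_le (∫ e, ∫ y, Φ (Fin.cons e y) ∂(Measure.pi μ') ∂(μ 0))
      (∫ e, ∫ y, Φ (Fin.cons e y) ∂(Measure.pi ν') ∂(μ 0))
      (∫ e, ∫ y, Φ (Fin.cons e y) ∂(Measure.pi ν') ∂(ν 0))
    push_cast
    linarith

/-! ### Taylor expansion -/

theorem abs_sub_le_of_deriv {f f' : ℝ → ℝ} {C r : ℝ} (hf : ∀ x, HasDerivAt f (f' x) x)
    (hr0 : 0 ≤ r) (hr1 : r ≤ 1) (hC : ∀ x, 0 ≤ x → x ≤ 1 → |f' x| ≤ C) : |f r - f 0| ≤ C := by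
  have := norm_image_sub_le_of_norm_deriv_le_segment' (f := f) (f' := f') (C := C) (a := 0) (b := 1)
    (fun x _ => (hf x).hasDerivWithinAt) (fun x hx => hC x hx.1 hx.2.le) r ⟨hr0, hr1⟩
  have hC0 : 0 ≤ C := (abs_nonneg _).trans (hC 0 le_rfl zero_le_one)
  rw [Real.norm_eq_abs] at this
  nlinarith

/-- The mean value inequality on `[0, 1]`, applied to the second derivative and then to the
successive remainders. The constant is `C` instead of `C / 6`, which suffices. -/
theorem abs_taylor_two_le {f f₁ f₂ f₃ : ℝ → ℝ} {C : ℝ} (h₁ : ∀ x, HasDerivAt f (f₁ x) x)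
    (h₂ : ∀ x, HasDerivAt f₁ (f₂ x) x) (h₃ : ∀ x, HasDerivAt f₂ (f₃ x) x)
    (hC : ∀ x, |f₃ x| ≤ C) : |f 1 - (f 0 + f₁ 0 + f₂ 0 / 2)| ≤ C := by
  have a1 : ∀ x, 0 ≤ x → x ≤ 1 → |f₂ x - f₂ 0| ≤ C := fun x hx hx' =>
    abs_sub_le_of_deriv h₃ hx hx' fun y _ _ => hC y
  have a2 : ∀ x, 0 ≤ x → x ≤ 1 → |f₁ x - x * f₂ 0 - f₁ 0| ≤ C := fun x hx hx' => by
    have := abs_sub_le_of_deriv (f := fun x => f₁ x - x * f₂ 0) (f' := fun x => f₂ x - 1 * f₂ 0)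
      (fun y => (h₂ y).sub ((hasDerivAt_id y).mul_const _)) hx hx'
      (fun y hy hy' => by simpa using a1 y hy hy')
    simpa using this
  have a3 := abs_sub_le_of_deriv (f := fun x => f x - x ^ 2 / 2 * f₂ 0 - x * f₁ 0)
      (f' := fun x => f₁ x - x * f₂ 0 - f₁ 0) (fun y => by
        have e1 : HasDerivAt (fun x : ℝ => x ^ 2 / 2) y y := by
          simpa using (hasDerivAt_pow 2 y).div_const 2
        simpa using ((h₁ y).fun_sub (e1.mul_const (f₂ 0))).fun_sub
          ((hasDerivAt_id' y).mul_const (f₁ 0)))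
      zero_le_one le_rfl a2
  convert a3 using 2
  ring

/-! ### A smooth approximation of the indicator of `{u | ∀ s ∈ A, u s ≤ t}` -/

/-- `exp (-∑_{s ∈ A} exp (β (u_s - t)))`. -/
def softInd {ι : Type*} (A : Finset ι) (β t : ℝ) (u : ι → ℝ) : ℝ :=
  Real.exp (-∑ s ∈ A, Real.exp (β * (u s - t)))

/-- The `k`-th derivative along `ξ` of `∑_{s ∈ A} exp (β (u_s - t))`. -/
def expSum {ι : Type*} (A : Finset ι) (β t : ℝ) (ξ : ι → ℝ) (k : ℕ) (u : ι → ℝ) : ℝ :=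
  ∑ s ∈ A, (β * ξ s) ^ k * Real.exp (β * (u s - t))

section SoftInd

variable {ι : Type*} (A : Finset ι) (β t : ℝ)

theorem softInd_nonneg (u : ι → ℝ) : 0 ≤ softInd A β t u := (Real.exp_pos _).le

theorem softInd_le_one (u : ι → ℝ) : softInd A β t u ≤ 1 := by
  rw [softInd, Real.exp_le_one_iff, neg_nonpos]
  positivity

theorem softInd_eq (ξ u : ι → ℝ) : softInd A β t u = Real.exp (-expSum A β t ξ 0 u) := by
  simp [softInd, expSum]

theorem hasDerivAt_expSum (u ξ : ι → ℝ) (k : ℕ) (r : ℝ) :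
    HasDerivAt (fun r : ℝ => expSum A β t ξ k (fun s => u s + r * ξ s))
      (expSum A β t ξ (k + 1) (fun s => u s + r * ξ s)) r := by
  unfold expSum
  refine HasDerivAt.fun_sum fun s _ => ?_
  have h : HasDerivAt (fun r : ℝ => β * (u s + r * ξ s - t)) (β * ξ s) r := by
    simpa using ((((hasDerivAt_id r).mul_const (ξ s)).const_add (u s)).sub_const t).const_mul β
  exact (h.exp.const_mul ((β * ξ s) ^ k)).congr_deriv (by ring)

theorem expSum_zero_nonneg (ξ u : ι → ℝ) : 0 ≤ expSum A β t ξ 0 u := by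
  unfold expSum; simp only [pow_zero, one_mul]; positivity

theorem abs_expSum_le {ξ : ι → ℝ} {b : ℝ} (hb : ∀ s ∈ A, |β * ξ s| ≤ b) (k : ℕ) (u : ι → ℝ) :
    |expSum A β t ξ k u| ≤ b ^ k * expSum A β t ξ 0 u := by
  unfold expSum
  rw [Finset.mul_sum]
  refine (Finset.abs_sum_le_sum_abs _ _).trans (Finset.sum_le_sum fun s hs => ?_)
  rw [abs_mul, abs_pow, abs_of_pos (Real.exp_pos _), pow_zero, one_mul]
  gcongr
  exact hb s hs

/-- The linear and the quadratic term of the expansion of `softInd` at `u`. -/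
def softQuad (u ξ : ι → ℝ) : ℝ :=
  -expSum A β t ξ 1 u * softInd A β t u
    + (expSum A β t ξ 1 u ^ 2 - expSum A β t ξ 2 u) * softInd A β t u / 2

/-- Along the segment the third derivative is a polynomial in `v 1, v 2, v 3` times `exp (-v 0)`,
where `|v k| ≤ b ^ k * v 0`. The factor `exp (-v 0)` absorbs all powers of `v 0`, so the bound is
free of the cardinality of `A`. -/
theorem softInd_taylor (u : ι → ℝ) {ξ : ι → ℝ} {b : ℝ} (hb0 : 0 ≤ b)
    (hb : ∀ s ∈ A, |β * ξ s| ≤ b) :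
    |softInd A β t (fun s => u s + ξ s) - (softInd A β t u + softQuad A β t u ξ)|
      ≤ 13 * b ^ 3 := by
  set v : ℕ → ℝ → ℝ := fun k r => expSum A β t ξ k (fun s => u s + r * ξ s) with hv
  have hd : ∀ k r, HasDerivAt (v k) (v (k + 1) r) r := fun k r => hasDerivAt_expSum A β t u ξ k r
  have hE : ∀ r, HasDerivAt (fun r => Real.exp (-v 0 r)) (-v 1 r * Real.exp (-v 0 r)) r := fun r => by
    exact (hd 0 r).fun_neg.exp.congr_deriv (by ring)
  have h2 : ∀ r, HasDerivAt (fun r => -v 1 r * Real.exp (-v 0 r))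
      ((v 1 r ^ 2 - v 2 r) * Real.exp (-v 0 r)) r := fun r => by
    exact ((hd 1 r).fun_neg.fun_mul (hE r)).congr_deriv (by ring)
  have h3 : ∀ r, HasDerivAt (fun r => (v 1 r ^ 2 - v 2 r) * Real.exp (-v 0 r))
      ((3 * v 1 r * v 2 r - v 1 r ^ 3 - v 3 r) * Real.exp (-v 0 r)) r := fun r => by
    exact ((((hd 1 r).fun_pow 2).fun_sub (hd 2 r)).fun_mul (hE r)).congr_deriv (by
      push_cast; ring)
  have key := abs_taylor_two_le hE h2 h3 (C := 13 * b ^ 3) (fun r => by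
    have hv0 : 0 ≤ v 0 r := expSum_zero_nonneg A β t ξ _
    have b1 : |v 1 r| ≤ b ^ 1 * v 0 r := abs_expSum_le A β t hb 1 _
    have b2 : |v 2 r| ≤ b ^ 2 * v 0 r := abs_expSum_le A β t hb 2 _
    have b3 : |v 3 r| ≤ b ^ 3 * v 0 r := abs_expSum_le A β t hb 3 _
    -- From `x ^ k ≤ k! * exp x` for `k = 1, 2, 3`; the constant is `13 = 3 * 2 + 6 + 1`.
    have e1 : v 0 r ≤ Real.exp (v 0 r) := by
      simpa using Real.pow_div_factorial_le_exp (v 0 r) hv0 1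
    have e2 : v 0 r ^ 2 ≤ 2 * Real.exp (v 0 r) := by
      have := Real.pow_div_factorial_le_exp (v 0 r) hv0 2
      simp [Nat.factorial] at this; linarith
    have e3 : v 0 r ^ 3 ≤ 6 * Real.exp (v 0 r) := by
      have := Real.pow_div_factorial_le_exp (v 0 r) hv0 3
      simp [Nat.factorial] at this; linarith
    have hpoly : |3 * v 1 r * v 2 r - v 1 r ^ 3 - v 3 r|
        ≤ b ^ 3 * (3 * v 0 r ^ 2 + v 0 r ^ 3 + v 0 r) := by
      calc |3 * v 1 r * v 2 r - v 1 r ^ 3 - v 3 r|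
          ≤ |3 * v 1 r * v 2 r| + |v 1 r ^ 3| + |v 3 r| :=
            (abs_sub _ _).trans (add_le_add_left (abs_sub _ _) _)
        _ = 3 * |v 1 r| * |v 2 r| + |v 1 r| ^ 3 + |v 3 r| := by
            rw [abs_mul, abs_mul, abs_pow]; norm_num
        _ ≤ 3 * (b ^ 1 * v 0 r) * (b ^ 2 * v 0 r) + (b ^ 1 * v 0 r) ^ 3 + b ^ 3 * v 0 r := by
            gcongr
        _ = _ := by ring
    rw [abs_mul, abs_of_pos (Real.exp_pos _), Real.exp_neg, ← div_eq_mul_inv,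
      div_le_iff₀ (Real.exp_pos _)]
    refine hpoly.trans ?_
    have := mul_le_mul_of_nonneg_left (show 3 * v 0 r ^ 2 + v 0 r ^ 3 + v 0 r
      ≤ 13 * Real.exp (v 0 r) by linarith) (pow_nonneg hb0 3)
    linarith)
  simp only [hv, one_mul, zero_mul, add_zero] at key
  rw [← softInd_eq, ← softInd_eq] at key
  convert key using 2
  unfold softQuad
  ring

/-- Each exponential in the sum is at most `exp (-(β η))`, and `exp (-x) ≥ 1 - x`. This direction
pays for the cardinality of `A`, but only logarithmically in the choice of `β η`. -/
theorem softInd_ge {u : ι → ℝ} {η ε : ℝ} (hβ : 0 ≤ β) (hN : A.card * Real.exp (-(β * η)) ≤ ε)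
    (h : ∀ s ∈ A, u s ≤ t - η) : 1 - ε ≤ softInd A β t u := by
  have : ∑ s ∈ A, Real.exp (β * (u s - t)) ≤ ε := by
    refine (Finset.sum_le_card_nsmul _ _ (Real.exp (-(β * η))) fun s hs => ?_).trans ?_
    · rw [Real.exp_le_exp]
      nlinarith [h s hs]
    · simpa using hN
  have := Real.add_one_le_exp (-∑ s ∈ A, Real.exp (β * (u s - t)))
  unfold softInd
  linarith

/-- A single index above the level makes the sum at least `1 / ε`, and `exp (-(1 / ε)) ≤ ε`. -/
theorem softInd_le {u : ι → ℝ} {η ε : ℝ} (hβ : 0 ≤ β) (hε : 0 < ε)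
    (hN : Real.exp (-(β * η)) ≤ ε) (h : ¬ ∀ s ∈ A, u s ≤ t + η) : softInd A β t u ≤ ε := by
  push Not at h
  obtain ⟨s, hs, h⟩ := h
  have h1 : 1 / ε ≤ ∑ s ∈ A, Real.exp (β * (u s - t)) := by
    refine le_trans ?_ (Finset.single_le_sum (f := fun s => Real.exp (β * (u s - t)))
      (fun i _ => (Real.exp_pos _).le) hs)
    calc 1 / ε ≤ 1 / Real.exp (-(β * η)) := one_div_le_one_div_of_le (Real.exp_pos _) hN
      _ = Real.exp (β * η) := by rw [Real.exp_neg, one_div, inv_inv]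
      _ ≤ _ := by rw [Real.exp_le_exp]; nlinarith
  have h2 : softInd A β t u ≤ Real.exp (-(1 / ε)) := by
    unfold softInd; rw [Real.exp_le_exp]; linarith
  refine h2.trans ?_
  rw [Real.exp_neg, inv_le_comm₀ (Real.exp_pos _) hε]
  have := Real.add_one_le_exp (1 / ε)
  rw [← one_div]
  linarith

end SoftInd

/-! ### Gaussian approximation of the distribution of maxima -/

theorem abs_integral_le_integral {Ω : Type*} [MeasurableSpace Ω] {μ : Measure Ω}
    {f g : Ω → ℝ} (hg : Integrable g μ) (h : ∀ x, |f x| ≤ g x) :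
    |∫ x, f x ∂μ| ≤ ∫ x, g x ∂μ :=
  norm_integral_le_of_norm_le (f := f) hg (ae_of_all _ h)

/-- `μ` is a centred law on `ℝ^p` with covariance matrix `S` and absolute third moments at most
`M`. -/
structure ThirdMoments {p : ℕ} (μ : Measure (Vec p)) (S : Matrix (Fin p) (Fin p) ℝ) (M : ℝ) :
    Prop where
  mean : ∀ m, ∫ x, x m ∂μ = 0
  cov : ∀ m₁ m₂, ∫ x, x m₁ * x m₂ ∂μ = S m₁ m₂
  integrable_cube : ∀ m, Integrable (fun x : Vec p => |x m| ^ 3) μ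
  cube_le : ∀ m, ∫ x, |x m| ^ 3 ∂μ ≤ M

namespace ThirdMoments

variable {p : ℕ} {μ : Measure (Vec p)} [IsProbabilityMeasure μ] {S : Matrix (Fin p) (Fin p) ℝ}
  {M : ℝ} (h : ThirdMoments μ S M)

include h

theorem integrable_mul (m₁ m₂ : Fin p) : Integrable (fun x : Vec p => x m₁ * x m₂) μ := by
  refine (((h.integrable_cube m₁).add (h.integrable_cube m₂)).add (integrable_const 1)).mono'
    (by fun_prop) (ae_of_all _ fun x => ?_)
  have sq_le : ∀ a : ℝ, 0 ≤ a → a ^ 2 ≤ 1 + a ^ 3 := fun a ha => by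
    rcases le_total a 1 with h1 | h1
    · nlinarith [pow_nonneg ha 3]
    · nlinarith [sq_nonneg a]
  rw [Real.norm_eq_abs, abs_mul]
  simp only [Pi.add_apply]
  nlinarith [sq_le _ (abs_nonneg (x m₁)), sq_le _ (abs_nonneg (x m₂)),
    sq_nonneg (|x m₁| - |x m₂|), pow_nonneg (abs_nonneg (x m₁)) 3,
    pow_nonneg (abs_nonneg (x m₂)) 3]

theorem integrable_coord (m : Fin p) : Integrable (fun x : Vec p => x m) μ := by
  refine ((h.integrable_cube m).add (integrable_const 1)).mono'
    (by fun_prop) (ae_of_all _ fun x => ?_)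
  rw [Real.norm_eq_abs]
  simp only [Pi.add_apply]
  have ha := abs_nonneg (x m)
  rcases le_total (|x m|) 1 with h1 | h1
  · nlinarith [pow_nonneg ha 3]
  · nlinarith [one_le_pow₀ h1 (n := 2)]

/-- The linear term integrates to zero and the quadratic one sees `μ` only through `S`. The formula
thus agrees for two laws with the same covariance matrix and cancels in the replacement argument. -/
theorem integral_softQuad {ι : Type*} (A : Finset ι) (β t : ℝ) (u c : ι → ℝ) (m : ι → Fin p) :
    Integrable (fun x : Vec p => softQuad A β t u fun s => c s * x (m s)) μ ∧
    ∫ x : Vec p, softQuad A β t u (fun s => c s * x (m s)) ∂μ =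
      ∑ s ∈ A, ∑ r ∈ A, (β * c s * Real.exp (β * (u s - t))) * (β * c r * Real.exp (β * (u r - t)))
          * softInd A β t u / 2 * S (m s) (m r)
        - ∑ s ∈ A, (β * c s) ^ 2 * Real.exp (β * (u s - t)) * softInd A β t u / 2
          * S (m s) (m s) := by
  have e : (fun x : Vec p => softQuad A β t u fun s => c s * x (m s)) = fun x =>
      ∑ s ∈ A, (-(β * c s * Real.exp (β * (u s - t))) * softInd A β t u) * x (m s)
      + (∑ s ∈ A, ∑ r ∈ A, (β * c s * Real.exp (β * (u s - t)))
          * (β * c r * Real.exp (β * (u r - t))) * softInd A β t u / 2 * (x (m s) * x (m r))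
        - ∑ s ∈ A, (β * c s) ^ 2 * Real.exp (β * (u s - t)) * softInd A β t u / 2
          * (x (m s) * x (m s))) := by
    funext x
    unfold softQuad expSum
    have e1 : (∑ s ∈ A, (β * (c s * x (m s))) ^ 1 * Real.exp (β * (u s - t))) ^ 2
        = ∑ s ∈ A, ∑ r ∈ A, (β * (c s * x (m s))) ^ 1 * Real.exp (β * (u s - t))
          * ((β * (c r * x (m r))) ^ 1 * Real.exp (β * (u r - t))) := by
      rw [sq, Finset.sum_mul_sum]
    rw [e1, sub_mul, sub_div]
    simp only [Finset.sum_mul, Finset.sum_div, ← Finset.sum_neg_distrib]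
    congr 1
    · exact Finset.sum_congr rfl fun s _ => by ring
    · congr 1
      · exact Finset.sum_congr rfl fun s _ => Finset.sum_congr rfl fun r _ => by ring
      · exact Finset.sum_congr rfl fun s _ => by ring
  have i1 : ∀ a : ι → ℝ, Integrable (fun x : Vec p => ∑ s ∈ A, a s * x (m s)) μ := fun a =>
    integrable_finsetSum _ fun s _ => (h.integrable_coord _).const_mul _
  have i2 : ∀ a : ι → ι → ℝ,
      Integrable (fun x : Vec p => ∑ s ∈ A, ∑ r ∈ A, a s r * (x (m s) * x (m r))) μ := fun a =>
    integrable_finsetSum _ fun s _ => integrable_finsetSum _ fun r _ =>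
      (h.integrable_mul _ _).const_mul _
  have i3 : ∀ a : ι → ℝ,
      Integrable (fun x : Vec p => ∑ s ∈ A, a s * (x (m s) * x (m s))) μ := fun a =>
    integrable_finsetSum _ fun s _ => (h.integrable_mul _ _).const_mul _
  have i23 : ∀ (a : ι → ι → ℝ) (b : ι → ℝ), Integrable (fun x : Vec p =>
      ∑ s ∈ A, ∑ r ∈ A, a s r * (x (m s) * x (m r)) - ∑ s ∈ A, b s * (x (m s) * x (m s))) μ :=
    fun a b => (i2 a).sub (i3 b)
  rw [e]
  refine ⟨(i1 _).add (i23 _ _), ?_⟩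
  have I1 : ∀ a : ι → ℝ, ∫ x : Vec p, ∑ s ∈ A, a s * x (m s) ∂μ = 0 := fun a => by
    rw [integral_finsetSum A fun s _ => (h.integrable_coord (m s)).const_mul (a s)]
    simp only [integral_const_mul, h.mean, mul_zero, Finset.sum_const_zero]
  have I3 : ∀ a : ι → ℝ, ∫ x : Vec p, ∑ s ∈ A, a s * (x (m s) * x (m s)) ∂μ
      = ∑ s ∈ A, a s * S (m s) (m s) := fun a => by
    rw [integral_finsetSum A fun s _ => (h.integrable_mul (m s) (m s)).const_mul (a s)]
    simp only [integral_const_mul, h.cov]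
  have I2 : ∀ a : ι → ι → ℝ, ∫ x : Vec p, ∑ s ∈ A, ∑ r ∈ A, a s r * (x (m s) * x (m r)) ∂μ
      = ∑ s ∈ A, ∑ r ∈ A, a s r * S (m s) (m r) := fun a => by
    rw [integral_finsetSum A fun s _ => integrable_finsetSum A fun r _ =>
      (h.integrable_mul (m s) (m r)).const_mul (a s r)]
    refine Finset.sum_congr rfl fun s _ => ?_
    rw [integral_finsetSum A fun r _ => (h.integrable_mul (m s) (m r)).const_mul (a s r)]
    simp only [integral_const_mul, h.cov]
  rw [integral_add (i1 _) (i23 _ _), integral_sub (i2 _) (i3 _), I1, I2, I3, zero_add]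

theorem abs_integral_softInd_sub_le {ι : Type*} (A : Finset ι) {β : ℝ} (hβ : 0 ≤ β) (t : ℝ)
    (u c : ι → ℝ) (m : ι → Fin p) {B : ℝ} (hB : ∀ s ∈ A, |c s| ≤ B) (hB0 : 0 ≤ B) :
    |∫ x : Vec p, softInd A β t (fun s => u s + c s * x (m s)) ∂μ - (softInd A β t u
      + ∫ x : Vec p, softQuad A β t u (fun s => c s * x (m s)) ∂μ)| ≤ 13 * (β * B) ^ 3 * (p * M) := by
  have hm : Measurable fun x : Vec p => softInd A β t (fun s => u s + c s * x (m s)) := by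
    unfold softInd; fun_prop
  have hi : Integrable (fun x : Vec p => softInd A β t (fun s => u s + c s * x (m s))) μ :=
    integrable_of_abs_le_one hm fun x => by
      rw [abs_of_nonneg (softInd_nonneg ..)]; exact softInd_le_one ..
  have hq := (h.integral_softQuad A β t u c m).1
  have e0 : softInd A β t u = ∫ _ : Vec p, softInd A β t u ∂μ := by simp
  have hcube : Integrable (fun x : Vec p => 13 * (β * B) ^ 3 * ∑ i, |x i| ^ 3) μ :=
    (integrable_finsetSum _ fun i _ => h.integrable_cube i).const_mul _
  have hsum : Integrable (fun x : Vec p => softInd A β t u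
      + softQuad A β t u fun s => c s * x (m s)) μ := (integrable_const _).add hq
  have e1 : softInd A β t u + ∫ x : Vec p, softQuad A β t u (fun s => c s * x (m s)) ∂μ
      = ∫ x : Vec p, (softInd A β t u + softQuad A β t u fun s => c s * x (m s)) ∂μ := by
    rw [integral_add (integrable_const _) hq, ← e0]
  rw [e1, ← integral_sub hi hsum]
  refine (abs_integral_le_integral hcube fun x => ?_).trans ?_
  -- For `p = 0` the map `m : ι → Fin p` forces `A` to be empty. Otherwise the largest coordinate of
  -- `x` bounds all increments, and its cube is at most the sum of the cubes, whence the factor `p`.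
  · rcases Nat.eq_zero_or_pos p with hp | hp
    · subst hp
      have hA : A = ∅ := Finset.eq_empty_of_forall_notMem fun s _ => (m s).elim0
      subst hA
      simp [softInd, softQuad, expSum]
    · have : Nonempty (Fin p) := ⟨⟨0, hp⟩⟩
      obtain ⟨i, hi⟩ := Finite.exists_max fun i => |x i|
      refine (softInd_taylor A β t u (b := β * B * |x i|) (by positivity) fun s hs => ?_).trans ?_
      · rw [abs_mul, abs_mul, abs_of_nonneg hβ, mul_assoc]
        exact mul_le_mul_of_nonneg_left
          (mul_le_mul (hB s hs) (hi _) (abs_nonneg _) hB0) hβ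
      · have : |x i| ^ 3 ≤ ∑ i, |x i| ^ 3 :=
          Finset.single_le_sum (f := fun i => |x i| ^ 3) (fun i _ => by positivity)
            (Finset.mem_univ i)
        rw [mul_pow, mul_assoc 13]
        gcongr
  · rw [integral_const_mul, integral_finsetSum _ fun i _ => h.integrable_cube i]
    gcongr
    refine (Finset.sum_le_sum fun i _ => h.cube_le i).trans (by simp)

end ThirdMoments

/-- The linear functional `∑_j c_j x_{j,m}`. -/
def linForm {n p : ℕ} (c : Fin n → ℝ) (m : Fin p) (x : Fin n → Vec p) : ℝ := ∑ j, c j * x j m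

@[fun_prop]
theorem measurable_linForm {n p : ℕ} (c : Fin n → ℝ) (m : Fin p) : Measurable (linForm c m) := by
  unfold linForm; fun_prop

theorem linForm_update {n p : ℕ} (c : Fin n → ℝ) (m : Fin p) (x : Fin n → Vec p) (j : Fin n)
    (e : Vec p) :
    linForm c m (Function.update x j e) = linForm c m (Function.update x j 0) + c j * e m := by
  unfold linForm
  rw [Finset.sum_eq_add_sum_sdiff_singleton_of_mem (Finset.mem_univ j),
    Finset.sum_eq_add_sum_sdiff_singleton_of_mem (Finset.mem_univ j)
      (fun i => c i * (Function.update x j 0) i m)]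
  have : ∀ e : Vec p, ∑ i ∈ Finset.univ \ {j}, c i * (Function.update x j e) i m
      = ∑ i ∈ Finset.univ \ {j}, c i * x i m := fun e =>
    Finset.sum_congr rfl fun i hi => by
      rw [Function.update_of_ne (by simpa using hi)]
  rw [this, this]
  simp
  ring

theorem measurableSet_forall_le {Ω ι : Type*} [MeasurableSpace Ω] (A : Finset ι) {X : ι → Ω → ℝ}
    (hX : ∀ s, Measurable (X s)) (t : ℝ) : MeasurableSet {x | ∀ s ∈ A, X s x ≤ t} := by
  have : {x | ∀ s ∈ A, X s x ≤ t} = ⋂ s ∈ A, {x | X s x ≤ t} := by ext; simp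
  rw [this]
  exact Finset.measurableSet_biInter _ fun s _ => measurableSet_le (hX s) measurable_const

/-- Comparison of the distributions of the maxima of linear functionals of two families of
independent vectors with the same first and second moments. -/
theorem measure_forall_linForm_le {n p : ℕ} {ι : Type*} {A : Finset ι} (hA : A.Nonempty)
    (c : ι → Fin n → ℝ) (m : ι → Fin p) (μ ν : Fin n → Measure (Vec p))
    [∀ i, IsProbabilityMeasure (μ i)] [∀ i, IsProbabilityMeasure (ν i)]
    {S : Fin n → Matrix (Fin p) (Fin p) ℝ} {M : ℝ} (hμ : ∀ j, ThirdMoments (μ j) (S j) M)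
    (hν : ∀ j, ThirdMoments (ν j) (S j) M) {B β η ε : ℝ} (hB0 : 0 ≤ B)
    (hB : ∀ s ∈ A, ∀ j, |c s j| ≤ B) (hβ : 0 ≤ β) (hε : 0 < ε)
    (hN : A.card * Real.exp (-(β * η)) ≤ ε) (t : ℝ) :
    (Measure.pi μ).real {x | ∀ s ∈ A, linForm (c s) (m s) x ≤ t} ≤
      (Measure.pi ν).real {x | ∀ s ∈ A, linForm (c s) (m s) x ≤ t + 2 * η} + 2 * ε
        + n * (26 * (β * B) ^ 3 * (p * M)) := by
  -- Centring at `t + η` makes `Φ` at least `1 - ε` where the maximum is at most `t`, and at most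
  -- `ε` where it exceeds `t + 2 * η`.
  set Φ : (Fin n → Vec p) → ℝ := fun x => softInd A β (t + η) fun s => linForm (c s) (m s) x with hΦ
  have hm : Measurable Φ := by
    simp only [hΦ]; unfold softInd; fun_prop
  have hb : ∀ x, |Φ x| ≤ 1 := fun x => by
    rw [abs_of_nonneg (softInd_nonneg ..)]; exact softInd_le_one ..
  have hcmp : |∫ x, Φ x ∂(Measure.pi μ) - ∫ x, Φ x ∂(Measure.pi ν)|
      ≤ n * (26 * (β * B) ^ 3 * (p * M)) := by
    -- Both laws are expanded around the vector with entry `0` in slot `j`. The quadratic parts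
    -- coincide, and the two remainders give `26 = 2 * 13`.
    refine abs_integral_pi_sub_le _ μ ν Φ hm hb fun j x => ?_
    have k1 := (hμ j).abs_integral_softInd_sub_le A hβ (t + η)
      (fun s => linForm (c s) (m s) (Function.update x j 0)) (fun s => c s j) m
      (fun s hs => hB s hs j) hB0
    have k2 := (hν j).abs_integral_softInd_sub_le A hβ (t + η)
      (fun s => linForm (c s) (m s) (Function.update x j 0)) (fun s => c s j) m
      (fun s hs => hB s hs j) hB0
    rw [((hμ j).integral_softQuad A β _ _ _ m).2] at k1
    rw [((hν j).integral_softQuad A β _ _ _ m).2] at k2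
    have e1 : ∀ e : Vec p, Φ (Function.update x j e) = softInd A β (t + η) fun s =>
        linForm (c s) (m s) (Function.update x j 0) + c s j * e (m s) := fun e => by
      simp only [hΦ]
      congr 1
      funext s
      exact linForm_update _ _ _ _ _
    simp only [e1]
    rw [abs_le] at k1 k2 ⊢
    constructor <;> linarith [k1.1, k1.2, k2.1, k2.2]
  have hS : ∀ t, MeasurableSet {x : Fin n → Vec p | ∀ s ∈ A, linForm (c s) (m s) x ≤ t} := fun t =>
    measurableSet_forall_le A (fun s => measurable_linForm _ _) t
  have hcard : (1 : ℝ) ≤ A.card := by exact_mod_cast hA.card_pos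
  have hN1 : Real.exp (-(β * η)) ≤ ε := by nlinarith [Real.exp_pos (-(β * η))]
  have lo : (Measure.pi μ).real {x | ∀ s ∈ A, linForm (c s) (m s) x ≤ t} - ε
      ≤ ∫ x, Φ x ∂(Measure.pi μ) := by
    have : ∫ x, ({x | ∀ s ∈ A, linForm (c s) (m s) x ≤ t}.indicator (fun _ => (1 : ℝ)) x - ε)
        ∂(Measure.pi μ) ≤ ∫ x, Φ x ∂(Measure.pi μ) := by
      refine integral_mono (((integrable_const _).indicator (hS t)).sub (integrable_const _))
        (integrable_of_abs_le_one hm hb) fun x => ?_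
      by_cases hx : ∀ s ∈ A, linForm (c s) (m s) x ≤ t
      · rw [Set.indicator_of_mem (by exact hx)]
        exact softInd_ge A β (t + η) hβ hN fun s hs => by simpa using hx s hs
      · rw [Set.indicator_of_notMem (by exact hx)]
        linarith [softInd_nonneg A β (t + η) fun s => linForm (c s) (m s) x]
    rw [integral_sub ((integrable_const _).indicator (hS t)) (integrable_const _),
      integral_indicator_const _ (hS t)] at this
    simpa using this
  have hi : ∫ x, Φ x ∂(Measure.pi ν)
      ≤ (Measure.pi ν).real {x | ∀ s ∈ A, linForm (c s) (m s) x ≤ t + 2 * η} + ε := by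
    have : ∫ x, Φ x ∂(Measure.pi ν) ≤ ∫ x, ({x | ∀ s ∈ A, linForm (c s) (m s) x
        ≤ t + 2 * η}.indicator (fun _ => (1 : ℝ)) x + ε) ∂(Measure.pi ν) := by
      refine integral_mono (integrable_of_abs_le_one hm hb)
        (((integrable_const _).indicator (hS _)).add (integrable_const _)) fun x => ?_
      by_cases hx : ∀ s ∈ A, linForm (c s) (m s) x ≤ t + 2 * η
      · rw [Set.indicator_of_mem (by exact hx)]
        linarith [softInd_le_one A β (t + η) fun s => linForm (c s) (m s) x]
      · rw [Set.indicator_of_notMem (by exact hx), zero_add]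
        exact softInd_le A β _ hβ hε hN1 (by convert hx using 4; ring)
    rw [integral_add ((integrable_const _).indicator (hS _)) (integrable_const _),
      integral_indicator_const _ (hS _)] at this
    simpa using this
  linarith [(abs_le.1 hcmp).2]

/-! ### Normal distributions on the line -/

section Normal

variable {Ω : Type*} [MeasurableSpace Ω] {P : Measure Ω}

theorem measureReal_ge_le_exp_of_le {X : Ω → ℝ} {v v' : NNReal} (h : P.map X = gaussianReal 0 v)
    (hv : v ≤ v') {t : ℝ} (ht : 0 ≤ t) :
    P.real {ω | t ≤ X ω} ≤ Real.exp (-t ^ 2 / (2 * v')) := by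
  -- A push-forward along a map that is not a.e. measurable is zero, so it could not be a normal
  -- law.
  have hX : AEMeasurable X P := AEMeasurable.of_map_ne_zero (by
    rw [h]; exact IsProbabilityMeasure.ne_zero _)
  have hs : HasSubgaussianMGF X v' P := by
    refine ⟨fun s => ?_, fun s => ?_⟩
    · have := integrable_exp_mul_gaussianReal (μ := 0) (v := v) s
      rw [← h, integrable_map_measure (by fun_prop) hX] at this
      exact this
    · rw [mgf_gaussianReal h, Real.exp_le_exp]
      have : (v : ℝ) ≤ v' := hv
      nlinarith [mul_le_mul_of_nonneg_right this (sq_nonneg s)]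
  exact hs.measure_ge_le ht

theorem measureReal_ge_le_exp {X : Ω → ℝ} {v : NNReal} (h : P.map X = gaussianReal 0 v) {t : ℝ}
    (ht : 0 ≤ t) : P.real {ω | t ≤ X ω} ≤ Real.exp (-t ^ 2 / (2 * v)) :=
  measureReal_ge_le_exp_of_le h le_rfl ht

theorem gaussianReal_Ioc (a b : ℝ) :
    (gaussianReal 0 1).real (Set.Ioc a b) = ∫ x in Set.Ioc a b, gaussianPDFReal 0 1 x := by
  rw [Measure.real, gaussianReal_apply_eq_integral 0 one_ne_zero, ENNReal.toReal_ofReal]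
  exact setIntegral_nonneg measurableSet_Ioc fun x _ => gaussianPDFReal_nonneg _ _ _

theorem gaussianReal_Ioc_le {a b C : ℝ} (hab : a ≤ b)
    (h : ∀ x ∈ Set.Ioc a b, gaussianPDFReal 0 1 x ≤ C) :
    (gaussianReal 0 1).real (Set.Ioc a b) ≤ (b - a) * C := by
  rw [gaussianReal_Ioc]
  refine (setIntegral_mono_on (integrable_gaussianPDFReal 0 1).integrableOn
    (integrableOn_const (C := C) (by simp)) measurableSet_Ioc h).trans ?_
  simp [hab]

theorem le_gaussianReal_Ioc {a b C : ℝ} (hab : a ≤ b)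
    (h : ∀ x ∈ Set.Ioc a b, C ≤ gaussianPDFReal 0 1 x) :
    (b - a) * C ≤ (gaussianReal 0 1).real (Set.Ioc a b) := by
  rw [gaussianReal_Ioc]
  refine le_trans ?_ (setIntegral_mono_on (integrableOn_const (C := C) (by simp))
    (integrable_gaussianPDFReal 0 1).integrableOn measurableSet_Ioc h)
  simp [hab]

theorem gaussianPDFReal_le_mul_exp {u v C : ℝ} (h : v ^ 2 - u ^ 2 ≤ 2 * C) :
    gaussianPDFReal 0 1 u ≤ gaussianPDFReal 0 1 v * Real.exp C := by
  simp only [gaussianPDFReal]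
  rw [mul_assoc _ _ (Real.exp C), ← Real.exp_add]
  gcongr
  simp only [sub_zero, NNReal.coe_one, mul_one]
  linarith

/-- Within `1 / (Q + 1)` of a point of `[-Q, Q]` the normal density changes by a bounded factor
only. Relative to its value at `x + η` it is at most `e` times larger on the left interval and at
most `e ^ 3` times smaller on the right one, whence `exp 4`. -/
theorem gaussianReal_Ioc_ratio {x η Q : ℝ} (hQ : |x| ≤ Q) (hη0 : 0 ≤ η) (hη : η ≤ 1 / (Q + 1)) :
    (gaussianReal 0 1).real (Set.Ioc x (x + η)) * (1 / (Q + 1)) ≤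
      Real.exp 4 * η * (gaussianReal 0 1).real (Set.Ioc (x + η) (x + η + 1 / (Q + 1))) := by
  have hQ0 : 0 ≤ Q := (abs_nonneg x).trans hQ
  set r := 1 / (Q + 1) with hr
  have hr0 : 0 < r := by positivity
  have hrQ : r * (Q + 1) = 1 := by rw [hr]; field_simp
  have hr1 : r ≤ 1 := by nlinarith
  obtain ⟨hx1, hx2⟩ := abs_le.1 hQ
  have h1 := gaussianReal_Ioc_le (a := x) (b := x + η)
    (C := gaussianPDFReal 0 1 (x + η) * Real.exp 1) (by linarith) fun u hu =>
      gaussianPDFReal_le_mul_exp (by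
        have e : (x + η) ^ 2 - u ^ 2 = (x + η - u) * (x + η + u) := by ring
        rw [e]
        have a1 : 0 ≤ x + η - u := by linarith [hu.2]
        have a2 : x + η - u ≤ r := by linarith [hu.1]
        have a3 : x + η + u ≤ 2 * (Q + 1) := by linarith [hu.2]
        nlinarith [mul_le_mul_of_nonneg_left a3 a1,
          mul_le_mul_of_nonneg_right a2 (by linarith : 0 ≤ Q + 1)])
  have h2 := le_gaussianReal_Ioc (a := x + η) (b := x + η + r)
    (C := gaussianPDFReal 0 1 (x + η) * Real.exp (-3)) (by linarith) fun u hu => by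
      have := gaussianPDFReal_le_mul_exp (u := x + η) (v := u) (C := 3) (by
        have e : u ^ 2 - (x + η) ^ 2 = (u - (x + η)) * (x + η + u) := by ring
        rw [e]
        have a1 : 0 ≤ u - (x + η) := by linarith [hu.1]
        have a2 : u - (x + η) ≤ r := by linarith [hu.2]
        have a3 : x + η + u ≤ 3 * (Q + 1) := by linarith [hu.2]
        nlinarith [mul_le_mul_of_nonneg_left a3 a1,
          mul_le_mul_of_nonneg_right a2 (by linarith : 0 ≤ Q + 1)])
      have e3 : Real.exp 3 * Real.exp (-3) = 1 := by rw [← Real.exp_add]; simp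
      calc _ ≤ gaussianPDFReal 0 1 u * Real.exp 3 * Real.exp (-3) := by gcongr
        _ = _ := by rw [mul_assoc, e3, mul_one]
  have e4 : Real.exp 4 * Real.exp (-3) = Real.exp 1 := by rw [← Real.exp_add]; norm_num
  have hp := gaussianPDFReal_nonneg 0 1 (x + η)
  calc _ ≤ (x + η - x) * (gaussianPDFReal 0 1 (x + η) * Real.exp 1) * r := by gcongr
    _ = Real.exp 4 * η * ((x + η + r - (x + η)) * (gaussianPDFReal 0 1 (x + η) * Real.exp (-3))) := by
      rw [← e4]; ring
    _ ≤ _ := by gcongr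

theorem measureReal_exists_lt_le [IsProbabilityMeasure P] {ι : Type*} {X : ι → Ω → ℝ} (A : Finset ι)
    (h : ∀ i ∈ A, P.map (X i) = gaussianReal 0 1) {t : ℝ} (ht : 0 ≤ t) :
    P.real {ω | ¬ ∀ i ∈ A, X i ω ≤ t} ≤ A.card * Real.exp (-t ^ 2 / 2) := by
  calc _ ≤ P.real (⋃ i ∈ A, {ω | t ≤ X i ω}) := by
        refine measureReal_mono (fun ω hω => ?_) (measure_ne_top _ _)
        have hω : ¬ ∀ i ∈ A, X i ω ≤ t := hω
        push Not at hω
        obtain ⟨i, hi, hlt⟩ := hω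
        exact Set.mem_iUnion₂.2 ⟨i, hi, hlt.le⟩
    _ ≤ ∑ i ∈ A, P.real {ω | t ≤ X i ω} := measureReal_biUnion_finset_le _ _
    _ ≤ ∑ i ∈ A, Real.exp (-t ^ 2 / 2) := Finset.sum_le_sum fun i hi => by
        simpa using measureReal_ge_le_exp (h i hi) ht
    _ = _ := by simp

end Normal

/-! ### Anti-concentration of Gaussian maxima -/

section AntiConcentration

variable {Ω : Type*} [MeasurableSpace Ω] {P : Measure Ω} {ι : Type*} [Fintype ι]
  {X : ι → Ω → ℝ}

/-- `t ↦ P(i is the first index of the maximum | X i = t)` is a monotone function. -/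
theorem exists_monotone_argmax_law [LinearOrder ι] (hX : HasGaussianLaw (fun ω i => X i ω) P)
    (hm : ∀ i, Measurable (X i)) (h0 : ∀ i, ∫ ω, X i ω ∂P = 0) (h1 : ∀ i, Var[X i; P] = 1) (i : ι) :
    ∃ G : ℝ → ENNReal, Monotone G ∧ ∀ I : Set ℝ, MeasurableSet I →
      P ({ω | X i ω ∈ I} ∩ {ω | ∀ j, (j < i → X j ω < X i ω) ∧ X j ω ≤ X i ω}) =
        ∫⁻ t in I, G t ∂(gaussianReal 0 1) := by
  have hP : IsProbabilityMeasure P := hX.isProbabilityMeasure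
  have hL2 : ∀ j, MemLp (X j) 2 P := fun j => (hX.eval j).memLp_two
  set ρ : ι → ℝ := fun j => cov[X j, X i; P] with hρ
  -- From `0 ≤ Var (X j - X i) = 2 - 2 * ρ j`. Unit variances enter here, and this bound is what
  -- makes the conditional probability monotone.
  have hρ1 : ∀ j, ρ j ≤ 1 := fun j => by
    have := variance_nonneg (X j - X i) P
    rw [variance_sub (hL2 j) (hL2 i), h1, h1] at this
    simp only [hρ]; linarith
  -- The residuals of the regression on `X i`; uncorrelated with `X i`, hence independent of it by
  -- joint normality.
  set V : Ω → ι → ℝ := fun ω j => X j ω - ρ j * X i ω with hV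
  have hVm : Measurable V := measurable_pi_iff.2 fun j => (hm j).sub ((hm i).const_mul _)
  have hind : IndepFun (X i) V P := by
    have hj : HasGaussianLaw (fun ω => ((fun _ : Unit => X i ω), fun j => V ω j)) P := by
      let L : (ι → ℝ) →L[ℝ] (Unit → ℝ) × (ι → ℝ) :=
        (ContinuousLinearMap.pi fun _ => ContinuousLinearMap.proj i).prod
          (ContinuousLinearMap.pi fun j =>
            ContinuousLinearMap.proj j - ρ j • ContinuousLinearMap.proj i)
      exact hX.map L
    have := HasGaussianLaw.indepFun_of_covariance_eval (X := fun _ : Unit => X i)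
      (Y := fun j ω => V ω j) hj (fun _ j => by
        have e : (fun ω => V ω j) = X j - fun ω => ρ j * X i ω := rfl
        rw [e, covariance_sub_right (hL2 i) (hL2 j) ((hL2 i).const_mul _),
          covariance_const_mul_right, covariance_self (hm i).aemeasurable, h1, covariance_comm]
        simp [hρ])
    exact this.comp (measurable_pi_apply ()) measurable_id
  have hlaw : P.map (X i) = gaussianReal 0 1 := by
    rw [(hX.eval i).map_eq_gaussianReal, h0, h1]; simp
  -- Given `X i = t`, index `i` is the first maximizer iff `V ∈ R t`; the sets `R t` increase with
  -- `t` because `1 - ρ j ≥ 0`.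
  set R : ℝ → Set (ι → ℝ) := fun t => {v | ∀ j, (j < i → v j < (1 - ρ j) * t) ∧ v j ≤ (1 - ρ j) * t}
    with hR
  refine ⟨fun t => P.map V (R t), fun s t hst => measure_mono fun v hv j => ?_, fun I hI => ?_⟩
  · have := mul_le_mul_of_nonneg_left hst (sub_nonneg.2 (hρ1 j))
    exact ⟨fun hj => ((hv j).1 hj).trans_le this, (hv j).2.trans this⟩
  · have hRm : MeasurableSet {q : ℝ × (ι → ℝ) | q.2 ∈ R q.1} := by
      have : {q : ℝ × (ι → ℝ) | q.2 ∈ R q.1} = ⋂ j, ({q | j < i → q.2 j < (1 - ρ j) * q.1} ∩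
          {q | q.2 j ≤ (1 - ρ j) * q.1}) := by
        ext q; simp [hR, forall_and]
      rw [this]
      refine MeasurableSet.iInter fun j => MeasurableSet.inter ?_
        (measurableSet_le (by fun_prop) (by fun_prop))
      by_cases hj : j < i
      · simp only [hj, true_imp_iff]
        exact measurableSet_lt (by fun_prop) (by fun_prop)
      · simp [hj]
    have hset : {ω | X i ω ∈ I} ∩ {ω | ∀ j, (j < i → X j ω < X i ω) ∧ X j ω ≤ X i ω}
        = (fun ω => (X i ω, V ω)) ⁻¹' ((I ×ˢ Set.univ) ∩ {q | q.2 ∈ R q.1}) := by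
      ext ω
      simp only [Set.mem_inter_iff, Set.mem_preimage, Set.mem_prod, Set.mem_univ, and_true, hR, hV]
      refine and_congr Iff.rfl (forall_congr' fun j => ?_)
      refine and_congr (imp_congr_right fun _ => ?_) ?_
      · constructor <;> intro h <;> linarith
      · constructor <;> intro h <;> linarith
    have hpr := (indepFun_iff_map_prod_eq_prod_map_map (hm i).aemeasurable hVm.aemeasurable).1 hind
    have hPV : IsProbabilityMeasure (P.map V) :=
      Measure.isProbabilityMeasure_map hVm.aemeasurable
    rw [hset, ← Measure.map_apply ((hm i).prodMk hVm)
      ((hI.prod MeasurableSet.univ).inter hRm), hpr, hlaw,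
      Measure.prod_apply ((hI.prod MeasurableSet.univ).inter hRm), ← lintegral_indicator hI]
    refine lintegral_congr fun t => ?_
    by_cases ht : t ∈ I
    · rw [Set.indicator_of_mem ht]
      congr 1
      ext v
      simp [ht]
    · rw [Set.indicator_of_notMem ht]
      convert measure_empty (μ := P.map V)
      ext v
      simp [ht]

/-- With `G = ∑ i, G i` nondecreasing, the mass of the maximum on `(a, b]` is at most `G b` times
the normal mass of `(a, b]`, while `G b` times the normal mass of `(b, c]` is at most the mass of
the maximum on `(b, c]`, hence at most `1`. -/
theorem measure_forall_le_ratio [LinearOrder ι] [Nonempty ι]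
    (hX : HasGaussianLaw (fun ω i => X i ω) P) (hm : ∀ i, Measurable (X i))
    (h0 : ∀ i, ∫ ω, X i ω ∂P = 0) (h1 : ∀ i, Var[X i; P] = 1) (a b c : ℝ) :
    P ({ω | ∀ i, X i ω ≤ b} \ {ω | ∀ i, X i ω ≤ a}) * gaussianReal 0 1 (Set.Ioc b c)
      ≤ gaussianReal 0 1 (Set.Ioc a b) := by
  have hP : IsProbabilityMeasure P := hX.isProbabilityMeasure
  choose G hG hGI using exists_monotone_argmax_law hX hm h0 h1
  set E : ι → Set Ω := fun i => {ω | ∀ j, (j < i → X j ω < X i ω) ∧ X j ω ≤ X i ω} with hE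
  have hEm : ∀ i, MeasurableSet (E i) := fun i => by
    have : E i = ⋂ j, ({ω | j < i → X j ω < X i ω} ∩ {ω | X j ω ≤ X i ω}) := by
      ext; simp [hE, forall_and]
    rw [this]
    refine MeasurableSet.iInter fun j => MeasurableSet.inter ?_ (measurableSet_le (hm j) (hm i))
    by_cases hj : j < i
    · simp only [hj, true_imp_iff]
      exact measurableSet_lt (hm j) (hm i)
    · simp [hj]
  have hdisj : Pairwise (Function.onFun Disjoint E) := by
    intro i j hij
    refine Set.disjoint_left.2 fun ω hi hj => ?_
    rcases lt_or_gt_of_ne hij with h | h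
    · exact absurd ((hj i).1 h) (not_lt.2 (hi j).2)
    · exact absurd ((hi j).1 h) (not_lt.2 (hj i).2)
  -- Breaking ties by the smallest index makes the events `E i` a partition, without any
  -- nondegeneracy of the covariances.
  have hcov : ∀ ω, ∃ i, ω ∈ E i := fun ω => by
    obtain ⟨k, hk⟩ := Finite.exists_max fun i => X i ω
    have hne : (Finset.univ.filter fun i => ∀ j, X j ω ≤ X i ω).Nonempty := ⟨k, by simpa using hk⟩
    refine ⟨Finset.min' _ hne, fun j => ⟨fun hj => ?_, ?_⟩⟩
    · by_contra hlt
      have hmin := (Finset.mem_filter.1 (Finset.min'_mem _ hne)).2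
      exact absurd (Finset.min'_le _ j (Finset.mem_filter.2 ⟨Finset.mem_univ _, fun l =>
        (hmin l).trans (not_lt.1 hlt)⟩)) (not_le.2 hj)
    · exact (Finset.mem_filter.1 (Finset.min'_mem _ hne)).2 j
  have up : P ({ω | ∀ i, X i ω ≤ b} \ {ω | ∀ i, X i ω ≤ a})
      ≤ (∑ i, G i b) * gaussianReal 0 1 (Set.Ioc a b) := by
    calc _ ≤ P (⋃ i, ({ω | X i ω ∈ Set.Ioc a b} ∩ E i)) := by
          refine measure_mono fun ω hω => ?_
          obtain ⟨i, hi⟩ := hcov ω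
          have hb : ∀ i, X i ω ≤ b := hω.1
          have ha : ¬ ∀ i, X i ω ≤ a := hω.2
          refine Set.mem_iUnion.2 ⟨i, ⟨?_, hb i⟩, hi⟩
          by_contra hlt
          exact ha fun j => (hi j).2.trans (not_lt.1 hlt)
      _ ≤ ∑ i, P ({ω | X i ω ∈ Set.Ioc a b} ∩ E i) := measure_iUnion_fintype_le _ _
      _ = ∑ i, ∫⁻ t in Set.Ioc a b, G i t ∂(gaussianReal 0 1) :=
          Finset.sum_congr rfl fun i _ => hGI i _ measurableSet_Ioc
      _ ≤ ∑ i, ∫⁻ _ in Set.Ioc a b, G i b ∂(gaussianReal 0 1) :=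
          Finset.sum_le_sum fun i _ => setLIntegral_mono' measurableSet_Ioc fun t ht => hG i ht.2
      _ = _ := by simp [Finset.sum_mul]
  have lo : (∑ i, G i b) * gaussianReal 0 1 (Set.Ioc b c) ≤ 1 := by
    calc _ = ∑ i, ∫⁻ _ in Set.Ioc b c, G i b ∂(gaussianReal 0 1) := by simp [Finset.sum_mul]
      _ ≤ ∑ i, ∫⁻ t in Set.Ioc b c, G i t ∂(gaussianReal 0 1) :=
          Finset.sum_le_sum fun i _ => setLIntegral_mono' measurableSet_Ioc fun t ht => hG i ht.1.le
      _ = ∑ i, P ({ω | X i ω ∈ Set.Ioc b c} ∩ E i) :=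
          Finset.sum_congr rfl fun i _ => (hGI i _ measurableSet_Ioc).symm
      _ ≤ ∑ i, P (E i) := Finset.sum_le_sum fun i _ => measure_mono Set.inter_subset_right
      _ = P (⋃ i, E i) := by
          rw [measure_iUnion hdisj hEm, tsum_fintype]
      _ ≤ 1 := prob_le_one
  calc _ ≤ (∑ i, G i b) * gaussianReal 0 1 (Set.Ioc a b) * gaussianReal 0 1 (Set.Ioc b c) := by
        gcongr
    _ = ((∑ i, G i b) * gaussianReal 0 1 (Set.Ioc b c)) * gaussianReal 0 1 (Set.Ioc a b) := by ring
    _ ≤ 1 * gaussianReal 0 1 (Set.Ioc a b) := by gcongr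
    _ = _ := one_mul _

/-- Anti-concentration of the maximum of jointly Gaussian standard normal variables. -/
theorem measureReal_forall_le_add [Nonempty ι] (hX : HasGaussianLaw (fun ω i => X i ω) P)
    (hm : ∀ i, Measurable (X i)) (h0 : ∀ i, ∫ ω, X i ω ∂P = 0) (h1 : ∀ i, Var[X i; P] = 1)
    {η Q : ℝ} (hQ : 1 ≤ Q) (hη0 : 0 ≤ η) (hη : η ≤ 1 / (Q + 1)) (x : ℝ) :
    P.real {ω | ∀ i, X i ω ≤ x + η} ≤ P.real {ω | ∀ i, X i ω ≤ x} +
      (Real.exp 4 * η * (Q + 1) + Fintype.card ι * Real.exp (-(Q - 1) ^ 2 / 2)) := by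
  have hP : IsProbabilityMeasure P := hX.isProbabilityMeasure
  have hlaw : ∀ i, P.map (X i) = gaussianReal 0 1 := fun i => by
    rw [(hX.eval i).map_eq_gaussianReal, h0, h1]; simp
  have hcard : (1 : ℝ) ≤ Fintype.card ι := by exact_mod_cast Fintype.card_pos
  have hr1 : 1 / (Q + 1) ≤ 1 := by rw [div_le_one (by linarith)]; linarith
  have hQ1 : 0 < Q + 1 := by linarith
  -- For `|x| ≤ Q` the density ratio decides. For `x > Q` a union bound shows that the left side can
  -- gain at most the tail; for `x < -Q` already one variable below `x + η ≤ -(Q - 1)` is unlikely.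
  rcases le_or_gt |x| Q with hx | hx
  · let e : ι ≃ Fin (Fintype.card ι) := Fintype.equivFin ι
    let _ : LinearOrder ι := LinearOrder.lift' e e.injective
    have hratio := measure_forall_le_ratio hX hm h0 h1 x (x + η) (x + η + 1 / (Q + 1))
    have hreal : P.real ({ω | ∀ i, X i ω ≤ x + η} \ {ω | ∀ i, X i ω ≤ x})
        * (gaussianReal 0 1).real (Set.Ioc (x + η) (x + η + 1 / (Q + 1)))
        ≤ (gaussianReal 0 1).real (Set.Ioc x (x + η)) := by
      rw [Measure.real, Measure.real, ← ENNReal.toReal_mul]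
      exact ENNReal.toReal_mono (measure_ne_top _ _) hratio
    have hg := gaussianReal_Ioc_ratio hx hη0 hη
    have hpos : 0 < (gaussianReal 0 1).real (Set.Ioc (x + η) (x + η + 1 / (Q + 1))) := by
      have hr0 : 0 < 1 / (Q + 1) := by positivity
      have := le_gaussianReal_Ioc (a := x + η) (b := x + η + 1 / (Q + 1))
        (C := gaussianPDFReal 0 1 (|x| + 2)) (by linarith) fun u hu => by
          have := gaussianPDFReal_le_mul_exp (u := |x| + 2) (v := u) (C := 0) (by
            have : |u| ≤ |x| + 2 := abs_le.2 ⟨by linarith [hu.1, neg_abs_le x],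
              by linarith [hu.2, le_abs_self x]⟩
            nlinarith [sq_abs u, abs_nonneg u])
          simpa using this
      have h3 := gaussianPDFReal_pos 0 1 (|x| + 2) one_ne_zero
      have : 0 < (x + η + 1 / (Q + 1) - (x + η)) * gaussianPDFReal 0 1 (|x| + 2) :=
        mul_pos (by linarith) h3
      linarith
    set d := P.real ({ω | ∀ i, X i ω ≤ x + η} \ {ω | ∀ i, X i ω ≤ x})
    have hd : d ≤ Real.exp 4 * η * (Q + 1) := by
      refine le_of_mul_le_mul_right ?_ hpos
      have h4 := mul_le_mul_of_nonneg_right hreal (by positivity : 0 ≤ 1 / (Q + 1))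
      have h5 := mul_le_mul_of_nonneg_right (h4.trans hg) hQ1.le
      field_simp at h5 ⊢
      linarith
    have hsub : P.real {ω | ∀ i, X i ω ≤ x + η} ≤ P.real {ω | ∀ i, X i ω ≤ x} + d := by
      refine (measureReal_mono fun ω hω => ?_).trans (measureReal_union_le _ _)
      by_cases h : ω ∈ {ω | ∀ i, X i ω ≤ x}
      · exact Or.inl h
      · exact Or.inr ⟨hω, h⟩
    have : 0 ≤ (Fintype.card ι : ℝ) * Real.exp (-(Q - 1) ^ 2 / 2) := by positivity
    linarith
  · have hη1 : 0 ≤ Real.exp 4 * η * (Q + 1) := by positivity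
    rcases lt_abs.1 hx with hx | hx
    · have h2 := measureReal_exists_lt_le (P := P) (X := X) Finset.univ (fun i _ => hlaw i)
        (t := x) (by linarith)
      have hle : Real.exp (-x ^ 2 / 2) ≤ Real.exp (-(Q - 1) ^ 2 / 2) := by
        rw [Real.exp_le_exp]; nlinarith
      have h3 : 1 ≤ P.real {ω | ∀ i, X i ω ≤ x} + P.real {ω | ¬ ∀ i ∈ Finset.univ, X i ω ≤ x} := by
        rw [← probReal_univ (μ := P)]
        refine (measureReal_mono fun ω _ => ?_).trans (measureReal_union_le _ _)
        by_cases h : ∀ i, X i ω ≤ x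
        · exact Or.inl h
        · exact Or.inr (by simpa using h)
      have h4 : P.real {ω | ∀ i, X i ω ≤ x + η} ≤ 1 := measureReal_le_one
      have h5 : (Fintype.card ι : ℝ) * Real.exp (-x ^ 2 / 2)
        ≤ Fintype.card ι * Real.exp (-(Q - 1) ^ 2 / 2) := by gcongr
      simp only [Finset.card_univ] at h2
      linarith
    · obtain ⟨i⟩ := ‹Nonempty ι›
      have hneg : P.map (fun ω => -X i ω) = gaussianReal 0 1 := by
        have := gaussianReal_map_neg (μ := 0) (v := 1)
        rw [← hlaw i, Measure.map_map measurable_neg (hm i), neg_zero] at this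
        exact this
      have h2 := measureReal_ge_le_exp hneg (t := -(x + η)) (by linarith)
      have hle : Real.exp (-(-(x + η)) ^ 2 / (2 * (1 : NNReal))) ≤ Real.exp (-(Q - 1) ^ 2 / 2) := by
        rw [Real.exp_le_exp]
        simp only [NNReal.coe_one, mul_one]
        nlinarith
      have h3 : P.real {ω | ∀ i, X i ω ≤ x + η} ≤ P.real {ω | -(x + η) ≤ -X i ω} :=
        measureReal_mono fun ω hω => neg_le_neg (hω i)
      have h4 : Real.exp (-(Q - 1) ^ 2 / 2)
          ≤ Fintype.card ι * Real.exp (-(Q - 1) ^ 2 / 2) := by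
        nlinarith [Real.exp_pos (-(Q - 1) ^ 2 / 2)]
      have h5 : 0 ≤ P.real {ω | ∀ i, X i ω ≤ x} := measureReal_nonneg
      linarith

end AntiConcentration

open scoped RealInnerProductSpace

/-! ### Square roots of positive semidefinite matrices -/

section Sqrt

open scoped MatrixOrder

variable {p : ℕ}

/-- The operator on Euclidean space given by the square root of a matrix. -/
def sqrtCLM (S : Matrix (Fin p) (Fin p) ℝ) : Vec p →L[ℝ] Vec p :=
  Matrix.toEuclideanCLM (𝕜 := ℝ) (CFC.sqrt S)

theorem multivariateGaussian_zero_eq (S : Matrix (Fin p) (Fin p) ℝ) :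
    multivariateGaussian 0 S = (stdGaussian (Vec p)).map (sqrtCLM S) := by
  simp only [multivariateGaussian, zero_add]
  rfl

theorem sqrtCLM_symm (S : Matrix (Fin p) (Fin p) ℝ) (x y : Vec p) :
    ⟪sqrtCLM S x, y⟫ = ⟪x, sqrtCLM S y⟫ := by
  have h : IsSelfAdjoint (sqrtCLM S) := (CFC.sqrt_nonneg S).isSelfAdjoint.map _
  exact h.isSymmetric x y

theorem sqrtCLM_nonneg (S : Matrix (Fin p) (Fin p) ℝ) (x : Vec p) : 0 ≤ ⟪x, sqrtCLM S x⟫ := by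
  rw [sqrtCLM, Matrix.inner_toEuclideanCLM]
  have := (Matrix.nonneg_iff_posSemidef.1 (CFC.sqrt_nonneg S)).re_dotProduct_nonneg (x.ofLp)
  simpa using this

theorem sqrtCLM_sq {S : Matrix (Fin p) (Fin p) ℝ} (hS : S.PosSemidef) (x y : Vec p) :
    ⟪sqrtCLM S x, sqrtCLM S y⟫ = ⟪x, Matrix.toEuclideanCLM (𝕜 := ℝ) S y⟫ := by
  rw [sqrtCLM_symm]
  congr 1
  rw [sqrtCLM, ← ContinuousLinearMap.comp_apply, ← ContinuousLinearMap.mul_def, ← map_mul,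
    CFC.sqrt_mul_sqrt_self _ hS.nonneg]

/-- Let `b` be a unit eigenvector of `√S - √S'` with eigenvalue `l`. Then `⟪b, (S - S') b⟫ = l *
(⟪b, √S b⟫ + ⟪b, √S' b⟫)`. The two terms of the sum are nonnegative and differ by `l`, so the sum is
at least `|l|` and `l ^ 2 ≤ ‖S - S'‖`. No lower bound on the spectrum is needed. -/
theorem norm_sqrtCLM_sub_le {S S' : Matrix (Fin p) (Fin p) ℝ} (hS : S.PosSemidef)
    (hS' : S'.PosSemidef) (x : Vec p) :
    ‖sqrtCLM S x - sqrtCLM S' x‖ ^ 2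
      ≤ ‖Matrix.toEuclideanCLM (𝕜 := ℝ) (S - S')‖ * ‖x‖ ^ 2 := by
  set δ := ‖Matrix.toEuclideanCLM (𝕜 := ℝ) (S - S')‖ with hδ
  set D : Vec p →ₗ[ℝ] Vec p := (sqrtCLM S - sqrtCLM S' : Vec p →L[ℝ] Vec p).toLinearMap with hD
  have hDx : ∀ x, D x = sqrtCLM S x - sqrtCLM S' x := fun x => rfl
  have hsym : D.IsSymmetric := fun x y => by
    rw [hDx, hDx, inner_sub_left, inner_sub_right, sqrtCLM_symm, sqrtCLM_symm]
  have hn : Module.finrank ℝ (Vec p) = p := by simp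
  set b := hsym.eigenvectorBasis hn
  set l := hsym.eigenvalues hn
  have hb : ∀ i, D (b i) = l i • b i := fun i => by
    exact hsym.apply_eigenvectorBasis hn i
  have hl : ∀ i, l i ^ 2 ≤ δ := fun i => by
    have hn1 : ‖b i‖ = 1 := b.orthonormal.1 i
    set u := sqrtCLM S (b i) with hu
    set v := sqrtCLM S' (b i) with hv
    have huv : u - v = l i • b i := hb i
    have e : ⟪b i, Matrix.toEuclideanCLM (𝕜 := ℝ) (S - S') (b i)⟫ = l i * (⟪b i, u⟫ + ⟪b i, v⟫) := by
      rw [map_sub, sub_apply, inner_sub_right, ← sqrtCLM_sq hS,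
        ← sqrtCLM_sq hS']
      have : ⟪u - v, u + v⟫ = l i * (⟪b i, u⟫ + ⟪b i, v⟫) := by
        rw [huv, inner_smul_left, inner_add_right]; simp
      rw [← this, inner_sub_left, inner_add_right, inner_add_right, real_inner_comm u v]
      ring
    have hu0 : 0 ≤ ⟪b i, u⟫ := sqrtCLM_nonneg S _
    have hv0 : 0 ≤ ⟪b i, v⟫ := sqrtCLM_nonneg S' _
    have hdiff : ⟪b i, u⟫ - ⟪b i, v⟫ = l i := by
      rw [← inner_sub_right, huv, inner_smul_right, real_inner_self_eq_norm_sq, hn1]; simp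
    have hle : |l i * (⟪b i, u⟫ + ⟪b i, v⟫)| ≤ δ := by
      rw [← e]
      refine (abs_real_inner_le_norm _ _).trans ?_
      rw [hn1, one_mul]
      have := (Matrix.toEuclideanCLM (𝕜 := ℝ) (S - S')).le_opNorm (b i)
      rwa [hn1, mul_one] at this
    have := abs_le.1 hle
    rcases le_total 0 (l i) with h | h
    · nlinarith
    · nlinarith
  have hδ0 : 0 ≤ δ := norm_nonneg _
  rw [← hDx, ← b.sum_sq_norm_inner_right (D x), ← b.sum_sq_norm_inner_right x, Finset.mul_sum]
  refine Finset.sum_le_sum fun i _ => ?_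
  rw [← hsym (b i) x, hb, inner_smul_left, norm_mul, mul_pow]
  gcongr
  simpa using hl i

theorem norm_sqrtCLM_single_sq {S : Matrix (Fin p) (Fin p) ℝ} (hS : S.PosSemidef) (m : Fin p) :
    ‖sqrtCLM S (EuclideanSpace.single m 1)‖ ^ 2 = S m m := by
  rw [← real_inner_self_eq_norm_sq, sqrtCLM_sq hS, Matrix.inner_toEuclideanCLM]
  simp

theorem abs_entry_le_norm (S : Matrix (Fin p) (Fin p) ℝ) (m m' : Fin p) :
    |S m m'| ≤ ‖Matrix.toEuclideanCLM (𝕜 := ℝ) S‖ := by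
  have h1 : S m m' = ⟪EuclideanSpace.single m (1 : ℝ),
      Matrix.toEuclideanCLM (𝕜 := ℝ) S (EuclideanSpace.single m' 1)⟫ := by
    rw [Matrix.inner_toEuclideanCLM]; simp
  rw [h1]
  refine (abs_real_inner_le_norm _ _).trans ?_
  simpa using (Matrix.toEuclideanCLM (𝕜 := ℝ) S).le_opNorm (EuclideanSpace.single m' 1)

end Sqrt

/-! ### Products of centred Gaussian laws -/

section GaussianProduct

variable {n p : ℕ}

theorem hasGaussianLaw_id_pi (μ : Fin n → Measure (Vec p)) [∀ j, IsGaussian (μ j)] :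
    HasGaussianLaw (fun x : Fin n → Vec p => (x ·)) (Measure.pi μ) := by
  have hi : iIndepFun (fun (j : Fin n) (x : Fin n → Vec p) => x j) (Measure.pi μ) :=
    iIndepFun_pi (X := fun _ => id) fun _ => aemeasurable_id
  exact hi.hasGaussianLaw fun j =>
    ⟨by rw [(measurePreserving_eval μ j).map_eq]; infer_instance⟩

variable (S : Fin n → Matrix (Fin p) (Fin p) ℝ)

/-- The law of independent vectors `z_j ∼ N(0, S_j)`. -/
def gaussPi : Measure (Fin n → Vec p) := Measure.pi fun j => multivariateGaussian 0 (S j)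

instance : IsProbabilityMeasure (gaussPi S) := by unfold gaussPi; infer_instance

theorem hasGaussianLaw_linForm {ι : Type*} [Fintype ι] (c : ι → Fin n → ℝ) (m : ι → Fin p) :
    HasGaussianLaw (fun x i => linForm (c i) (m i) x) (gaussPi S) := by
  let L : (Fin n → Vec p) →L[ℝ] (ι → ℝ) := ContinuousLinearMap.pi fun i =>
    ∑ j, c i j • (EuclideanSpace.proj (m i)).comp (ContinuousLinearMap.proj j)
  have h := (hasGaussianLaw_id_pi fun j => multivariateGaussian 0 (S j)).map L
  have e : (fun (x : Fin n → Vec p) i => linForm (c i) (m i) x) = L ∘ fun x => (x ·) := by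
    funext x i
    simp [L, linForm]
  rw [e]
  exact h

theorem memLp_coord (j : Fin n) (m : Fin p) :
    MemLp (fun x : Fin n → Vec p => x j m) 2 (gaussPi S) := by
  have h := (hasGaussianLaw_id_pi fun j => multivariateGaussian 0 (S j)).map_fun
    ((EuclideanSpace.proj (𝕜 := ℝ) m).comp (ContinuousLinearMap.proj j))
  exact h.memLp_two

theorem integral_coord (j : Fin n) (m : Fin p) : ∫ x, x j m ∂(gaussPi S) = 0 := by
  unfold gaussPi
  have h := measurePreserving_eval (fun j => multivariateGaussian 0 (S j)) j
  rw [← integral_map (φ := fun x : Fin n → Vec p => x j) (f := fun y : Vec p => y m)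
    h.measurable.aemeasurable (by fun_prop), h.map_eq]
  have := (EuclideanSpace.proj (𝕜 := ℝ) m).integral_comp_id_comm
    (IsGaussian.integrable_id (μ := multivariateGaussian 0 (S j)))
  simpa using this

theorem integral_linForm (c : Fin n → ℝ) (m : Fin p) : ∫ x, linForm c m x ∂(gaussPi S) = 0 := by
  unfold linForm
  rw [integral_finsetSum Finset.univ fun j _ =>
    ((memLp_coord S j m).integrable (by norm_num)).const_mul (c j)]
  simp [integral_const_mul, integral_coord]

variable {S} (hS : ∀ j, (S j).PosSemidef)

include hS

theorem covariance_coord (j k : Fin n) (m m' : Fin p) :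
    cov[fun x : Fin n → Vec p => x j m, fun x => x k m'; gaussPi S]
      = if j = k then S j m m' else 0 := by
  have hi : iIndepFun (fun (j : Fin n) (x : Fin n → Vec p) => x j) (gaussPi S) :=
    iIndepFun_pi (X := fun _ => id) fun _ => aemeasurable_id
  split_ifs with h
  · subst h
    have h := measurePreserving_eval (fun j => multivariateGaussian 0 (S j)) j
    have := covariance_map (μ := gaussPi S) (Z := fun x : Fin n → Vec p => x j)
      (X := fun y : Vec p => y m) (Y := fun y : Vec p => y m') (by fun_prop) (by fun_prop)
      (measurable_pi_apply j).aemeasurable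
    unfold gaussPi at this
    rw [h.map_eq, covariance_eval_multivariateGaussian (hS j)] at this
    exact this.symm
  · exact ((hi.indepFun h).comp (φ := fun y : Vec p => y m) (ψ := fun y : Vec p => y m')
      (by fun_prop) (by fun_prop)).covariance_eq_zero (memLp_coord S j m) (memLp_coord S k m')

theorem covariance_linForm (c c' : Fin n → ℝ) (m m' : Fin p) :
    cov[linForm c m, linForm c' m'; gaussPi S] = ∑ j, c j * c' j * S j m m' := by
  have e : ∀ (c : Fin n → ℝ) m, linForm c m = fun x : Fin n → Vec p => ∑ j, c j * x j m :=
    fun c m => rfl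
  rw [e, e, covariance_fun_sum_fun_sum (fun j => (memLp_coord S j m).const_mul _)
    (fun j => (memLp_coord S j m').const_mul _)]
  simp only [covariance_const_mul_left, covariance_const_mul_right, covariance_coord hS]
  refine Finset.sum_congr rfl fun j _ => ?_
  simp
  ring

theorem variance_linForm (c : Fin n → ℝ) (m : Fin p) :
    Var[linForm c m; gaussPi S] = ∑ j, c j ^ 2 * S j m m := by
  rw [← covariance_self (measurable_linForm c m).aemeasurable, covariance_linForm hS]
  exact Finset.sum_congr rfl fun j _ => by ring

theorem map_linForm {c : Fin n → ℝ} {m : Fin p} (h : ∑ j, c j ^ 2 * S j m m = 1) :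
    (gaussPi S).map (linForm c m) = gaussianReal 0 1 := by
  have := (hasGaussianLaw_linForm S (fun _ : Unit => c) (fun _ => m)).eval ()
  rw [this.map_eq_gaussianReal, integral_linForm, variance_linForm hS, h]
  simp

/-- Anti-concentration for the maximum of standardized linear functionals. -/
theorem gaussPi_forall_le_add {ι : Type*} {A : Finset ι} (hA : A.Nonempty) {c : ι → Fin n → ℝ}
    {m : ι → Fin p} (h : ∀ i ∈ A, ∑ j, c i j ^ 2 * S j (m i) (m i) = 1) {η Q : ℝ} (hQ : 1 ≤ Q)
    (hη0 : 0 ≤ η) (hη : η ≤ 1 / (Q + 1)) (x : ℝ) :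
    (gaussPi S).real {z | ∀ i ∈ A, linForm (c i) (m i) z ≤ x + η}
      ≤ (gaussPi S).real {z | ∀ i ∈ A, linForm (c i) (m i) z ≤ x} +
      (Real.exp 4 * η * (Q + 1) + A.card * Real.exp (-(Q - 1) ^ 2 / 2)) := by
  have : Nonempty A := hA.to_subtype
  have key := measureReal_forall_le_add (hasGaussianLaw_linForm S (fun i : A => c i) fun i : A => m i)
    (fun i => measurable_linForm _ _) (fun i => integral_linForm S _ _)
    (fun i => (variance_linForm hS _ _).trans (h i i.2)) hQ hη0 hη x
  simpa using key

/-- Standardized linear functionals with disjoint supports are independent. -/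
theorem gaussPi_forall_le_eq_pow {ι : Type*} {A : Finset ι} {c : ι → Fin n → ℝ}
    {m : ι → Fin p} (h : ∀ i ∈ A, ∑ j, c i j ^ 2 * S j (m i) (m i) = 1)
    (hd : ∀ i ∈ A, ∀ k ∈ A, i ≠ k → ∀ j, c i j * c k j = 0) (x : ℝ) :
    (gaussPi S).real {z | ∀ i ∈ A, linForm (c i) (m i) z ≤ x}
      = (gaussianReal 0 1).real (Set.Iic x) ^ A.card := by
  have hi : iIndepFun (fun (i : A) z => linForm (c i) (m i) z) (gaussPi S) := by
    refine (hasGaussianLaw_linForm S (fun i : A => c i) fun i : A => m i).iIndepFun_of_covariance_eq_zero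
      fun i k hik => ?_
    have := covariance_linForm hS (c i) (c k) (m i) (m k)
    refine this.trans (Finset.sum_eq_zero fun j _ => ?_)
    rw [hd i i.2 k k.2 (fun e => hik (Subtype.ext e)), zero_mul]
  have h2 := hi.measure_inter_preimage_eq_mul Finset.univ (sets := fun _ => Set.Iic x)
    fun _ _ => measurableSet_Iic
  have e : {z : Fin n → Vec p | ∀ i ∈ A, linForm (c i) (m i) z ≤ x}
      = ⋂ i ∈ (Finset.univ : Finset A), (fun z => linForm (c i) (m i) z) ⁻¹' Set.Iic x := by
    ext z; simp
  rw [Measure.real, e, h2, ENNReal.toReal_prod]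
  have : ∀ i : A, (gaussPi S ((fun z => linForm (c i) (m i) z) ⁻¹' Set.Iic x)).toReal
      = (gaussianReal 0 1).real (Set.Iic x) := fun i => by
    rw [← Measure.map_apply (measurable_linForm _ _) measurableSet_Iic]
    rw [map_linForm hS (h i i.2)]
    rfl
  simp [this]

omit hS in
-- Since `|a| ^ 3 ≤ 6 * (exp a + exp (-a))`, the moment generating function at `±1` bounds the third
-- moment, with a constant that depends on the variances only.
theorem thirdMoments_multivariateGaussian {S : Matrix (Fin p) (Fin p) ℝ} (hS : S.PosSemidef)
    {σ : ℝ} (hσ : ∀ m, S m m ≤ σ) :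
    ThirdMoments (multivariateGaussian 0 S) S (12 * Real.exp (σ / 2)) := by
  have hint : ∀ m : Fin p, ∀ t : ℝ,
      Integrable (fun x : Vec p => Real.exp (t * x m)) (multivariateGaussian 0 S) := fun m t => by
    have hmp := measurePreserving_eval_multivariateGaussian (μ := 0) hS (i := m)
    exact hmp.integrable_comp_of_integrable (integrable_exp_mul_gaussianReal t)
  have hval : ∀ m : Fin p, ∀ t : ℝ, t ^ 2 = 1 →
      ∫ x : Vec p, Real.exp (t * x m) ∂(multivariateGaussian 0 S) ≤ Real.exp (σ / 2) := fun m t ht => by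
    have hmp := measurePreserving_eval_multivariateGaussian (μ := 0) hS (i := m)
    have := mgf_gaussianReal hmp.map_eq t
    rw [mgf] at this
    rw [this, ht, Real.exp_le_exp]
    have := hσ m
    have h0 : 0 ≤ S m m := hS.diag_nonneg
    simp [Real.coe_toNNReal _ h0]
    linarith
  have hcube : ∀ a : ℝ, |a| ^ 3 ≤ 6 * (Real.exp (1 * a) + Real.exp (-1 * a)) := fun a => by
    have h1 := Real.pow_div_factorial_le_exp |a| (abs_nonneg a) 3
    have h2 : Real.exp |a| ≤ Real.exp (1 * a) + Real.exp (-1 * a) := by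
      rcases abs_cases a with ⟨h, _⟩ | ⟨h, _⟩ <;> rw [h]
      · rw [one_mul]; linarith [Real.exp_pos (-1 * a)]
      · rw [neg_one_mul]; linarith [Real.exp_pos (1 * a)]
    simp [Nat.factorial] at h1
    linarith
  have hsum : ∀ m : Fin p, Integrable (fun x : Vec p => 6 * (Real.exp (1 * x m)
      + Real.exp (-1 * x m))) (multivariateGaussian 0 S) := fun m =>
    ((hint m 1).add (hint m (-1))).const_mul 6
  have hc3 : ∀ m : Fin p, Integrable (fun x : Vec p => |x m| ^ 3) (multivariateGaussian 0 S) :=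
    fun m => (hsum m).mono' (by fun_prop) (ae_of_all _ fun x => by
      rw [Real.norm_eq_abs, abs_of_nonneg (by positivity)]; exact hcube _)
  have hmean : ∀ m : Fin p, ∫ x : Vec p, x m ∂(multivariateGaussian 0 S) = 0 := fun m => by
    have := (EuclideanSpace.proj (𝕜 := ℝ) m).integral_comp_id_comm
      (IsGaussian.integrable_id (μ := multivariateGaussian 0 S))
    simpa using this
  have hL2 : ∀ m : Fin p, MemLp (fun x : Vec p => x m) 2 (multivariateGaussian 0 S) := fun m =>
    IsGaussian.memLp_dual _ (EuclideanSpace.proj (𝕜 := ℝ) m) 2 (by simp)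
  refine ⟨hmean, fun m m' => ?_, hc3, fun m => ?_⟩
  · have := covariance_eval_multivariateGaussian (μ := 0) hS m m'
    rw [covariance_eq_sub (hL2 m) (hL2 m'), hmean, zero_mul, sub_zero] at this
    exact this
  · refine (integral_mono (hc3 m) (hsum m) fun x => hcube _).trans ?_
    rw [integral_const_mul, integral_add (hint m 1) (hint m (-1))]
    linarith [hval m 1 (by norm_num), hval m (-1) (by norm_num)]

omit hS in
-- The source of the coupling: laws with different covariance matrices become images of the same
-- standard normal vectors.
theorem gaussPi_eq_map : gaussPi S
    = (Measure.pi fun _ : Fin n => stdGaussian (Vec p)).map fun g j => sqrtCLM (S j) (g j) := by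
  unfold gaussPi
  simp only [multivariateGaussian_zero_eq]
  rw [Measure.pi_map_pi fun j => by fun_prop]

omit hS in
/-- Comparison of Gaussian maxima by a coupling. -/
theorem gaussPi_forall_le_of_close {S' : Fin n → Matrix (Fin p) (Fin p) ℝ} {ι : Type*}
    (A : Finset ι) {c c' : ι → Fin n → ℝ} {m : ι → Fin p} {v η : ℝ} (hη : 0 ≤ η) (hv : 0 < v)
    (h : ∀ i ∈ A, ∑ j, ‖c i j • sqrtCLM (S j) (EuclideanSpace.single (m i) 1)
      - c' i j • sqrtCLM (S' j) (EuclideanSpace.single (m i) 1)‖ ^ 2 ≤ v) (t : ℝ) :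
    (gaussPi S').real {z | ∀ i ∈ A, linForm (c' i) (m i) z ≤ t}
      ≤ (gaussPi S).real {z | ∀ i ∈ A, linForm (c i) (m i) z ≤ t + η}
        + A.card * Real.exp (-η ^ 2 / (2 * v)) := by
  set G := Measure.pi fun _ : Fin n => stdGaussian (Vec p) with hG
  have hmeas : ∀ S : Fin n → Matrix (Fin p) (Fin p) ℝ,
      Measurable fun (g : Fin n → Vec p) j => sqrtCLM (S j) (g j) := fun S => by fun_prop
  have hset : ∀ (c : ι → Fin n → ℝ) t,
      MeasurableSet {z : Fin n → Vec p | ∀ i ∈ A, linForm (c i) (m i) z ≤ t} := fun c t =>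
    measurableSet_forall_le A (fun i => measurable_linForm _ _) t
  rw [gaussPi_eq_map, gaussPi_eq_map, map_measureReal_apply (hmeas _) (hset _ _),
    map_measureReal_apply (hmeas _) (hset _ _)]
  -- Under the coupling the difference of the two functionals is `∑ j, ⟪a i j, g j⟫`, which is
  -- centred normal with variance `∑ j, ‖a i j‖ ^ 2 ≤ v`; the square roots are moved onto the basis
  -- vector by self-adjointness.
  set a : ι → Fin n → Vec p := fun i j => c i j • sqrtCLM (S j) (EuclideanSpace.single (m i) 1)
      - c' i j • sqrtCLM (S' j) (EuclideanSpace.single (m i) 1) with ha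
  have hlin : ∀ (S : Fin n → Matrix (Fin p) (Fin p) ℝ) (c : Fin n → ℝ) (m : Fin p)
      (g : Fin n → Vec p), linForm c m (fun j => sqrtCLM (S j) (g j))
        = ∑ j, ⟪c j • sqrtCLM (S j) (EuclideanSpace.single m 1), g j⟫ := fun S c m g => by
    unfold linForm
    refine Finset.sum_congr rfl fun j _ => ?_
    rw [real_inner_smul_left, sqrtCLM_symm, EuclideanSpace.inner_single_left]
    simp
  have hdiff : ∀ (i : ι) (g : Fin n → Vec p), linForm (c i) (m i) (fun j => sqrtCLM (S j) (g j))
      - linForm (c' i) (m i) (fun j => sqrtCLM (S' j) (g j)) = ∑ j, ⟪a i j, g j⟫ := fun i g => by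
    rw [hlin, hlin, ← Finset.sum_sub_distrib]
    exact Finset.sum_congr rfl fun j _ => by rw [ha, inner_sub_left]
  have htail : ∀ i ∈ A, G.real {g | η ≤ ∑ j, ⟪a i j, g j⟫} ≤ Real.exp (-η ^ 2 / (2 * v)) := by
    intro i hi
    let L : (Fin n → Vec p) →L[ℝ] ℝ := ∑ j, (innerSL ℝ (a i j)).comp (ContinuousLinearMap.proj j)
    have hL : (fun g : Fin n → Vec p => ∑ j, ⟪a i j, g j⟫) = L := by
      funext g; simp [L]
    have hgl : HasGaussianLaw (fun g : Fin n → Vec p => ∑ j, ⟪a i j, g j⟫) G := by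
      rw [hL]
      exact (hasGaussianLaw_id_pi fun _ : Fin n => stdGaussian (Vec p)).map_fun L
    have hmean : ∫ g, ∑ j, ⟪a i j, g j⟫ ∂G = 0 := by
      have hI : ∀ j, Integrable (fun g : Fin n → Vec p => ⟪a i j, g j⟫) G := fun j =>
        (((hasGaussianLaw_id_pi fun _ : Fin n => stdGaussian (Vec p)).map_fun
          ((innerSL ℝ (a i j)).comp (ContinuousLinearMap.proj j))).integrable)
      rw [integral_finsetSum Finset.univ fun j _ => hI j]
      refine Finset.sum_eq_zero fun j _ => ?_
      have hmp := measurePreserving_eval (fun _ : Fin n => stdGaussian (Vec p)) j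
      have := integral_map (μ := G) (φ := fun x : Fin n → Vec p => x j)
        (f := fun y : Vec p => ⟪a i j, y⟫) hmp.measurable.aemeasurable (by fun_prop)
      rw [← this, hmp.map_eq]
      exact integral_strongDual_stdGaussian (innerSL ℝ (a i j))
    have hvar : Var[fun g : Fin n → Vec p => ∑ j, ⟪a i j, g j⟫; G] = ∑ j, ‖a i j‖ ^ 2 := by
      have := variance_sum_pi (μ := fun _ : Fin n => stdGaussian (Vec p))
        (X := fun j (x : Vec p) => ⟪a i j, x⟫)
        fun j => IsGaussian.memLp_dual _ (innerSL ℝ (a i j)) 2 (by simp)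
      have e : (fun g : Fin n → Vec p => ∑ j, ⟪a i j, g j⟫)
          = ∑ j, fun g : Fin n → Vec p => ⟪a i j, g j⟫ := by
        funext g; simp
      rw [e, this]
      refine Finset.sum_congr rfl fun j _ => ?_
      have := variance_dual_stdGaussian (innerSL ℝ (a i j))
      rw [innerSL_apply_norm] at this
      exact this
    have hlaw := hgl.map_eq_gaussianReal
    rw [hmean, hvar] at hlaw
    have := measureReal_ge_le_exp_of_le hlaw (Real.toNNReal_le_toNNReal (h i hi)) hη
    rwa [Real.coe_toNNReal _ hv.le] at this
  calc _ ≤ G.real (((fun g j => sqrtCLM (S j) (g j)) ⁻¹'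
        {z | ∀ i ∈ A, linForm (c i) (m i) z ≤ t + η}) ∪ ⋃ i ∈ A, {g | η ≤ ∑ j, ⟪a i j, g j⟫}) := by
        refine measureReal_mono (fun g hg => ?_) (measure_ne_top _ _)
        by_cases hgi : ∃ i ∈ A, η ≤ ∑ j, ⟪a i j, g j⟫
        · obtain ⟨i, hi, hgi⟩ := hgi
          exact Or.inr (Set.mem_iUnion₂.2 ⟨i, hi, hgi⟩)
        · push Not at hgi
          refine Or.inl fun i hi => ?_
          have h1 := hgi i hi
          have h2 : linForm (c' i) (m i) (fun j => sqrtCLM (S' j) (g j)) ≤ t := hg i hi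
          rw [← hdiff] at h1
          linarith
    _ ≤ _ := by
        refine (measureReal_union_le _ _).trans ?_
        gcongr
        refine (measureReal_biUnion_finset_le _ _).trans ((Finset.sum_le_sum htail).trans ?_)
        simp

end GaussianProduct

/-! ### Moments of the disturbances -/

namespace Model.DisturbanceConditions

variable {d p n : ℕ} {w : Model d p n} {c : ClassConstants} {X : ℕ → Vec d}
  (h : w.DisturbanceConditions c X)

include h

theorem integrable_rpow (i : Fin n) (m : Fin p) :
    Integrable (fun e : Vec p => |e m| ^ (4 + c.δ)) (w.law i) := by
  refine ⟨(by fun_prop : Measurable fun e : Vec p => |e m| ^ (4 + c.δ)).aestronglyMeasurable, ?_⟩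
  rw [hasFiniteIntegral_iff_ofReal (ae_of_all _ fun e => by positivity)]
  exact (h.moment i m).trans_lt ENNReal.ofReal_lt_top

theorem integral_rpow_le (i : Fin n) (m : Fin p) :
    ∫ e : Vec p, |e m| ^ (4 + c.δ) ∂(w.law i) ≤ c.Cmom := by
  rw [integral_eq_lintegral_of_nonneg_ae (ae_of_all _ fun e => by positivity)
    (h.integrable_rpow i m).1]
  exact ENNReal.toReal_le_of_le_ofReal c.Cmom_pos.le (h.moment i m)

omit h in
theorem pow_le_one_add_rpow (c : ClassConstants) {k : ℕ} (hk : k ≤ 4) (a : ℝ) :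
    |a| ^ k ≤ 1 + |a| ^ (4 + c.δ) := by
  rcases le_total |a| 1 with h1 | h1
  · have := pow_le_one₀ (abs_nonneg a) h1 (n := k)
    have h2 : 0 ≤ |a| ^ (4 + c.δ) := by positivity
    linarith
  · have : |a| ^ k ≤ |a| ^ (4 + c.δ) := by
      rw [← Real.rpow_natCast]
      refine Real.rpow_le_rpow_of_exponent_le h1 ?_
      have : (k : ℝ) ≤ 4 := by exact_mod_cast hk
      linarith [c.δ_pos]
    linarith

theorem integrable_abs_pow {k : ℕ} (hk : k ≤ 4) (i : Fin n) (m : Fin p) :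
    Integrable (fun e : Vec p => |e m| ^ k) (w.law i) := by
  have := w.prob i
  exact ((integrable_const 1).add (h.integrable_rpow i m)).mono' (by fun_prop) (ae_of_all _ fun e => by
    rw [Real.norm_eq_abs, abs_of_nonneg (by positivity)]
    exact pow_le_one_add_rpow c hk _)

theorem integral_abs_pow_le {k : ℕ} (hk : k ≤ 4) (i : Fin n) (m : Fin p) :
    ∫ e : Vec p, |e m| ^ k ∂(w.law i) ≤ 1 + c.Cmom := by
  have := w.prob i
  have hi : Integrable (fun e : Vec p => 1 + |e m| ^ (4 + c.δ)) (w.law i) :=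
    (integrable_const 1).add (h.integrable_rpow i m)
  refine (integral_mono (h.integrable_abs_pow hk i m) hi fun e =>
    pow_le_one_add_rpow c hk _).trans ?_
  rw [integral_add (integrable_const 1) (h.integrable_rpow i m)]
  have := h.integral_rpow_le i m
  simpa using this

theorem thirdMoments (i : Fin n) : ThirdMoments (w.law i) (w.cov i) (1 + c.Cmom) :=
  ⟨h.mean_zero i, fun _ _ => rfl, h.integrable_abs_pow (by norm_num) i,
    h.integral_abs_pow_le (by norm_num) i⟩

theorem cov_le (i : Fin n) (m : Fin p) : w.cov i m m ≤ 1 + c.Cmom := by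
  have := h.integral_abs_pow_le (k := 2) (by norm_num) i m
  simp only [sq, abs_mul_abs_self] at this
  exact this

theorem posSemidef_cov (i : Fin n) : (w.cov i).PosSemidef := by
  have := w.prob i
  refine Matrix.PosSemidef.of_dotProduct_mulVec_nonneg ?_ fun x => ?_
  · ext m m'
    simp [Model.cov, mul_comm]
  · have hi := (h.thirdMoments i).integrable_mul
    have e : star x ⬝ᵥ (w.cov i).mulVec x = ∫ e : Vec p, (∑ m, x m * e m) ^ 2 ∂(w.law i) := by
      have e1 : ∀ e : Vec p, (∑ m, x m * e m) ^ 2 = ∑ m, ∑ m', x m * x m' * (e m * e m') :=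
        fun e => by
          rw [sq, Finset.sum_mul_sum]
          exact Finset.sum_congr rfl fun m _ => Finset.sum_congr rfl fun m' _ => by ring
      simp only [e1]
      rw [integral_finsetSum Finset.univ fun m _ => integrable_finsetSum Finset.univ fun m' _ =>
        (hi m m').const_mul (x m * x m')]
      simp only [dotProduct, Matrix.mulVec, star_trivial]
      refine Finset.sum_congr rfl fun m _ => ?_
      rw [integral_finsetSum Finset.univ fun m' _ => (hi m m').const_mul (x m * x m'),
        Finset.mul_sum]
      refine Finset.sum_congr rfl fun m' _ => ?_
      rw [integral_const_mul, Model.cov]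
      ring
    rw [e]
    exact integral_nonneg fun e => sq_nonneg _

end Model.DisturbanceConditions

namespace ThirdMoments

theorem mono {p : ℕ} {μ : Measure (Vec p)} {S : Matrix (Fin p) (Fin p) ℝ} {M M' : ℝ}
    (h : ThirdMoments μ S M) (hM : M ≤ M') : ThirdMoments μ S M' :=
  ⟨h.mean, h.cov, h.integrable_cube, fun m => (h.cube_le m).trans hM⟩

end ThirdMoments

namespace TestSetup

variable {d p : ℕ} (D : TestSetup d p)

/-! ### Bandwidths -/

theorem H_eq_image (n : ℕ) :
    D.H n = (fun k : ℕ => D.hmax * D.a ^ k) '' {k : ℕ | D.hmin n ≤ D.hmax * D.a ^ k} := by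
  ext h
  constructor
  · rintro ⟨h1, k, rfl⟩; exact ⟨k, h1, rfl⟩
  · rintro ⟨k, h1, rfl⟩; exact ⟨h1, k, rfl⟩

section Bandwidths

variable {D} (hH : D.BandwidthConditions)

include hH

theorem injective_bandwidth : Function.Injective fun k : ℕ => D.hmax * D.a ^ k := fun _ _ h =>
  pow_right_injective₀ hH.a_pos hH.a_lt.ne (mul_left_cancel₀ hH.hmax_pos.ne' h)

theorem finite_exponents (n : ℕ) : {k : ℕ | D.hmin n ≤ D.hmax * D.a ^ k}.Finite := by
  have ht : Tendsto (fun k : ℕ => D.hmax * D.a ^ k) atTop (𝓝 0) := by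
    simpa using (tendsto_pow_atTop_nhds_zero_of_lt_one hH.a_pos.le hH.a_lt).const_mul D.hmax
  obtain ⟨N, hN⟩ := eventually_atTop.1 (ht.eventually (gt_mem_nhds (hH.hmin_pos n)))
  refine (Set.finite_lt_nat N).subset fun k hk => ?_
  by_contra hlt
  exact absurd (hN k (not_lt.1 hlt)) (not_lt.2 hk)

theorem finite_H (n : ℕ) : (D.H n).Finite := by
  rw [H_eq_image D]
  exact (finite_exponents hH n).image _

theorem finite_S (n : ℕ) : (D.S n).Finite := by
  refine (Set.finite_univ.prod (Set.finite_univ.prod (finite_H hH n))).subset fun s hs => ?_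
  exact ⟨trivial, trivial, hs.1⟩

theorem ncard_S_le (n : ℕ) : (D.S n).ncard ≤ n * (p * (D.H n).ncard) := by
  have hsub : D.S n ⊆ Set.univ ×ˢ (Set.univ ×ˢ D.H n) := fun s hs => ⟨trivial, trivial, hs.1⟩
  refine (Set.ncard_le_ncard hsub
    (Set.finite_univ.prod (Set.finite_univ.prod (finite_H hH n)))).trans ?_
  simp [Set.ncard_prod]

theorem H_pos {n : ℕ} {h : ℝ} (hh : h ∈ D.H n) : 0 < h := (hH.hmin_pos n).trans_le hh.1

theorem tendsto_ncard_H : Tendsto (fun n => (D.H n).ncard) atTop atTop := by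
  refine tendsto_atTop.2 fun K => ?_
  have hpos : 0 < D.hmax * D.a ^ K := mul_pos hH.hmax_pos (pow_pos hH.a_pos _)
  filter_upwards [hH.hmin_lim.eventually (gt_mem_nhds hpos)] with n hn
  rw [H_eq_image D, Set.ncard_image_of_injective _ (injective_bandwidth hH)]
  calc K = (Set.Iio K : Set ℕ).ncard := by simp [← Finset.coe_Iio, Set.ncard_coe_finset]
    _ ≤ _ := Set.ncard_le_ncard (fun k hk => hn.le.trans ?_) (finite_exponents hH n)
  exact mul_le_mul_of_nonneg_left
    (pow_le_pow_of_le_one hH.a_pos.le hH.a_lt.le (le_of_lt hk)) hH.hmax_pos.le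

/-- Among `|H_n|` distinct natural exponents one is at least `|H_n| - 1`, so some bandwidth is
exponentially small in `|H_n|`. -/
theorem exists_exponent (n : ℕ) (h1 : 0 < (D.H n).ncard) :
    ∃ k : ℕ, (D.H n).ncard ≤ k + 1 ∧ D.hmax * D.a ^ k ∈ D.H n := by
  by_contra hcon
  push Not at hcon
  rw [H_eq_image D, Set.ncard_image_of_injective _ (injective_bandwidth hH)] at h1 hcon
  set T := {k : ℕ | D.hmin n ≤ D.hmax * D.a ^ k} with hT
  have hsub : T ⊆ Set.Iio (T.ncard - 1) := fun k hk => by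
    by_contra hlt
    have hlt : ¬ k < T.ncard - 1 := hlt
    exact hcon k (by omega) ⟨k, hk, rfl⟩
  have := Set.ncard_le_ncard hsub (Set.finite_Iio _)
  rw [← Finset.coe_Iio, Set.ncard_coe_finset] at this
  simp at this
  omega

end Bandwidths

/-! ### Weights -/

section Weights

variable {D}

theorem weight_eq {n : ℕ} {h : ℝ} (hh : 0 < h) (i j : Fin n) :
    D.weight h i j = D.K (h⁻¹ • (D.X i - D.X j)) / ∑ k : Fin n, D.K (h⁻¹ • (D.X i - D.X k)) := by
  unfold weight Kh
  rw [← Finset.sum_div, div_div_div_cancel_right₀ (pow_pos hh d).ne']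

theorem norm_inv_smul {h : ℝ} (hh : 0 < h) (x : Vec d) : ‖h⁻¹ • x‖ = ‖x‖ / h := by
  rw [norm_smul, norm_inv, Real.norm_of_nonneg hh.le, inv_mul_eq_div]

theorem weight_eq_zero (hK : D.KernelConditions) {n : ℕ} {h : ℝ} (hh : 0 < h) {i j : Fin n}
    (hij : h < ‖D.X i - D.X j‖) : D.weight h i j = 0 := by
  rw [weight_eq hh, hK.support, zero_div]
  rwa [norm_inv_smul hh, one_lt_div hh]

theorem weight_nonneg (hK : D.KernelConditions) {n : ℕ} {h : ℝ} (hh : 0 < h) (i j : Fin n) :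
    0 ≤ D.weight h i j := by
  rw [weight_eq hh]
  exact div_nonneg (hK.nonneg _) (Finset.sum_nonneg fun k _ => hK.nonneg _)

/-- What the conditions on the design and on the kernel yield for the weights at sample size
`n`. -/
structure WeightBounds (D : TestSetup d p) (n : ℕ) (C : ℝ) : Prop where
  pos : 0 < C
  npos : 0 < n
  le : ∀ h ∈ D.H n, ∀ i j : Fin n, D.weight h i j ≤ C / (n * h ^ d)
  sum_sq_ge : ∀ h ∈ D.H n, ∀ i : Fin n, 1 / (C * (n * h ^ d)) ≤ ∑ j, D.weight h i j ^ 2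

/-- The denominators are at least of order `n h ^ d`, because the kernel is bounded below on the
ball of half the radius. The lower bound on the sum of squares is Cauchy–Schwarz: the weights sum to
one and at most `C₂ n h ^ d` of them are nonzero. -/
theorem eventually_weightBounds (hX : D.DesignConditions) (hH : D.BandwidthConditions)
    (hK : D.KernelConditions) : ∃ C, ∀ᶠ n in atTop, WeightBounds D n C := by
  obtain ⟨C₁, C₂, hC₁, hC₁₂, hev⟩ := hX.counts
  obtain ⟨c₀, hc₀, -, hlow⟩ := hK.lower
  have hC₂ : 0 < C₂ := hC₁.trans hC₁₂
  refine ⟨max (2 ^ d / (c₀ * C₁)) C₂, ?_⟩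
  set C := max (2 ^ d / (c₀ * C₁)) C₂
  have hC : 0 < C := lt_max_of_lt_right hC₂
  filter_upwards [hev, eventually_gt_atTop 0] with n hn hn0
  have hn0' : (0 : ℝ) < n := by exact_mod_cast hn0
  have hsum : ∀ h ∈ D.H n, ∀ i : Fin n,
      c₀ * (C₁ * n * (h / 2) ^ d) ≤ ∑ k : Fin n, D.K (h⁻¹ • (D.X i - D.X k)) := fun h hh i => by
    have hp := H_pos hH hh
    classical
    set T : Set (Fin n) := {j : Fin n | ‖D.X j - D.X i‖ ≤ h / 2} with hT
    have hM : (D.M n (h / 2) i : ℝ) = T.toFinset.card := by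
      rw [M, Set.ncard_eq_toFinset_card']
    calc c₀ * (C₁ * n * (h / 2) ^ d) ≤ c₀ * D.M n (h / 2) i :=
          mul_le_mul_of_nonneg_left (hn i h hh).2.2 hc₀.le
      _ = ∑ k ∈ T.toFinset, c₀ := by rw [hM]; simp [mul_comm]
      _ ≤ ∑ k ∈ T.toFinset, D.K (h⁻¹ • (D.X i - D.X k)) := by
          refine Finset.sum_le_sum fun k hk => hlow _ ?_
          have hk : ‖D.X k - D.X i‖ ≤ h / 2 := by simpa [hT] using hk
          rw [norm_inv_smul hp, norm_sub_rev, div_le_iff₀ hp]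
          linarith
      _ ≤ _ := Finset.sum_le_sum_of_subset_of_nonneg (Finset.subset_univ _) fun k _ _ => hK.nonneg _
  have hspos : ∀ h ∈ D.H n, ∀ i : Fin n, 0 < ∑ k : Fin n, D.K (h⁻¹ • (D.X i - D.X k)) :=
    fun h hh i => by
      have hp := H_pos hH hh
      refine lt_of_lt_of_le ?_ (hsum h hh i)
      positivity
  have hone : ∀ h ∈ D.H n, ∀ i : Fin n, ∑ j, D.weight h i j = 1 := fun h hh i => by
    simp only [weight_eq (H_pos hH hh), ← Finset.sum_div]
    exact div_self (hspos h hh i).ne'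
  refine ⟨hC, hn0, fun h hh i j => ?_, fun h hh i => ?_⟩
  · have hp := H_pos hH hh
    rw [weight_eq hp]
    calc _ ≤ 1 / (c₀ * (C₁ * n * (h / 2) ^ d)) :=
          div_le_div₀ zero_le_one (hK.le_one _) (by positivity) (hsum h hh i)
      _ = 2 ^ d / (c₀ * C₁) / (n * h ^ d) := by
          rw [div_pow]; field_simp
      _ ≤ _ := by gcongr; exact le_max_left _ _
  · have hp := H_pos hH hh
    classical
    set T : Set (Fin n) := {j : Fin n | ‖D.X j - D.X i‖ ≤ h} with hT
    have hM : (D.M n h i : ℝ) = T.toFinset.card := by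
      rw [M, Set.ncard_eq_toFinset_card']
    have h1 : ∑ j ∈ T.toFinset, D.weight h i j = 1 := by
      rw [← hone h hh i]
      refine Finset.sum_subset (Finset.subset_univ _) fun j _ hj => weight_eq_zero hK hp ?_
      rw [norm_sub_rev]
      simpa [hT] using hj
    have h2 := sq_sum_le_card_mul_sum_sq (s := T.toFinset) (f := fun j => D.weight h i j)
    rw [h1, ← hM] at h2
    have h3 : ∑ j ∈ T.toFinset, D.weight h i j ^ 2 ≤ ∑ j, D.weight h i j ^ 2 :=
      Finset.sum_le_sum_of_subset_of_nonneg (Finset.subset_univ _) fun j _ _ => sq_nonneg _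
    have h4 : (D.M n h i : ℝ) ≤ C * (n * h ^ d) := by
      refine (hn i h hh).2.1.trans ?_
      rw [mul_assoc]
      gcongr
      exact le_max_right _ _
    rw [div_le_iff₀ (by positivity)]
    have h5 : 0 ≤ ∑ j, D.weight h i j ^ 2 := by positivity
    nlinarith [mul_le_mul_of_nonneg_left h3 (Nat.cast_nonneg (D.M n h i) (α := ℝ)),
      mul_le_mul_of_nonneg_right h4 h5]

/-- For a smallest bandwidth `h`, the balls of radius `2 h` around the test points cover the design,
and each contains at most `C₂ n h' ^ d` design points. Hence there are at least `1 / (C₂ h' ^ d)`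
test points, which is exponential in `|H_n|` with base `a ^ (-d)`. -/
theorem exists_many_testPoints (hX : D.DesignConditions) (hH : D.BandwidthConditions)
    (hI : D.TestPointConditions) (hd : 0 < d) : ∃ C b : ℝ, 0 < C ∧ 1 < b ∧ ∀ᶠ n in atTop,
      ∃ h ∈ D.H n, C * b ^ (D.H n).ncard ≤ (D.I n h).ncard := by
  obtain ⟨C₁, C₂, hC₁, hC₁₂, hev⟩ := hX.counts
  have hC₂ : 0 < C₂ := hC₁.trans hC₁₂
  have ha := hH.a_pos
  have hm := hH.hmax_pos
  -- The counts are controlled at bandwidths in `H_n` only, so `2 h` is replaced by `h' = h * a ^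
  -- (-k₀) ≥ 2 h`. The exponent `-(k₀ + 1)` reflects `k - k₀ ≥ |H_n| - 1 - k₀`.
  obtain ⟨k₀, hk₀⟩ := exists_pow_lt_of_lt_one (show (0 : ℝ) < 1 / 2 by norm_num) hH.a_lt
  refine ⟨(D.a⁻¹ ^ d) ^ (-(k₀ + 1 : ℤ)) / (C₂ * D.hmax ^ d), D.a⁻¹ ^ d, by positivity,
    one_lt_pow₀ ((one_lt_inv₀ ha).2 hH.a_lt) hd.ne', ?_⟩
  filter_upwards [hev, eventually_gt_atTop 0, (tendsto_ncard_H hH).eventually_gt_atTop k₀]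
    with n hn hn0 hK
  have hn0' : (0 : ℝ) < n := by exact_mod_cast hn0
  obtain ⟨k, hk, hkH⟩ := exists_exponent hH n (by omega)
  refine ⟨_, hkH, ?_⟩
  set h := D.hmax * D.a ^ k with hh
  have hkk : k₀ ≤ k := by omega
  set h' := D.hmax * D.a ^ (k - k₀) with hh'
  have hrel : h = h' * D.a ^ k₀ := by
    rw [hh, hh', mul_assoc, ← pow_add, Nat.sub_add_cancel hkk]
  have hp' : 0 < h' := mul_pos hm (pow_pos ha _)
  have h2 : 2 * h ≤ h' := by rw [hrel]; nlinarith
  have hH' : h' ∈ D.H n := ⟨hkH.1.trans (by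
    change h ≤ h'
    have := H_pos hH hkH
    change 0 < h at this
    linarith), _, rfl⟩
  classical
  have hcover : (Finset.univ : Finset (Fin n)) ⊆ (D.I n h).toFinset.biUnion fun j =>
      {i : Fin n | ‖D.X i - D.X j‖ ≤ h'}.toFinset := fun i _ => by
    obtain ⟨j, hj, hij⟩ := (hI n h hkH).2 i
    exact Finset.mem_biUnion.2 ⟨j, by simpa using hj, by simpa using hij.trans h2⟩
  have hcount : (n : ℝ) ≤ (D.I n h).ncard * (C₂ * n * h' ^ d) := by
    have h1 := (Finset.card_le_card hcover).trans Finset.card_biUnion_le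
    rw [Finset.card_univ, Fintype.card_fin] at h1
    have h1' : (n : ℝ) ≤ ∑ j ∈ (D.I n h).toFinset,
        (({i : Fin n | ‖D.X i - D.X j‖ ≤ h'}.toFinset.card : ℕ) : ℝ) := by exact_mod_cast h1
    refine h1'.trans ((Finset.sum_le_card_nsmul _ _ (C₂ * n * h' ^ d) fun j _ => ?_).trans ?_)
    · have := (hn j h' hH').2.1
      rwa [M, Set.ncard_eq_toFinset_card'] at this
    · rw [nsmul_eq_mul, Set.ncard_eq_toFinset_card']
  have hcount' : 1 ≤ (D.I n h).ncard * (C₂ * h' ^ d) := by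
    have : (n : ℝ) * 1 ≤ n * ((D.I n h).ncard * (C₂ * h' ^ d)) := by linarith
    exact le_of_mul_le_mul_left this hn0'
  set b := D.a⁻¹ ^ d with hb
  have hb1 : 1 < b := one_lt_pow₀ ((one_lt_inv₀ ha).2 hH.a_lt) hd.ne'
  have hb0 : 0 < b := by linarith
  have hh'd : h' ^ d = D.hmax ^ d * (b ^ (k - k₀))⁻¹ := by
    rw [hh', mul_pow, hb, ← pow_mul, ← pow_mul, inv_pow, inv_inv, mul_comm d]
  rw [hh'd] at hcount'
  have hexp : b ^ (-(k₀ + 1 : ℤ)) * b ^ (D.H n).ncard ≤ b ^ (k - k₀) := by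
    rw [← zpow_natCast b (D.H n).ncard, ← zpow_natCast b (k - k₀), ← zpow_add₀ hb0.ne']
    refine zpow_le_zpow_right₀ hb1.le ?_
    have : ((k - k₀ : ℕ) : ℤ) = k - k₀ := by omega
    omega
  calc b ^ (-(k₀ + 1 : ℤ)) / (C₂ * D.hmax ^ d) * b ^ (D.H n).ncard
      = b ^ (-(k₀ + 1 : ℤ)) * b ^ (D.H n).ncard / (C₂ * D.hmax ^ d) := by ring
    _ ≤ b ^ (k - k₀) / (C₂ * D.hmax ^ d) := by gcongr
    _ ≤ _ := by
        rw [div_le_iff₀ (by positivity)]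
        have hbp : 0 < b ^ (k - k₀) := by positivity
        have := mul_le_mul_of_nonneg_left hcount' hbp.le
        field_simp at this ⊢
        linarith

end Weights

end TestSetup

/-! ### Symmetry of centred Gaussian laws -/

section Symmetry

variable {n p : ℕ}

theorem map_neg_multivariateGaussian (S : Matrix (Fin p) (Fin p) ℝ) :
    (multivariateGaussian 0 S).map (fun x => -x) = multivariateGaussian 0 S := by
  have h := stdGaussian_map (E := Vec p) (LinearIsometryEquiv.neg ℝ (E := Vec p))
  have h' : (stdGaussian (Vec p)).map (fun x => -x) = stdGaussian (Vec p) := h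
  rw [multivariateGaussian_zero_eq]
  conv_rhs => rw [← h']
  rw [Measure.map_map (by fun_prop) (by fun_prop), Measure.map_map (by fun_prop) (by fun_prop)]
  congr 1
  funext x
  simp

theorem map_neg_gaussPi (S : Fin n → Matrix (Fin p) (Fin p) ℝ) :
    (gaussPi S).map (fun x => -x) = gaussPi S := by
  unfold gaussPi
  have h := Measure.pi_map_pi (μ := fun j => multivariateGaussian 0 (S j))
    (f := fun (_ : Fin n) (x : Vec p) => -x) fun j => by fun_prop
  simp only [map_neg_multivariateGaussian] at h
  exact h

theorem linForm_neg_left (c : Fin n → ℝ) (m : Fin p) (x : Fin n → Vec p) :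
    linForm (-c) m x = -linForm c m x := by
  simp [linForm]

theorem linForm_neg_right (c : Fin n → ℝ) (m : Fin p) (x : Fin n → Vec p) :
    linForm c m (-x) = -linForm c m x := by
  simp [linForm]

/-- Lets lower tails of the errors be compared with the same `gaussCDF` as upper tails. -/
theorem gaussPi_forall_neg_le (S : Fin n → Matrix (Fin p) (Fin p) ℝ) {ι : Type*} (A : Finset ι)
    (c : ι → Fin n → ℝ) (m : ι → Fin p) (t : ℝ) :
    (gaussPi S).real {z | ∀ i ∈ A, linForm (-c i) (m i) z ≤ t}
      = (gaussPi S).real {z | ∀ i ∈ A, linForm (c i) (m i) z ≤ t} := by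
  conv_rhs => rw [← map_neg_gaussPi S]
  rw [map_measureReal_apply measurable_neg
    (measurableSet_forall_le A (fun i => measurable_linForm _ _) t)]
  congr 1
  ext z
  simp [linForm_neg_left, linForm_neg_right]

end Symmetry

/-! ### Standardized errors and their Gaussian analogue -/

namespace Model

/-- The values of the regression function at the design points. -/
def mean {d p n : ℕ} (w : Model d p n) (X : ℕ → Vec d) (i : Fin n) : Vec p :=
  WithLp.toLp 2 fun m => w.f m (X i)

instance {d p n : ℕ} (w : Model d p n) (i : Fin n) : IsProbabilityMeasure (w.law i) := w.prob i

/-- Translation is a measurable equivalence, so the identity holds for arbitrary `T`; the acceptance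
regions are never shown to be measurable. -/
theorem dataLaw_real {d p n : ℕ} (w : Model d p n) (X : ℕ → Vec d) (T : Set (Fin n → Vec p)) :
    (w.dataLaw X).real T = (Measure.pi w.law).real {e | w.mean X + e ∈ T} := by
  have : w.dataLaw X = (Measure.pi w.law).map (MeasurableEquiv.addLeft (w.mean X)) := rfl
  rw [this, Measure.real, MeasurableEquiv.map_apply]
  rfl

end Model

namespace TestSetup

variable {d p : ℕ} (D : TestSetup d p)

/-- The standard deviation of the kernel estimator. -/
def stdDev {n : ℕ} (w : Model d p n) (s : Fin n × Fin p × ℝ) : ℝ :=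
  √(∑ j, D.weight s.2.2 s.1 j ^ 2 * w.cov j s.2.1 s.2.1)

/-- The standardized weights. -/
def coef {n : ℕ} (w : Model d p n) (s : Fin n × Fin p × ℝ) (j : Fin n) : ℝ :=
  D.weight s.2.2 s.1 j / D.stdDev w s

/-- The distribution function of `max_{s ∈ A} (∑_j w_h(X_i, X_j) z_{j,m}) / V_s`, for independent
`z_j ∼ N(0, Σ_j)`. -/
def gaussCDF {n : ℕ} (w : Model d p n) (A : Set (Fin n × Fin p × ℝ)) (t : ℝ) : ℝ :=
  (gaussPi w.cov).real {z | ∀ s ∈ A, D.smooth z s / D.stdDev w s ≤ t}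

variable {D} {n : ℕ}

theorem smooth_add (x y : Fin n → Vec p) (s : Fin n × Fin p × ℝ) :
    D.smooth (x + y) s = D.smooth x s + D.smooth y s := by
  simp [smooth, mul_add, Finset.sum_add_distrib]

theorem smooth_div_stdDev (w : Model d p n) (z : Fin n → Vec p) (s : Fin n × Fin p × ℝ) :
    D.smooth z s / D.stdDev w s = linForm (D.coef w s) s.2.1 z := by
  unfold smooth linForm coef
  rw [Finset.sum_div]
  exact Finset.sum_congr rfl fun j _ => by ring

theorem gaussCDF_mono_right (w : Model d p n) (A : Set (Fin n × Fin p × ℝ)) :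
    Monotone (D.gaussCDF w A) := fun _ _ hst =>
  measureReal_mono fun _ hz s hs => (hz s hs).trans hst

theorem gaussCDF_anti_left (w : Model d p n) {A B : Set (Fin n × Fin p × ℝ)} (h : A ⊆ B) (t : ℝ) :
    D.gaussCDF w B t ≤ D.gaussCDF w A t :=
  measureReal_mono fun _ hz s hs => hz s (h hs)

theorem gaussCDF_eq (w : Model d p n) (A : Finset (Fin n × Fin p × ℝ)) (t : ℝ) :
    D.gaussCDF w A t = (gaussPi w.cov).real {z | ∀ s ∈ A, linForm (D.coef w s) s.2.1 z ≤ t} := by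
  unfold gaussCDF
  simp only [smooth_div_stdDev, Finset.mem_coe]

section Coef

variable {C : ℝ} (hW : WeightBounds D n C) (hH : D.BandwidthConditions) {c : ClassConstants}
  {w : Model d p n} (hw : w.DisturbanceConditions c D.X)

include hW hH hw

omit hW hH in
theorem stdDev_sq_ge {s : Fin n × Fin p × ℝ} :
    c.Cvar * ∑ j, D.weight s.2.2 s.1 j ^ 2 ≤ D.stdDev w s ^ 2 := by
  rw [stdDev, Real.sq_sqrt, Finset.mul_sum]
  · exact Finset.sum_le_sum fun j _ => by
      rw [mul_comm]
      exact mul_le_mul_of_nonneg_left (hw.var_lower j s.2.1) (sq_nonneg _)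
  · exact Finset.sum_nonneg fun j _ => mul_nonneg (sq_nonneg _)
      (c.Cvar_pos.le.trans (hw.var_lower j s.2.1))

omit hw in
theorem sum_weight_sq_pos {s : Fin n × Fin p × ℝ} (hs : s ∈ D.S n) :
    0 < ∑ j, D.weight s.2.2 s.1 j ^ 2 := by
  refine lt_of_lt_of_le ?_ (hW.sum_sq_ge _ hs.1 s.1)
  have := H_pos hH hs.1
  have := hW.npos
  have := hW.pos
  positivity

theorem stdDev_pos {s : Fin n × Fin p × ℝ} (hs : s ∈ D.S n) : 0 < D.stdDev w s := by
  have h1 := stdDev_sq_ge hw (s := s)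
  have h2 := mul_pos c.Cvar_pos (sum_weight_sq_pos hW hH hs)
  have h3 : 0 ≤ D.stdDev w s := Real.sqrt_nonneg _
  rcases h3.eq_or_lt with h | h
  · rw [← h] at h1; norm_num at h1; linarith
  · exact h

theorem sum_coef_sq_mul_cov {s : Fin n × Fin p × ℝ} (hs : s ∈ D.S n) :
    ∑ j, D.coef w s j ^ 2 * w.cov j s.2.1 s.2.1 = 1 := by
  have h := stdDev_pos hW hH hw hs
  have h2 : D.stdDev w s ^ 2 = ∑ j, D.weight s.2.2 s.1 j ^ 2 * w.cov j s.2.1 s.2.1 :=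
    Real.sq_sqrt (Finset.sum_nonneg fun j _ => mul_nonneg (sq_nonneg _)
      (c.Cvar_pos.le.trans (hw.var_lower j s.2.1)))
  calc _ = (∑ j, D.weight s.2.2 s.1 j ^ 2 * w.cov j s.2.1 s.2.1) / D.stdDev w s ^ 2 := by
        rw [Finset.sum_div]
        exact Finset.sum_congr rfl fun j _ => by rw [coef, div_pow]; ring
    _ = 1 := by rw [← h2, div_self (by positivity)]

theorem sum_coef_sq_le {s : Fin n × Fin p × ℝ} (hs : s ∈ D.S n) :
    ∑ j, D.coef w s j ^ 2 ≤ 1 / c.Cvar := by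
  rw [le_div_iff₀ c.Cvar_pos, ← sum_coef_sq_mul_cov hW hH hw hs, Finset.sum_mul]
  exact Finset.sum_le_sum fun j _ => mul_le_mul_of_nonneg_left (hw.var_lower j s.2.1) (sq_nonneg _)

/-- Weights are at most `C / (n h ^ d)` and variances at least `Cvar / (C n h ^ d)`. The result is
the bound `B` of the replacement argument. -/
theorem abs_coef_le {s : Fin n × Fin p × ℝ} (hs : s ∈ D.S n) (hK : D.KernelConditions)
    (j : Fin n) : |D.coef w s j| ≤ √(C ^ 3 / c.Cvar / (n * D.hmin n ^ d)) := by
  have hh := H_pos hH hs.1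
  have hn : (0 : ℝ) < n := by exact_mod_cast hW.npos
  have hC := hW.pos
  have hV := stdDev_pos hW hH hw hs
  have hcv := c.Cvar_pos
  have hm := hH.hmin_pos n
  refine Real.abs_le_sqrt ?_
  rw [coef, div_pow, div_le_iff₀ (by positivity)]
  have h1 : D.weight s.2.2 s.1 j ^ 2 ≤ (C / (n * s.2.2 ^ d)) ^ 2 :=
    pow_le_pow_left₀ (weight_nonneg hK hh _ _) (hW.le _ hs.1 _ _) 2
  have h2 : c.Cvar * (1 / (C * (n * s.2.2 ^ d))) ≤ D.stdDev w s ^ 2 :=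
    (mul_le_mul_of_nonneg_left (hW.sum_sq_ge _ hs.1 s.1) hcv.le).trans (stdDev_sq_ge hw)
  have h3 : C ^ 3 / c.Cvar / (n * s.2.2 ^ d) ≤ C ^ 3 / c.Cvar / (n * D.hmin n ^ d) := by
    gcongr
    exact hs.1.1
  calc _ ≤ (C / (n * s.2.2 ^ d)) ^ 2 := h1
    _ = C ^ 3 / c.Cvar / (n * s.2.2 ^ d) * (c.Cvar * (1 / (C * (n * s.2.2 ^ d)))) := by
        field_simp
    _ ≤ _ := by gcongr

/-- Gaussian approximation for the standardized errors. -/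
theorem gaussCDF_compare (hK : D.KernelConditions) {A : Finset (Fin n × Fin p × ℝ)}
    (hA : A.Nonempty) (hAS : (A : Set _) ⊆ D.S n) {β η ε : ℝ} (hβ : 0 ≤ β) (hε : 0 < ε)
    (hN : (D.S n).ncard * Real.exp (-(β * η)) ≤ ε) {M R : ℝ} (hM1 : 1 + c.Cmom ≤ M)
    (hM2 : 12 * Real.exp ((1 + c.Cmom) / 2) ≤ M)
    (hR : n * (26 * (β * √(C ^ 3 / c.Cvar / (n * D.hmin n ^ d))) ^ 3 * (p * M)) ≤ R) (t : ℝ) :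
    (Measure.pi w.law).real {e | ∀ s ∈ A, D.smooth e s / D.stdDev w s ≤ t}
        ≤ D.gaussCDF w A (t + 2 * η) + 2 * ε + R ∧
      D.gaussCDF w A t ≤ (Measure.pi w.law).real
        {e | ∀ s ∈ A, D.smooth e s / D.stdDev w s ≤ t + 2 * η} + 2 * ε + R ∧
      D.gaussCDF w A t ≤ (Measure.pi w.law).real
        {e | ∀ s ∈ A, -(D.smooth e s / D.stdDev w s) ≤ t + 2 * η} + 2 * ε + R := by
  have hμ : ∀ j, ThirdMoments (w.law j) (w.cov j) M := fun j => (hw.thirdMoments j).mono hM1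
  have hν : ∀ j, ThirdMoments (multivariateGaussian 0 (w.cov j)) (w.cov j) M := fun j =>
    (thirdMoments_multivariateGaussian (hw.posSemidef_cov j) (hw.cov_le j)).mono hM2
  have hB : ∀ s ∈ A, ∀ j, |D.coef w s j| ≤ √(C ^ 3 / c.Cvar / (n * D.hmin n ^ d)) := fun s hs j =>
    abs_coef_le hW hH hw (hAS hs) hK j
  have hB' : ∀ s ∈ A, ∀ j, |(-D.coef w s) j| ≤ √(C ^ 3 / c.Cvar / (n * D.hmin n ^ d)) :=
    fun s hs j => by rw [Pi.neg_apply, abs_neg]; exact hB s hs j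
  have hN' : A.card * Real.exp (-(β * η)) ≤ ε := by
    refine le_trans ?_ hN
    gcongr
    rw [← Set.ncard_coe_finset]
    exact Set.ncard_le_ncard hAS (finite_S hH n)
  refine ⟨?_, ?_, ?_⟩
  · rw [gaussCDF_eq]
    simp only [smooth_div_stdDev]
    exact (measure_forall_linForm_le hA _ _ w.law _ hμ hν (Real.sqrt_nonneg _) hB hβ hε hN' t).trans
      (add_le_add_right hR _)
  · rw [gaussCDF_eq]
    simp only [smooth_div_stdDev]
    exact (measure_forall_linForm_le hA _ _ _ w.law hν hμ (Real.sqrt_nonneg _) hB hβ hε hN' t).trans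
      (add_le_add_right hR _)
  -- The comparison is applied with negated coefficients, after reflecting the Gaussian side.
  · rw [gaussCDF_eq, ← gaussPi_forall_neg_le]
    simp only [smooth_div_stdDev, ← linForm_neg_left]
    exact (measure_forall_linForm_le hA _ _ _ w.law hν hμ (Real.sqrt_nonneg _) hB' hβ hε hN' t).trans
      (add_le_add_right hR _)

theorem gaussCDF_add_le {A : Finset (Fin n × Fin p × ℝ)} (hA : A.Nonempty)
    (hAS : (A : Set _) ⊆ D.S n) {η Q : ℝ} (hQ : 1 ≤ Q) (hη0 : 0 ≤ η) (hη : η ≤ 1 / (Q + 1))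
    (t : ℝ) : D.gaussCDF w A (t + η) ≤ D.gaussCDF w A t
      + (Real.exp 4 * η * (Q + 1) + (D.S n).ncard * Real.exp (-(Q - 1) ^ 2 / 2)) := by
  rw [gaussCDF_eq, gaussCDF_eq]
  refine (gaussPi_forall_le_add hw.posSemidef_cov hA
    (fun s hs => sum_coef_sq_mul_cov hW hH hw (hAS hs)) hQ hη0 hη t).trans ?_
  gcongr
  rw [← Set.ncard_coe_finset]
  exact Set.ncard_le_ncard hAS (finite_S hH n)

theorem one_sub_gaussCDF_le {A : Finset (Fin n × Fin p × ℝ)} (hAS : (A : Set _) ⊆ D.S n) {t : ℝ}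
    (ht : 0 ≤ t) : 1 - D.gaussCDF w A t ≤ A.card * Real.exp (-t ^ 2 / 2) := by
  have h := measureReal_exists_lt_le (P := gaussPi w.cov) A
    (X := fun s z => linForm (D.coef w s) s.2.1 z) (fun s hs =>
      map_linForm hw.posSemidef_cov (sum_coef_sq_mul_cov hW hH hw (hAS hs))) ht
  refine le_trans ?_ h
  have hm := measurableSet_forall_le A (fun s : Fin n × Fin p × ℝ =>
    measurable_linForm (D.coef w s) s.2.1) t
  rw [gaussCDF_eq, ← probReal_compl_eq_one_sub hm]
  exact le_of_eq rfl

theorem gaussCDF_singleton {s : Fin n × Fin p × ℝ} (hs : s ∈ D.S n) (t : ℝ) :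
    D.gaussCDF w {s} t = (gaussianReal 0 1).real (Set.Iic t) := by
  have := gaussPi_forall_le_eq_pow hw.posSemidef_cov (A := {s}) (c := D.coef w) (m := fun s => s.2.1)
    (fun r hr => by rw [Finset.mem_singleton.1 hr]; exact sum_coef_sq_mul_cov hW hH hw hs)
    (fun i hi k hk hik => absurd ((Finset.mem_singleton.1 hi).trans (Finset.mem_singleton.1 hk).symm)
      hik) t
  rw [Finset.card_singleton, pow_one] at this
  rw [← this, ← gaussCDF_eq]
  simp

/-- Test points of one bandwidth are more than `2 h` apart, so their kernel windows are disjoint and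
the corresponding statistics are independent standard normal. -/
theorem gaussCDF_eq_pow (hK : D.KernelConditions) (hI : D.TestPointConditions)
    {A : Finset (Fin n × Fin p × ℝ)} (hAS : (A : Set _) ⊆ D.S n) {m : Fin p} {h : ℝ}
    (hA : ∀ s ∈ A, s.2 = (m, h)) (t : ℝ) :
    D.gaussCDF w A t = (gaussianReal 0 1).real (Set.Iic t) ^ A.card := by
  rw [gaussCDF_eq]
  refine gaussPi_forall_le_eq_pow hw.posSemidef_cov
    (fun s hs => sum_coef_sq_mul_cov hW hH hw (hAS hs)) (fun s hs r hr hsr j => ?_) t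
  obtain ⟨i, s2⟩ := s
  obtain ⟨k, r2⟩ := r
  have e1 : s2 = (m, h) := hA _ hs
  have e2 : r2 = (m, h) := hA _ hr
  subst e1 e2
  have hiS := hAS hs
  have hkS := hAS hr
  have hik : i ≠ k := fun e => hsr (by rw [e])
  have hh : 0 < h := H_pos hH hiS.1
  have hsep := (hI n h hiS.1).1 i hiS.2 k hkS.2 hik
  have : h < ‖D.X i - D.X j‖ ∨ h < ‖D.X k - D.X j‖ := by
    by_contra hcon
    push Not at hcon
    have := norm_sub_le_norm_sub_add_norm_sub (D.X i) (D.X j) (D.X k)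
    rw [norm_sub_rev (D.X j)] at this
    linarith
  unfold coef
  rcases this with h1 | h1
  · rw [weight_eq_zero hK hh h1]; simp
  · rw [weight_eq_zero hK hh h1]; simp

end Coef

/-! ### The bootstrap -/

section Boot

theorem maxStat_le_iff {y z : Fin n → Vec p} {A : Set (Fin n × Fin p × ℝ)} (hA : A.Nonempty)
    (hfin : A.Finite) (t : ℝ) :
    D.maxStat y z A ≤ t ↔ ∀ s ∈ A, D.smooth z s / D.VHat y s ≤ t := by
  unfold maxStat
  rw [csSup_le_iff (hfin.image _).bddAbove (hA.image _)]
  exact Set.forall_mem_image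

theorem bootLaw_eq (y : Fin n → Vec p) : D.bootLaw y = gaussPi (D.sigmaHat n y) := rfl

theorem smooth_div_VHat (y z : Fin n → Vec p) (s : Fin n × Fin p × ℝ) :
    D.smooth z s / D.VHat y s
      = linForm (fun j => D.weight s.2.2 s.1 j / D.VHat y s) s.2.1 z := by
  unfold smooth linForm
  rw [Finset.sum_div]
  exact Finset.sum_congr rfl fun j _ => by ring

variable {C : ℝ} (hW : WeightBounds D n C) (hH : D.BandwidthConditions) {c : ClassConstants}
  {w : Model d p n} (hw : w.DisturbanceConditions c D.X) {y : Fin n → Vec p} {δ : ℝ}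
  (hy : ∀ i, ‖Matrix.toEuclideanCLM (𝕜 := ℝ) (D.sigmaHat n y i - w.cov i)‖ ≤ δ)
  (hpsd : ∀ i, (D.sigmaHat n y i).PosSemidef)

include hW hH hw hy

/-- Since the variances are at least `Cvar`, an error `δ` in the entries is a relative error `δ /
Cvar` in the squared standard deviation. -/
theorem abs_VHat_ratio {s : Fin n × Fin p × ℝ} (hs : s ∈ D.S n) (hδ : δ ≤ c.Cvar / 2) :
    0 < D.VHat y s ∧ |D.stdDev w s / D.VHat y s - 1| ≤ 2 * δ / c.Cvar := by
  have hcv := c.Cvar_pos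
  set x := ∑ j, D.weight s.2.2 s.1 j ^ 2 * D.sigmaHat n y j s.2.1 s.2.1 with hx
  set V := D.stdDev w s with hV
  have hVp : 0 < V := stdDev_pos hW hH hw hs
  have hV2 : V ^ 2 = ∑ j, D.weight s.2.2 s.1 j ^ 2 * w.cov j s.2.1 s.2.1 :=
    Real.sq_sqrt (Finset.sum_nonneg fun j _ => mul_nonneg (sq_nonneg _)
      (c.Cvar_pos.le.trans (hw.var_lower j s.2.1)))
  have hδ0 : 0 ≤ δ := (norm_nonneg _).trans (hy s.1)
  have hdiff : |x - V ^ 2| ≤ δ / c.Cvar * V ^ 2 := by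
    rw [hx, hV2, ← Finset.sum_sub_distrib]
    calc _ ≤ ∑ j, D.weight s.2.2 s.1 j ^ 2 * δ := by
          refine (Finset.abs_sum_le_sum_abs _ _).trans (Finset.sum_le_sum fun j _ => ?_)
          rw [← mul_sub, abs_mul, abs_of_nonneg (sq_nonneg _)]
          gcongr
          exact (abs_entry_le_norm (D.sigmaHat n y j - w.cov j) s.2.1 s.2.1).trans (hy j)
      _ = δ / c.Cvar * (c.Cvar * ∑ j, D.weight s.2.2 s.1 j ^ 2) := by
          rw [← Finset.sum_mul]; field_simp
      _ ≤ _ := by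
          rw [← hV2]
          gcongr
          exact stdDev_sq_ge hw
  set u := δ / c.Cvar with hu
  have hu0 : 0 ≤ u := by positivity
  have hu1 : u ≤ 1 / 2 := by rw [hu, div_le_iff₀ hcv]; linarith
  have hV2p : 0 < V ^ 2 := by positivity
  obtain ⟨h1, h2⟩ := abs_le.1 hdiff
  have hxp : 0 < x := by nlinarith
  have hVH : D.VHat y s = √x := rfl
  have hVHp : 0 < D.VHat y s := by rw [hVH]; exact Real.sqrt_pos.2 hxp
  refine ⟨hVHp, ?_⟩
  set ρ := V / D.VHat y s with hρ
  have hρ0 : 0 < ρ := by positivity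
  have hρ2 : ρ ^ 2 * x = V ^ 2 := by
    rw [hρ, div_pow, hVH, Real.sq_sqrt hxp.le]; field_simp
  have e : 2 * δ / c.Cvar = 2 * u := by rw [hu]; ring
  rw [e]
  -- From `ρ² (1 - u) ≤ 1 ≤ ρ² (1 + u)` and `u ≤ 1 / 2`. The bound passes to `ρ` because `|ρ² - 1| =
  -- |ρ - 1| (ρ + 1) ≥ |ρ - 1|`.
  have hρsq : |ρ ^ 2 - 1| ≤ 2 * u := by
    have h3 : x ≤ (1 + u) * V ^ 2 := by linarith
    have h4 : (1 - u) * V ^ 2 ≤ x := by linarith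
    have hle : ρ ^ 2 * (1 - u) ≤ 1 := by
      have : ρ ^ 2 * (1 - u) * V ^ 2 ≤ 1 * V ^ 2 := by
        rw [← hρ2]; nlinarith [sq_nonneg ρ, mul_le_mul_of_nonneg_left h4 (sq_nonneg ρ)]
      exact le_of_mul_le_mul_right this hV2p
    have hge : 1 ≤ ρ ^ 2 * (1 + u) := by
      have : 1 * V ^ 2 ≤ ρ ^ 2 * (1 + u) * V ^ 2 := by
        nlinarith [mul_le_mul_of_nonneg_left h3 (sq_nonneg ρ)]
      exact le_of_mul_le_mul_right this hV2p
    rw [abs_le]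
    constructor <;> nlinarith [sq_nonneg ρ]
  have : |ρ ^ 2 - 1| = |ρ - 1| * (ρ + 1) := by
    rw [show ρ ^ 2 - 1 = (ρ - 1) * (ρ + 1) by ring, abs_mul, abs_of_pos (by linarith : 0 < ρ + 1)]
  nlinarith [abs_nonneg (ρ - 1)]

include hpsd

/-- The variance of the coupling error is linear in `δ`. With `a`, `b` the images of the basis
vector under the two square roots, each summand is `coef • ((a - b) - (ρ - 1) • b)`, where `‖a - b‖²
≤ δ`, `(ρ - 1)² ≤ 4 δ / Cvar²` (as `δ ≤ 1`) and `‖b‖² ≤ 2 + Cmom`; the squared coefficients sum to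
at most `1 / Cvar`. -/
theorem sum_norm_sub_sq_le {s : Fin n × Fin p × ℝ} (hs : s ∈ D.S n) (hδ : δ ≤ c.Cvar / 2)
    (hδ1 : δ ≤ 1) :
    ∑ j, ‖D.coef w s j • sqrtCLM (w.cov j) (EuclideanSpace.single s.2.1 1)
      - (D.weight s.2.2 s.1 j / D.VHat y s) •
        sqrtCLM (D.sigmaHat n y j) (EuclideanSpace.single s.2.1 1)‖ ^ 2
      ≤ 2 / c.Cvar * (1 + 4 / c.Cvar ^ 2 * (2 + c.Cmom)) * δ := by
  obtain ⟨hVH, hρ⟩ := abs_VHat_ratio hW hH hw hy hs hδ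
  have hcv := c.Cvar_pos
  have hV := stdDev_pos hW hH hw hs
  have hδ0 : 0 ≤ δ := (norm_nonneg _).trans (hy s.1)
  have hcm := c.Cmom_pos
  set ρ := D.stdDev w s / D.VHat y s
  have hterm : ∀ j, ‖D.coef w s j • sqrtCLM (w.cov j) (EuclideanSpace.single s.2.1 1)
      - (D.weight s.2.2 s.1 j / D.VHat y s) •
        sqrtCLM (D.sigmaHat n y j) (EuclideanSpace.single s.2.1 1)‖ ^ 2
      ≤ D.coef w s j ^ 2 * (2 * (1 + 4 / c.Cvar ^ 2 * (2 + c.Cmom)) * δ) := fun j => by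
    set a := sqrtCLM (w.cov j) (EuclideanSpace.single s.2.1 1)
    set b := sqrtCLM (D.sigmaHat n y j) (EuclideanSpace.single s.2.1 1)
    have hc : D.weight s.2.2 s.1 j / D.VHat y s = D.coef w s j * ρ := by
      simp only [coef, ρ]; field_simp
    have e : D.coef w s j • a - (D.weight s.2.2 s.1 j / D.VHat y s) • b
        = D.coef w s j • ((a - b) - (ρ - 1) • b) := by
      rw [hc]; module
    have hab : ‖a - b‖ ^ 2 ≤ δ := by
      have := norm_sqrtCLM_sub_le (hpsd j) (hw.posSemidef_cov j) (EuclideanSpace.single s.2.1 1)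
      rw [norm_sub_rev]
      refine this.trans ?_
      simpa using hy j
    have hb : ‖b‖ ^ 2 ≤ 2 + c.Cmom := by
      rw [norm_sqrtCLM_single_sq (hpsd j)]
      have h1 := (abs_le.1 ((abs_entry_le_norm (D.sigmaHat n y j - w.cov j) s.2.1 s.2.1).trans
        (hy j))).2
      rw [Matrix.sub_apply] at h1
      linarith [hw.cov_le j s.2.1]
    have hρ2 : (ρ - 1) ^ 2 ≤ 4 / c.Cvar ^ 2 * δ := by
      have h1 : (ρ - 1) ^ 2 ≤ (2 * δ / c.Cvar) ^ 2 := by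
        rw [← sq_abs]; exact pow_le_pow_left₀ (abs_nonneg _) hρ 2
      refine h1.trans ?_
      have : (2 * δ / c.Cvar) ^ 2 = 4 / c.Cvar ^ 2 * (δ * δ) := by ring
      rw [this]
      gcongr
      nlinarith
    rw [e, norm_smul, mul_pow, Real.norm_eq_abs, sq_abs]
    gcongr
    have h1 : ‖(a - b) - (ρ - 1) • b‖ ≤ ‖a - b‖ + |ρ - 1| * ‖b‖ := by
      refine (norm_sub_le _ _).trans_eq ?_
      rw [norm_smul, Real.norm_eq_abs]
    have h2 : ‖(a - b) - (ρ - 1) • b‖ ^ 2 ≤ (‖a - b‖ + |ρ - 1| * ‖b‖) ^ 2 :=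
      pow_le_pow_left₀ (norm_nonneg _) h1 2
    have h3 : (|ρ - 1| * ‖b‖) ^ 2 ≤ 4 / c.Cvar ^ 2 * δ * (2 + c.Cmom) := by
      rw [mul_pow, sq_abs]
      gcongr
    nlinarith [sq_nonneg (‖a - b‖ - |ρ - 1| * ‖b‖)]
  refine (Finset.sum_le_sum fun j _ => hterm j).trans ?_
  rw [← Finset.sum_mul]
  have := sum_coef_sq_le hW hH hw hs
  calc _ ≤ 1 / c.Cvar * (2 * (1 + 4 / c.Cvar ^ 2 * (2 + c.Cmom)) * δ) := by gcongr
    _ = _ := by ring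

/-- The bootstrap distribution is close to the Gaussian distribution with the true covariance
matrices. -/
theorem bootLaw_compare {A : Finset (Fin n × Fin p × ℝ)} (hA : A.Nonempty)
    (hAS : (A : Set _) ⊆ D.S n) (hδ0 : 0 < δ) (hδ : δ ≤ c.Cvar / 2) (hδ1 : δ ≤ 1) {η R : ℝ}
    (hη : 0 ≤ η)
    (hR : (D.S n).ncard * Real.exp (-η ^ 2 /
      (2 * (2 / c.Cvar * (1 + 4 / c.Cvar ^ 2 * (2 + c.Cmom)) * δ))) ≤ R) (t : ℝ) :
    (D.bootLaw y).real {z | D.maxStat y z A ≤ t} ≤ D.gaussCDF w A (t + η) + R ∧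
      D.gaussCDF w A t ≤ (D.bootLaw y).real {z | D.maxStat y z A ≤ t + η} + R := by
  have hcv := c.Cvar_pos
  have hcm := c.Cmom_pos
  set v := 2 / c.Cvar * (1 + 4 / c.Cvar ^ 2 * (2 + c.Cmom)) * δ with hv
  have hv0 : 0 < v := by positivity
  have hclose := fun s (hs : s ∈ A) => sum_norm_sub_sq_le hW hH hw hy hpsd (hAS hs) hδ hδ1
  have hcard : A.card * Real.exp (-η ^ 2 / (2 * v)) ≤ R := by
    refine le_trans ?_ hR
    gcongr
    rw [← Set.ncard_coe_finset]
    exact Set.ncard_le_ncard hAS (finite_S hH n)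
  have hset : ∀ t, {z | D.maxStat y z A ≤ t}
      = {z | ∀ s ∈ A, linForm (fun j => D.weight s.2.2 s.1 j / D.VHat y s) s.2.1 z ≤ t} := fun t => by
    ext z
    change D.maxStat y z A ≤ t ↔ _
    rw [maxStat_le_iff (by simpa using hA) A.finite_toSet]
    simp only [smooth_div_VHat]
    rfl
  rw [bootLaw_eq, hset, hset, gaussCDF_eq, gaussCDF_eq]
  constructor
  · exact (gaussPi_forall_le_of_close A hη hv0 hclose t).trans (by gcongr)
  · refine (gaussPi_forall_le_of_close (S := D.sigmaHat n y) (S' := w.cov) A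
      (c := fun s j => D.weight s.2.2 s.1 j / D.VHat y s) hη hv0 (fun s hs => ?_) t).trans
      (by gcongr)
    have := hclose s hs
    simp only [norm_sub_rev] at this ⊢
    convert this using 4

end Boot

end TestSetup

/-! ### Analysis of the two tests at a fixed sample size -/

theorem measureReal_union_le_add {Ω : Type*} [MeasurableSpace Ω] {μ : Measure Ω}
    {A B : Set Ω} {x y : ℝ} (hA : μ.real A ≤ x) (hB : μ.real B ≤ y) : μ.real (A ∪ B) ≤ x + y :=
  (measureReal_union_le A B).trans (add_le_add hA hB)

namespace TestSetup

variable {d p n : ℕ} {D : TestSetup d p}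

/-- For the case that no triple survives the pretest: by `sSup ∅ = 0` the bootstrap statistic is
constant. -/
theorem bootQuantile_empty (y : Fin n → Vec p) {q : ℝ} (hq0 : 0 < q) (hq1 : q ≤ 1) :
    D.bootQuantile y ∅ q = 0 := by
  have : IsProbabilityMeasure (D.bootLaw y) := by unfold bootLaw; infer_instance
  have : {t : ℝ | q ≤ (D.bootLaw y).real {z | D.maxStat y z ∅ ≤ t}} = Set.Ici 0 := by
    ext t
    change q ≤ _ ↔ 0 ≤ t
    have hm : ∀ z, D.maxStat y z ∅ = 0 := fun z => by simp [maxStat]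
    simp only [hm]
    by_cases ht : 0 ≤ t
    · simpa [ht] using hq1
    · simpa [ht] using hq0
  rw [bootQuantile, this, csInf_Ici]

theorem exists_le_bootLaw (y : Fin n → Vec p) (A : Set (Fin n × Fin p × ℝ)) {q : ℝ} (hq1 : q < 1) :
    ∃ t : ℝ, q ≤ (D.bootLaw y).real {z | D.maxStat y z A ≤ t} := by
  have : IsProbabilityMeasure (D.bootLaw y) := by unfold bootLaw; infer_instance
  have hmono : Monotone fun t : ℝ => {z | D.maxStat y z A ≤ t} :=
    fun s t hst z (hz : _ ≤ s) => hz.trans hst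
  have h := tendsto_measure_iUnion_atTop (μ := D.bootLaw y) hmono
  have hU : (⋃ t : ℝ, {z | D.maxStat y z A ≤ t}) = Set.univ :=
    Set.eq_univ_of_forall fun z => Set.mem_iUnion.2 ⟨D.maxStat y z A, le_refl (D.maxStat y z A)⟩
  rw [hU, measure_univ] at h
  have h' := (ENNReal.tendsto_toReal ENNReal.one_ne_top).comp h
  obtain ⟨t, ht⟩ := (h'.eventually (lt_mem_nhds (by simpa using hq1 : q < (1 : ENNReal).toReal))).exists
  exact ⟨t, ht.le⟩

/-- The facts on the model `w`, up to errors `ε`, on which the analysis of the tests is based. The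
data in `good` are those for which the estimators of the covariance matrices are accurate. -/
structure Approx (D : TestSetup d p) (w : Model d p n) (ε η Q r : ℝ)
    (good : Set (Fin n → Vec p)) : Prop where
  finite : (D.S n).Finite
  nonempty : (D.S n).Nonempty
  ε_pos : 0 < ε
  η_pos : 0 < η
  Q_pos : 0 < Q
  r_nonneg : 0 ≤ r
  r_le : r ≤ 1 / 2
  Qr_le : Q * (2 * r) ≤ η
  stdDev_pos : ∀ s ∈ D.S n, 0 < D.stdDev w s
  weight_nonneg : ∀ h ∈ D.H n, ∀ i j : Fin n, 0 ≤ D.weight h i j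
  anti : ∀ A ⊆ D.S n, A.Nonempty → ∀ t, D.gaussCDF w A (t + η) ≤ D.gaussCDF w A t + ε
  upper : ∀ A ⊆ D.S n, A.Nonempty → ∀ t, (Measure.pi w.law).real
    {e | ¬ ∀ s ∈ A, D.smooth e s / D.stdDev w s ≤ t} ≤ 1 - D.gaussCDF w A t + ε
  lower : ∀ A ⊆ D.S n, A.Nonempty → ∀ t, (Measure.pi w.law).real
    {e | ¬ ∀ s ∈ A, -t ≤ D.smooth e s / D.stdDev w s} ≤ 1 - D.gaussCDF w A t + ε
  all_le : ∀ t, (Measure.pi w.law).real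
    {e | ∀ s ∈ D.S n, D.smooth e s / D.stdDev w s ≤ t} ≤ D.gaussCDF w (D.S n) t + ε
  boot : ∀ y ∈ good, ∀ A ⊆ D.S n, A.Nonempty → ∀ t,
    |(D.bootLaw y).real {z | D.maxStat y z A ≤ t} - D.gaussCDF w A t| ≤ ε
  ratio : ∀ y ∈ good, ∀ s ∈ D.S n, 0 < D.VHat y s ∧ |D.stdDev w s / D.VHat y s - 1| ≤ r
  good_compl : (Measure.pi w.law).real {e | w.mean D.X + e ∉ good} ≤ ε
  top : 1 - ε ≤ D.gaussCDF w (D.S n) Q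
  bot : ∀ s ∈ D.S n, D.gaussCDF w {s} (-Q) ≤ ε

/-- Facts on the tails that the analysis of moment selection needs in addition. -/
structure TailApprox (D : TestSetup d p) (w : Model d p n) (ε θ M : ℝ) (N : ℕ) : Prop where
  M_nonneg : 0 ≤ M
  N_pos : 0 < N
  single : ∀ s ∈ D.S n, D.gaussCDF w {s} (-M) ≤ θ
  many : ∀ A ⊆ D.S n, A.ncard = N → (∃ m h, ∀ s ∈ A, s.2 = (m, h)) → D.gaussCDF w A 0 ≤ θ
  all : D.gaussCDF w (D.S n) 0 ≤ θ
  quantile_ge : ∀ l, 1 / 4 ≤ D.gaussCDF w (D.S n) l → 4 * M ≤ l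
  half : ∀ l, 1 / 4 ≤ D.gaussCDF w (D.S n) l → ∀ A ⊆ D.S n, A.Nonempty → A.ncard = N →
    1 - ε ≤ D.gaussCDF w A (l / 2)
  sparse : ∀ l, 1 / 4 ≤ D.gaussCDF w (D.S n) l → ∀ A ⊆ D.S n, A.Nonempty →
    (∀ m h, {s ∈ A | s.2 = (m, h)}.ncard < N) → 1 - ε ≤ D.gaussCDF w A (l - 2 * M)

namespace Approx

variable {w : Model d p n} {ε η Q r : ℝ} {good : Set (Fin n → Vec p)}
  (a : Approx D w ε η Q r good)

include a

theorem bot_le {A : Set (Fin n × Fin p × ℝ)} (hA : A ⊆ D.S n) (hne : A.Nonempty) :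
    D.gaussCDF w A (-Q) ≤ ε := by
  obtain ⟨s, hs⟩ := hne
  exact (gaussCDF_anti_left w (Set.singleton_subset_iff.2 hs) _).trans (a.bot s (hA hs))

theorem top_le {A : Set (Fin n × Fin p × ℝ)} (hA : A ⊆ D.S n) : 1 - ε ≤ D.gaussCDF w A Q :=
  a.top.trans (gaussCDF_anti_left w hA _)

/-- Approximate quantiles of the Gaussian maxima. -/
theorem exists_quantile {A : Set (Fin n × Fin p × ℝ)} (hA : A ⊆ D.S n) (hne : A.Nonempty) {q : ℝ}
    (hq0 : ε < q) (hq1 : q ≤ 1 - ε) :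
    ∃ t, t ≤ Q ∧ q - ε ≤ D.gaussCDF w A t ∧ D.gaussCDF w A t < q := by
  have hη := a.η_pos
  -- The quantile is sought on the grid `-Q + k η`. At the last grid point below level `q` the
  -- distribution function exceeds `q - ε`, because one step changes it by at most `ε`; continuity
  -- is not needed. The first grid point has value at most `ε < q`.
  have hex : ∃ k : ℕ, q ≤ D.gaussCDF w A (-Q + k * η) := by
    obtain ⟨k, hk⟩ := exists_nat_gt (2 * Q / η)
    rw [div_lt_iff₀ hη] at hk
    exact ⟨k, (hq1.trans (a.top_le hA)).trans (gaussCDF_mono_right (D := D) w A (by linarith))⟩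
  classical
  have h1 := Nat.find_spec hex
  have h0 : Nat.find hex ≠ 0 := fun h => by
    rw [h] at h1
    have := a.bot_le hA hne
    simp at h1
    linarith
  obtain ⟨k, hk⟩ := Nat.exists_eq_succ_of_ne_zero h0
  have h2 : D.gaussCDF w A (-Q + k * η) < q := not_le.1 (Nat.find_min hex (by omega))
  refine ⟨-Q + k * η, ?_, ?_, h2⟩
  · by_contra hlt
    push Not at hlt
    have := gaussCDF_mono_right (D := D) w A hlt.le
    have := a.top_le hA
    linarith
  · rw [hk] at h1
    have := a.anti A hA hne (-Q + k * η)
    have e : -Q + k * η + η = -Q + (k + 1 : ℕ) * η := by push_cast; ring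
    rw [e] at this
    linarith

theorem le_bootQuantile {y : Fin n → Vec p} (hy : y ∈ good) {A : Set (Fin n × Fin p × ℝ)}
    (hA : A ⊆ D.S n) (hne : A.Nonempty) {q t : ℝ} (hq1 : q < 1)
    (ht : D.gaussCDF w A t < q - ε) : t ≤ D.bootQuantile y A q := by
  refine le_csInf (exists_le_bootLaw y A hq1) fun u (hu : q ≤ _) => ?_
  by_contra hlt
  push Not at hlt
  have h1 := (abs_le.1 (a.boot y hy A hA hne u)).2
  have h2 := gaussCDF_mono_right (D := D) w A hlt.le
  linarith

theorem bootQuantile_le {y : Fin n → Vec p} (hy : y ∈ good) {A : Set (Fin n × Fin p × ℝ)}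
    (hA : A ⊆ D.S n) (hne : A.Nonempty) {q t : ℝ} (hq : 2 * ε < q)
    (ht : q + ε ≤ D.gaussCDF w A t) : D.bootQuantile y A q ≤ t := by
  -- Below `-Q` the bootstrap probability is at most `2 * ε < q`, so the set that defines the
  -- quantile is bounded below.
  refine csInf_le ⟨-Q, fun u (hu : q ≤ _) => ?_⟩ ?_
  · by_contra hlt
    push Not at hlt
    have h1 := (abs_le.1 (a.boot y hy A hA hne u)).2
    have h2 := gaussCDF_mono_right (D := D) w A hlt.le
    have h3 := a.bot_le hA hne
    linarith
  · change q ≤ _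
    have h1 := (abs_le.1 (a.boot y hy A hA hne t)).1
    linarith

theorem statistic_eq {e : Fin n → Vec p} {s : Fin n × Fin p × ℝ} (hs : s ∈ D.S n)
    (hy : w.mean D.X + e ∈ good) :
    D.smooth (w.mean D.X + e) s / D.VHat (w.mean D.X + e) s =
      D.stdDev w s / D.VHat (w.mean D.X + e) s *
        (D.smooth (w.mean D.X) s / D.stdDev w s + D.smooth e s / D.stdDev w s) := by
  have h1 := a.stdDev_pos s hs
  have h2 := (a.ratio _ hy s hs).1
  rw [smooth_add]
  field_simp

theorem mean_nonpos (hf : ∀ (i : Fin n) m, w.f m (D.X i) ≤ 0) {s : Fin n × Fin p × ℝ} (hs : s ∈ D.S n) :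
    D.smooth (w.mean D.X) s / D.stdDev w s ≤ 0 := by
  refine div_nonpos_of_nonpos_of_nonneg (Finset.sum_nonpos fun j _ => ?_) (a.stdDev_pos s hs).le
  exact mul_nonpos_of_nonneg_of_nonpos (a.weight_nonneg _ hs.1 _ _) (hf j s.2.1)

theorem testStat_le_iff (y : Fin n → Vec p) (t : ℝ) :
    D.testStat y ≤ t ↔ ∀ s ∈ D.S n, D.smooth y s / D.VHat y s ≤ t :=
  maxStat_le_iff a.nonempty a.finite t

theorem abs_mul_sub_le {ρ L : ℝ} (hρ : |ρ - 1| ≤ r) (h1 : -Q ≤ L) (h2 : L ≤ Q) :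
    |ρ * L - L| ≤ η := by
  have := a.r_nonneg
  have := a.Qr_le
  rw [show ρ * L - L = (ρ - 1) * L by ring, abs_mul]
  have h3 : |L| ≤ Q := abs_le.2 ⟨h1, h2⟩
  have : |ρ - 1| * |L| ≤ r * Q := mul_le_mul hρ h3 (abs_nonneg _) a.r_nonneg
  have := mul_nonneg a.r_nonneg a.Q_pos.le
  linarith

/-- The mean part is nonpositive under the null hypothesis and is dropped; rescaling an error in
`[-Q, Q]` by the ratio of standard deviations costs at most `η`. -/
theorem statistic_le (hf : ∀ (i : Fin n) m, w.f m (D.X i) ≤ 0) {e : Fin n → Vec p} {s : Fin n × Fin p × ℝ}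
    (hs : s ∈ D.S n) (hy : w.mean D.X + e ∈ good) (h1 : -Q ≤ D.smooth e s / D.stdDev w s)
    (h2 : D.smooth e s / D.stdDev w s ≤ Q) :
    D.smooth (w.mean D.X + e) s / D.VHat (w.mean D.X + e) s ≤ D.smooth e s / D.stdDev w s + η := by
  rw [a.statistic_eq hs hy]
  obtain ⟨h3, h4⟩ := a.ratio _ hy s hs
  have h5 := (abs_le.1 (a.abs_mul_sub_le h4 h1 h2)).2
  have h6 := mul_nonpos_of_nonneg_of_nonpos (div_pos (a.stdDev_pos s hs) h3).le (a.mean_nonpos hf hs)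
  rw [mul_add]
  linarith

omit a in
-- Only monotonicity and subadditivity are used, so neither `T` nor `B` has to be measurable.
theorem one_sub_le_of_compl {T B : Set (Fin n → Vec p)} {b : ℝ}
    (hB : (Measure.pi w.law).real B ≤ b) (h : ∀ e, e ∉ B → w.mean D.X + e ∈ T) :
    1 - b ≤ (w.dataLaw D.X).real T := by
  rw [Model.dataLaw_real]
  have h1 : (Measure.pi w.law).real Set.univ ≤ (Measure.pi w.law).real
      ({e | w.mean D.X + e ∈ T} ∪ B) := measureReal_mono (fun e _ => by
    by_cases he : e ∈ B
    · exact Or.inr he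
    · exact Or.inl (h e he))
  have h2 := measureReal_union_le (μ := Measure.pi w.law) {e | w.mean D.X + e ∈ T} B
  rw [probReal_univ] at h1
  linarith

/-- The event that the variance estimators are inaccurate, or some standardized error is not in
`[-Q, Q]`. -/
theorem measure_bad_le : (Measure.pi w.law).real ({e | w.mean D.X + e ∉ good} ∪
    ({e | ¬ ∀ s ∈ D.S n, D.smooth e s / D.stdDev w s ≤ Q} ∪
      {e | ¬ ∀ s ∈ D.S n, -Q ≤ D.smooth e s / D.stdDev w s})) ≤ 5 * ε := by
  refine (measureReal_union_le_add a.good_compl (measureReal_union_le_add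
    (a.upper _ subset_rfl a.nonempty Q) (a.lower _ subset_rfl a.nonempty Q))).trans ?_
  have := a.top
  linarith

/-- The event that is excluded in the analysis of critical values above the quantile `t`. -/
theorem measure_exceed_le {A : Set (Fin n × Fin p × ℝ)} (hA : A ⊆ D.S n) (hne : A.Nonempty)
    {t q : ℝ} (ht : q ≤ D.gaussCDF w A t) : (Measure.pi w.law).real
      {e | ¬ ∀ s ∈ A, D.smooth e s / D.stdDev w s ≤ t - η} ≤ 1 - q + 2 * ε := by
  refine (a.upper A hA hne _).trans ?_
  have := a.anti A hA hne (t - η)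
  rw [sub_add_cancel] at this
  linarith

/-- The plug-in test has the level `α`, approximately. -/
theorem le_acceptPIA (hf : ∀ (i : Fin n) m, w.f m (D.X i) ≤ 0) {α : ℝ} (hα : 0 < α) (h : 2 * ε < 1 - α) :
    1 - α - 9 * ε ≤ D.acceptPIA α w := by
  have hε := a.ε_pos
  -- Level `1 - α - ε` keeps the bootstrap quantile of level `1 - α` above `t`. The excluded events
  -- have probability at most `5 ε + (α + 4 ε)`.
  obtain ⟨t, -, ht1, ht2⟩ := a.exists_quantile subset_rfl a.nonempty (q := 1 - α - ε) (by linarith)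
    (by linarith)
  have hB := measureReal_union_le_add a.measure_bad_le (a.measure_exceed_le subset_rfl a.nonempty ht1)
  refine le_trans (by linarith) (one_sub_le_of_compl hB fun e he => ?_)
  simp only [Set.mem_union, not_or, Set.mem_ofPred_eq, not_not] at he
  obtain ⟨⟨hg, hu, hl⟩, ht⟩ := he
  change D.testStat _ ≤ D.bootQuantile _ _ _
  rw [a.testStat_le_iff]
  intro s hs
  refine (a.statistic_le hf hs hg (hl s hs) (hu s hs)).trans ?_
  have := a.le_bootQuantile hg subset_rfl a.nonempty (q := 1 - α) (by linarith) ht2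
  linarith [ht s hs]

/-- In models with `f = 0`, a critical value that is at most a quantile of level `q` leads to an
acceptance probability of at most `q`, approximately. -/
theorem accept_le (hf : ∀ m, w.f m = 0) {q t : ℝ} (ht : D.gaussCDF w (D.S n) t ≤ q)
    (crit : (Fin n → Vec p) → ℝ) (hcrit : ∀ y ∈ good, crit y ≤ t) :
    (w.dataLaw D.X).real {y | D.testStat y ≤ crit y} ≤ q + 7 * ε := by
  rw [Model.dataLaw_real]
  have hB := measureReal_union_le_add a.measure_bad_le (a.all_le (t + η))
  have h1 := a.anti _ subset_rfl a.nonempty t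
  refine le_trans (measureReal_mono fun e he => ?_) (hB.trans (by linarith))
  by_contra hcon
  simp only [Set.mem_union, not_or, Set.mem_ofPred_eq, not_not] at hcon
  obtain ⟨⟨hg, hu, hl⟩, hx⟩ := hcon
  refine hx fun s hs => ?_
  have h2 : D.testStat (w.mean D.X + e) ≤ crit (w.mean D.X + e) := he
  rw [a.testStat_le_iff] at h2
  have h3 := h2 s hs
  rw [a.statistic_eq hs hg] at h3
  have h0 : D.smooth (w.mean D.X) s = 0 := by
    unfold smooth Model.mean
    simp [hf]
  rw [h0, zero_div, zero_add] at h3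
  have h4 := (abs_le.1 (a.abs_mul_sub_le (a.ratio _ hg s hs).2 (hl s hs) (hu s hs))).1
  linarith [hcrit _ hg]

theorem acceptPIA_le (hf : ∀ m, w.f m = 0) {α : ℝ} (hα : 3 * ε ≤ α) (h : 2 * ε < 1 - α) :
    D.acceptPIA α w ≤ 1 - α + 9 * ε := by
  have hε := a.ε_pos
  -- Now `t` must lie above the bootstrap quantile of level `1 - α`, so the distribution function at
  -- `t` has to be at least `1 - α + ε`.
  obtain ⟨t, -, ht1, ht2⟩ := a.exists_quantile subset_rfl a.nonempty (q := 1 - α + 2 * ε)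
    (by linarith) (by linarith)
  refine (a.accept_le hf ht2.le (D.critPIA (1 - α)) fun y hy => ?_).trans (by linarith)
  exact a.bootQuantile_le hy subset_rfl a.nonempty h (by linarith)

/-- Dropping triples can only lower the quantile of the maximum, so the full maximum bounds the
critical value. The term `2 * γ` is the raised level of the quantile and is why `γ → 0` is needed
for exact size. -/
theorem acceptRMS_le {θ M : ℝ} {N : ℕ} (b : TailApprox D w ε θ M N) (hf : ∀ m, w.f m = 0)
    {α γ : ℝ} (hα : 2 * γ + 3 * ε ≤ α) (hγ : 0 < γ) (h : 2 * ε < 1 - α) (hθ : θ < 1 - α) :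
    D.acceptRMS α γ w ≤ 1 - α + 2 * γ + 9 * ε := by
  have hε := a.ε_pos
  obtain ⟨t, -, ht1, ht2⟩ := a.exists_quantile subset_rfl a.nonempty (q := 1 - α + 2 * γ + 2 * ε)
    (by linarith) (by linarith)
  refine (a.accept_le hf ht2.le (D.critRMS γ (1 - α + 2 * γ)) fun y hy => ?_).trans (by linarith)
  have hsub : D.SRMS γ y ⊆ D.S n := fun s hs => hs.1
  rcases (D.SRMS γ y).eq_empty_or_nonempty with he | hne
  · rw [critRMS, he, bootQuantile_empty y (by linarith) (by linarith)]
    -- The critical value is `0` here, and `t ≥ 0` because the distribution function of the full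
    -- maximum at `0` is at most `θ < 1 - α`.
    by_contra hlt
    push Not at hlt
    have := gaussCDF_mono_right (D := D) w (D.S n) hlt.le
    have := b.all
    linarith
  · refine a.bootQuantile_le hy hsub hne (by linarith) ?_
    exact le_trans (by linarith) (gaussCDF_anti_left w hsub t)

/-- Triples whose standardized statistic is not too small survive the pretest. -/
theorem mem_SRMS {γ l : ℝ} (hl0 : 0 ≤ l) (hlQ : l ≤ Q) {e : Fin n → Vec p}
    (hg : w.mean D.X + e ∈ good) (hc : l + η ≤ D.critPIA (1 - γ) (w.mean D.X + e))
    {s : Fin n × Fin p × ℝ} (hs : s ∈ D.S n)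
    (hx : -(2 * l) ≤ D.smooth (w.mean D.X) s / D.stdDev w s + D.smooth e s / D.stdDev w s) :
    s ∈ D.SRMS γ (w.mean D.X + e) := by
  refine ⟨hs, ?_⟩
  rw [a.statistic_eq hs hg]
  obtain ⟨-, h2⟩ := a.ratio _ hg s hs
  set x := D.smooth (w.mean D.X) s / D.stdDev w s + D.smooth e s / D.stdDev w s
  set ρ := D.stdDev w s / D.VHat (w.mean D.X + e) s
  obtain ⟨h3, h4⟩ := abs_le.1 h2
  have hη := a.η_pos
  have hr0 := a.r_nonneg
  have hr := a.r_le
  have hQr := a.Qr_le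
  have hlr : l * (2 * r) ≤ η := (mul_le_mul_of_nonneg_right hlQ (by linarith)).trans hQr
  -- The pretest threshold is at most `-2 * l - 2 * η`, while the scale error lowers the statistic
  -- to no less than `-2 * l - η`.
  rcases le_or_gt 0 x with hx0 | hx0
  · have : 0 ≤ ρ * x := mul_nonneg (by linarith) hx0
    linarith
  · have : (1 + r) * x ≤ ρ * x := by nlinarith
    nlinarith

/-- One surviving triple suffices: the standard normal distribution function at `-M` is at most `θ <
q - ε`. Without survivors the critical value is `0`. -/
theorem neg_le_critRMS {θ M : ℝ} {N : ℕ} (b : TailApprox D w ε θ M N) {γ q : ℝ} (hq0 : 0 < q)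
    (hq1 : q < 1) (hθ : θ < q - ε) {y : Fin n → Vec p} (hy : y ∈ good) :
    -M ≤ D.critRMS γ q y := by
  have hsub : D.SRMS γ y ⊆ D.S n := fun s hs => hs.1
  rcases (D.SRMS γ y).eq_empty_or_nonempty with he | ⟨s, hs⟩
  · rw [critRMS, he, bootQuantile_empty y hq0 hq1.le]
    linarith [b.M_nonneg]
  · refine a.le_bootQuantile hy hsub ⟨s, hs⟩ hq1 (lt_of_le_of_lt ?_ hθ)
    exact (gaussCDF_anti_left w (Set.singleton_subset_iff.2 hs) _).trans (b.single s (hsub hs))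

/-- The triples for which the regression function is much smaller than zero, relative to the
quantile `l`, do not lead to rejections. -/
theorem exists_event_critRMS {θ M : ℝ} {N : ℕ} (b : TailApprox D w ε θ M N)
    {γ q l : ℝ} (hq0 : 0 < q) (hq1 : q < 1) (hθ : θ < q - ε)
    (hl : 1 / 4 ≤ D.gaussCDF w (D.S n) l) (hlQ : l ≤ Q) :
    ∃ B : Set (Fin n → Vec p), (Measure.pi w.law).real B ≤ 2 * ε ∧ ∀ e ∉ B,
      w.mean D.X + e ∈ good → l + η ≤ D.critPIA (1 - γ) (w.mean D.X + e) →
      (∀ s ∈ D.S n, D.smooth e s / D.stdDev w s ≤ l) → ∀ s ∈ D.S n,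
      D.smooth (w.mean D.X) s / D.stdDev w s ≤ -l →
      D.smooth (w.mean D.X + e) s / D.VHat (w.mean D.X + e) s
        ≤ D.critRMS γ q (w.mean D.X + e) := by
  have hε := a.ε_pos
  have hM := b.M_nonneg
  have hlM := b.quantile_ge l hl
  set S2 := {s ∈ D.S n | -l - 2 * M < D.smooth (w.mean D.X) s / D.stdDev w s} with hS2
  have hS2S : S2 ⊆ D.S n := fun s hs => hs.1
  -- Either `N` independent statistics with mean above `-l - 2 * M` exist, or `S2` has fewer than
  -- `N` triples for each component and bandwidth.
  by_cases hbig : ∃ A ⊆ S2, A.ncard = N ∧ ∃ m h, ∀ s ∈ A, s.2 = (m, h)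
  · obtain ⟨A, hA2, hcard, hmh⟩ := hbig
    have hAS := hA2.trans hS2S
    have hne : A.Nonempty := Set.nonempty_of_ncard_ne_zero (by rw [hcard]; exact b.N_pos.ne')
    refine ⟨{e | ¬ ∀ s ∈ A, -(l / 2) ≤ D.smooth e s / D.stdDev w s}, ?_, ?_⟩
    · refine (a.lower A hAS hne _).trans ?_
      linarith [b.half l hl A hAS hne hcard]
    · intro e he hg hc hu s hs hsl
      have he' : ∀ s ∈ A, -(l / 2) ≤ D.smooth e s / D.stdDev w s := not_not.1 he
      have hsub : A ⊆ D.SRMS γ (w.mean D.X + e) := fun s hs => by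
        -- The sum of mean and error exceeds `-l - 2 * M - l / 2`, which is at least `-2 * l`
        -- because `4 * M ≤ l`.
        refine a.mem_SRMS (by linarith) hlQ hg hc (hAS hs) ?_
        have h1 : -l - 2 * M < D.smooth (w.mean D.X) s / D.stdDev w s := (hA2 hs).2
        linarith [he' s hs]
      have h0 : 0 ≤ D.critRMS γ q (w.mean D.X + e) := by
        refine a.le_bootQuantile hg (fun s hs => hs.1) (hne.mono hsub) hq1 (lt_of_le_of_lt ?_ hθ)
        exact (gaussCDF_anti_left w hsub _).trans (b.many A hAS hcard hmh)
      refine le_trans ?_ h0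
      rw [a.statistic_eq hs hg]
      refine mul_nonpos_of_nonneg_of_nonpos ?_ (by linarith [hu s hs])
      exact (div_pos (a.stdDev_pos s hs) (a.ratio _ hg s hs).1).le
  · have hfib : ∀ m h, {s ∈ S2 | s.2 = (m, h)}.ncard < N := fun m h => by
      by_contra hcon
      push Not at hcon
      obtain ⟨A, hA, hcard⟩ := Set.exists_subset_card_eq hcon
      exact hbig ⟨A, fun s hs => (hA hs).1, hcard, m, h, fun s hs => (hA hs).2⟩
    have hmain : ∀ e : Fin n → Vec p, (∀ s ∈ S2, D.smooth e s / D.stdDev w s ≤ l - 2 * M) →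
        w.mean D.X + e ∈ good → (∀ s ∈ D.S n, D.smooth e s / D.stdDev w s ≤ l) → ∀ s ∈ D.S n,
        D.smooth (w.mean D.X) s / D.stdDev w s ≤ -l →
        D.smooth (w.mean D.X + e) s / D.VHat (w.mean D.X + e) s
          ≤ D.critRMS γ q (w.mean D.X + e) := fun e he hg hu s hs hsl => by
      refine le_trans ?_ (a.neg_le_critRMS b hq0 hq1 hθ hg)
      rw [a.statistic_eq hs hg]
      -- In `S2` the mean is at most `-l` and the error at most `l - 2 * M`; outside `S2` the mean
      -- is at most `-l - 2 * M` and the error at most `l`. As the ratio is at least `1 / 2`, the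
      -- statistic is at most `-M`.
      have hx : D.smooth (w.mean D.X) s / D.stdDev w s + D.smooth e s / D.stdDev w s
          ≤ -(2 * M) := by
        by_cases h2 : s ∈ S2
        · linarith [he s h2]
        · have : D.smooth (w.mean D.X) s / D.stdDev w s ≤ -l - 2 * M := by
            by_contra hcon
            push Not at hcon
            exact h2 ⟨hs, hcon⟩
          linarith [hu s hs]
      obtain ⟨h3, -⟩ := abs_le.1 (a.ratio _ hg s hs).2
      have hr := a.r_le
      nlinarith
    rcases S2.eq_empty_or_nonempty with he | hne
    · refine ⟨∅, by simp [hε.le], fun e _ hg _ hu => hmain e (by simp [he]) hg hu⟩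
    · refine ⟨{e | ¬ ∀ s ∈ S2, D.smooth e s / D.stdDev w s ≤ l - 2 * M}, ?_,
        fun e he hg _ hu => hmain e (not_not.1 he) hg hu⟩
      refine (a.upper S2 hS2S hne _).trans ?_
      linarith [b.sparse l hl S2 hS2S hne hfib]

/-- The moment selection test has the level `α`, approximately. -/
theorem le_acceptRMS {θ M : ℝ} {N : ℕ} (b : TailApprox D w ε θ M N)
    (hf : ∀ (i : Fin n) m, w.f m (D.X i) ≤ 0) {α γ : ℝ} (hγ0 : 0 < γ) (hγ : γ < α / 2)
    (hε12 : 12 * ε ≤ 1) (h : 2 * ε < 1 - α) (hθ : θ < 1 - α - ε) :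
    1 - α - 19 * ε ≤ D.acceptRMS α γ w := by
  have hε := a.ε_pos
  have hη := a.η_pos
  -- The pretest quantile of level `1 - γ` is at least `l' = l + η`. From `γ < 1 / 2` and `12 ε ≤ 1`
  -- the distribution function at `l` is at least `1 / 4`, as the tail facts require.
  obtain ⟨l', hl'Q, hl1, hl2⟩ := a.exists_quantile subset_rfl a.nonempty (q := 1 - γ - ε)
    (by linarith) (by linarith)
  obtain ⟨l, rfl⟩ : ∃ l, l' = l + η := ⟨l' - η, by ring⟩
  have hlF : 1 - γ - 3 * ε ≤ D.gaussCDF w (D.S n) l := by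
    linarith [a.anti _ subset_rfl a.nonempty l]
  have hl4 : 1 / 4 ≤ D.gaussCDF w (D.S n) l := by linarith
  have hlQ : l ≤ Q := by linarith
  have hl0 : 0 ≤ l := by linarith [b.quantile_ge l hl4, b.M_nonneg]
  set q := 1 - α + 2 * γ with hq
  obtain ⟨B, hB, hBe⟩ := a.exists_event_critRMS b (γ := γ) (q := q) (by linarith) (by linarith)
    (by linarith) hl4 hlQ
  set S1 := {s ∈ D.S n | -l < D.smooth (w.mean D.X) s / D.stdDev w s} with hS1
  have hS1S : S1 ⊆ D.S n := fun s hs => hs.1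
  obtain ⟨t, B', ht, hB', hBe'⟩ : ∃ t, ∃ B' : Set (Fin n → Vec p),
      (S1.Nonempty → D.gaussCDF w S1 t < q - ε) ∧ (Measure.pi w.law).real B' ≤ 1 - q + 4 * ε ∧
      ∀ e ∉ B', ∀ s ∈ S1, D.smooth e s / D.stdDev w s ≤ t - η := by
    rcases S1.eq_empty_or_nonempty with he | hne
    · exact ⟨0, ∅, fun h => absurd he h.ne_empty, by simp; linarith, by simp [he]⟩
    · obtain ⟨t, -, ht1, ht2⟩ := a.exists_quantile hS1S hne (q := q - ε) (by linarith)
        (by linarith)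
      exact ⟨t, _, fun _ => ht2, (a.measure_exceed_le hS1S hne ht1).trans (by linarith),
        fun e he => not_not.1 he⟩
  -- The budget: `5 ε` for the bad event, `γ + 4 ε` for each side of `[-l, l]`, `2 ε` for `B`, and
  -- `α - 2 γ + 4 ε` for `B'`; in total `α + 19 ε`.
  have hall := measureReal_union_le_add (measureReal_union_le_add a.measure_bad_le
    (measureReal_union_le_add (a.upper _ subset_rfl a.nonempty l)
      (a.lower _ subset_rfl a.nonempty l))) (measureReal_union_le_add hB hB')
  refine le_trans (by linarith) (one_sub_le_of_compl hall fun e he => ?_)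
  simp only [Set.mem_union, not_or, Set.mem_ofPred_eq, not_not] at he
  obtain ⟨⟨⟨hg, hu, hlo⟩, hu', hlo'⟩, heB, heB'⟩ := he
  have hc : l + η ≤ D.critPIA (1 - γ) (w.mean D.X + e) :=
    a.le_bootQuantile hg subset_rfl a.nonempty (by linarith) hl2
  change D.testStat _ ≤ D.critRMS _ _ _
  rw [a.testStat_le_iff]
  intro s hs
  by_cases hs1 : s ∈ S1
  · refine (a.statistic_le hf hs hg (hlo s hs) (hu s hs)).trans ?_
    have hsub : S1 ⊆ D.SRMS γ (w.mean D.X + e) := fun s hs => by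
      refine a.mem_SRMS hl0 hlQ hg hc (hS1S hs) ?_
      have h1 : -l < D.smooth (w.mean D.X) s / D.stdDev w s := hs.2
      linarith [hlo' s (hS1S hs)]
    have h2 : t ≤ D.critRMS γ q (w.mean D.X + e) :=
      a.le_bootQuantile hg (fun s hs => hs.1) ⟨s, hsub hs1⟩ (by linarith)
        ((gaussCDF_anti_left w hsub _).trans_lt (ht ⟨s, hs1⟩))
    linarith [hBe' e heB' s hs1]
  · refine hBe e heB hg hc hu' s hs ?_
    by_contra hcon
    push Not at hcon
    exact hs1 ⟨hs, hcon⟩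

end Approx

end TestSetup

/-! ### Tails of the standard normal distribution -/

/-- The standard normal distribution function. -/
def stdNormalCDF (t : ℝ) : ℝ := (gaussianReal 0 1).real (Set.Iic t)

theorem stdNormalCDF_mono : Monotone stdNormalCDF := fun _ _ h =>
  measureReal_mono (Set.Iic_subset_Iic.2 h)

theorem stdNormalCDF_nonneg (t : ℝ) : 0 ≤ stdNormalCDF t := measureReal_nonneg

theorem stdNormalCDF_le_one (t : ℝ) : stdNormalCDF t ≤ 1 := measureReal_le_one

theorem tendsto_stdNormalCDF_atBot : Tendsto stdNormalCDF atBot (𝓝 0) :=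
  (tendsto_cdf_atBot (gaussianReal 0 1)).congr fun t => cdf_eq_real _ t

/-- The mass of `(t, t + 1]` is at least the density at `t + 1`, and `√(2π) ≤ 3`. -/
theorem le_one_sub_stdNormalCDF {t : ℝ} (ht : 0 ≤ t) :
    Real.exp (-(t + 1) ^ 2 / 2) / 3 ≤ 1 - stdNormalCDF t := by
  have h1 : gaussianPDFReal 0 1 (t + 1) ≤ (gaussianReal 0 1).real (Set.Ioc t (t + 1)) := by
    have := le_gaussianReal_Ioc (a := t) (b := t + 1) (C := gaussianPDFReal 0 1 (t + 1))
      (by linarith) (fun x hx => by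
        have := gaussianPDFReal_le_mul_exp (u := t + 1) (v := x) (C := 0)
          (by nlinarith [hx.1, hx.2])
        simpa using this)
    linarith
  have h2 : (gaussianReal 0 1).real (Set.Ioc t (t + 1)) + stdNormalCDF t ≤ 1 := by
    rw [stdNormalCDF, add_comm, ← measureReal_union]
    · exact measureReal_le_one
    · exact Set.disjoint_left.2 fun x hx hx' => absurd hx'.1 (not_lt.2 hx)
    · exact measurableSet_Ioc
  have h3 : Real.exp (-(t + 1) ^ 2 / 2) / 3 ≤ gaussianPDFReal 0 1 (t + 1) := by
    have hpi : √(2 * Real.pi) ≤ 3 :=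
      Real.sqrt_le_iff.2 ⟨by norm_num, by nlinarith [Real.pi_lt_d2]⟩
    have hpi0 : 0 < √(2 * Real.pi) := Real.sqrt_pos.2 (by positivity)
    simp only [gaussianPDFReal, sub_zero, NNReal.coe_one, mul_one]
    rw [div_eq_inv_mul]
    gcongr
  linarith

theorem stdNormalCDF_lt_one (t : ℝ) : stdNormalCDF t < 1 := by
  refine (stdNormalCDF_mono (le_max_left t 0)).trans_lt ?_
  have := le_one_sub_stdNormalCDF (le_max_right t 0)
  have := Real.exp_pos (-(max t 0 + 1) ^ 2 / 2)
  linarith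

theorem tendsto_exp_neg_sq_mul (a b c₀ c₁ : ℝ) :
    Tendsto (fun l : ℝ => a * (c₀ + c₁ * (l + 1) ^ 2) * Real.exp (-(l - b) ^ 2 / 2)) atTop
      (𝓝 0) := by
  have hpoly : ∀ k : ℕ, Tendsto (fun x : ℝ => x ^ k * Real.exp (-x)) atTop (𝓝 0) :=
    Real.tendsto_pow_mul_exp_neg_atTop_nhds_zero
  have hmain : Tendsto (fun x : ℝ => |a| * (|c₀| + |c₁| * (x + b + 1) ^ 2) * Real.exp (-x)) atTop
      (𝓝 0) := by
    have e : (fun x : ℝ => |a| * (|c₀| + |c₁| * (x + b + 1) ^ 2) * Real.exp (-x)) = fun x =>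
        |a| * |c₁| * (x ^ 2 * Real.exp (-x)) + 2 * (b + 1) * (|a| * |c₁|) * (x ^ 1 * Real.exp (-x))
          + (|a| * |c₀| + |a| * |c₁| * (b + 1) ^ 2) * (x ^ 0 * Real.exp (-x)) := by
      funext x; ring
    rw [e]
    simpa using (((hpoly 2).const_mul (|a| * |c₁|)).add
      ((hpoly 1).const_mul (2 * (b + 1) * (|a| * |c₁|)))).add
      ((hpoly 0).const_mul (|a| * |c₀| + |a| * |c₁| * (b + 1) ^ 2))
  have hshift : Tendsto (fun l : ℝ => l - b) atTop atTop := tendsto_atTop_add_const_right _ _ tendsto_id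
  have hcomp := hmain.comp hshift
  refine squeeze_zero_norm' ?_ hcomp
  filter_upwards [hshift.eventually_ge_atTop 2] with l hl
  simp only [Function.comp_apply, sub_add_cancel, Real.norm_eq_abs, abs_mul, Real.abs_exp]
  have h1 : |c₀ + c₁ * (l + 1) ^ 2| ≤ |c₀| + |c₁| * (l + 1) ^ 2 := by
    refine (abs_add_le _ _).trans_eq ?_
    rw [abs_mul, abs_of_nonneg (sq_nonneg (l + 1))]
  have h2 : Real.exp (-(l - b) ^ 2 / 2) ≤ Real.exp (-(l - b)) := by
    gcongr
    nlinarith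
  gcongr

/-! ### Explicit bounds that imply the approximations -/

namespace TestSetup

variable {d p n : ℕ} {D : TestSetup d p}

section Bounds

variable {C : ℝ} (hW : WeightBounds D n C) (hH : D.BandwidthConditions)
  (hK : D.KernelConditions) {c : ClassConstants} {w : Model d p n}
  (hw : w.DisturbanceConditions c D.X)

include hW hH hK hw

/-- Sufficient conditions for the approximations. -/
theorem approx_of_bounds (hne : (D.S n).Nonempty)
    (hpsd : ∀ y i, (D.sigmaHat n y i).PosSemidef) {ε η Q β δ M : ℝ} (hε : 0 < ε) (hη : 0 < η)
    (hQ : 1 ≤ Q) (hηQ : η ≤ 1 / (Q + 1)) (hβ : 0 ≤ β) (hδ0 : 0 < δ) (hδ : δ ≤ c.Cvar / 4)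
    (hδ1 : δ ≤ 1) (hδQ : Q * (2 * (2 * δ / c.Cvar)) ≤ η) (hM1 : 1 + c.Cmom ≤ M)
    (hM2 : 12 * Real.exp ((1 + c.Cmom) / 2) ≤ M)
    (h1 : (D.S n).ncard * Real.exp (-(β * (η / 2))) ≤ ε / 8)
    (h2 : n * (26 * (β * √(C ^ 3 / c.Cvar / (n * D.hmin n ^ d))) ^ 3 * (p * M)) ≤ ε / 4)
    (h3 : Real.exp 4 * η * (Q + 1) + (D.S n).ncard * Real.exp (-(Q - 1) ^ 2 / 2) ≤ ε / 4)
    (h4 : (D.S n).ncard * Real.exp (-η ^ 2 /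
      (2 * (2 / c.Cvar * (1 + 4 / c.Cvar ^ 2 * (2 + c.Cmom)) * δ))) ≤ ε / 2)
    (h5 : (D.S n).ncard * Real.exp (-Q ^ 2 / 2) ≤ ε) (h6 : stdNormalCDF (-Q) ≤ ε)
    (hcons : (w.dataLaw D.X).real {y | ∃ i : Fin n,
      δ < ‖Matrix.toEuclideanCLM (𝕜 := ℝ) (D.sigmaHat n y i - w.cov i)‖} ≤ ε) :
    Approx D w ε η Q (2 * δ / c.Cvar) {y | ∀ i : Fin n,
      ‖Matrix.toEuclideanCLM (𝕜 := ℝ) (D.sigmaHat n y i - w.cov i)‖ ≤ δ} := by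
  have hfin := finite_S hH n
  have hcv := c.Cvar_pos
  have hanti : ∀ A : Finset (Fin n × Fin p × ℝ), (A : Set _) ⊆ D.S n → A.Nonempty → ∀ t,
      D.gaussCDF w A (t + η) ≤ D.gaussCDF w A t + ε / 4 := fun A hA hne t =>
    (gaussCDF_add_le hW hH hw hne hA hQ hη.le hηQ t).trans (by linarith)
  have hcmp : ∀ A : Finset (Fin n × Fin p × ℝ), (A : Set _) ⊆ D.S n → A.Nonempty → ∀ t, _ :=
    fun A hA hne t => gaussCDF_compare hW hH hw hK hne hA hβ (by positivity : 0 < ε / 8) h1 hM1 hM2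
      h2 t
  have hη2 : 2 * (η / 2) = η := by ring
  have hlift : ∀ A ⊆ D.S n, A.Nonempty → ∃ B : Finset (Fin n × Fin p × ℝ), (B : Set _) = A ∧
      B.Nonempty := fun A hA hne => by
    obtain ⟨B, hB⟩ := (hfin.subset hA).exists_finset_coe
    exact ⟨B, hB, by rw [← Finset.coe_nonempty, hB]; exact hne⟩
  have hcompl : ∀ (A : Finset (Fin n × Fin p × ℝ)) (f : (Fin n × Fin p × ℝ) → Fin n → ℝ) (t : ℝ),
      (Measure.pi w.law).real {e | ¬ ∀ s ∈ A, linForm (f s) s.2.1 e ≤ t}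
        = 1 - (Measure.pi w.law).real {e | ∀ s ∈ A, linForm (f s) s.2.1 e ≤ t} := fun A f t => by
    rw [← probReal_compl_eq_one_sub
      (measurableSet_forall_le A (fun s => measurable_linForm _ _) t)]
    rfl
  refine
    { finite := hfin
      nonempty := hne
      ε_pos := hε
      η_pos := hη
      Q_pos := by linarith
      r_nonneg := by positivity
      r_le := by rw [div_le_iff₀ hcv]; linarith
      Qr_le := hδQ
      stdDev_pos := fun s hs => stdDev_pos hW hH hw hs
      weight_nonneg := fun h hh i j => weight_nonneg hK (H_pos hH hh) i j
      anti := ?_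
      upper := ?_
      lower := ?_
      all_le := ?_
      boot := ?_
      ratio := fun y hy s hs => abs_VHat_ratio hW hH hw hy hs (by linarith)
      good_compl := ?_
      top := ?_
      bot := ?_ }
  · intro A hA hne t
    obtain ⟨B, rfl, hB⟩ := hlift A hA hne
    linarith [hanti B hA hB t]
  · intro A hA hne t
    obtain ⟨B, rfl, hB⟩ := hlift A hA hne
    -- The comparison starts at `t - η`, so that its shift of `2 * (η / 2)` ends at `t`;
    -- anti-concentration then moves the Gaussian side back to `t`.
    obtain ⟨-, h, -⟩ := hcmp B hA hB (t - η)
    have h' := hanti B hA hB (t - η)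
    rw [hη2] at h
    rw [sub_add_cancel] at h h'
    simp only [smooth_div_stdDev, Finset.mem_coe] at h ⊢
    rw [hcompl]
    linarith
  · intro A hA hne t
    obtain ⟨B, rfl, hB⟩ := hlift A hA hne
    obtain ⟨-, -, h⟩ := hcmp B hA hB (t - η)
    have h' := hanti B hA hB (t - η)
    rw [hη2] at h
    rw [sub_add_cancel] at h h'
    have e : ∀ (e : Fin n → Vec p) (s : Fin n × Fin p × ℝ), -t ≤ D.smooth e s / D.stdDev w s ↔
        linForm (-D.coef w s) s.2.1 e ≤ t := fun e s => by
      rw [linForm_neg_left, smooth_div_stdDev, neg_le]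
    simp only [smooth_div_stdDev, ← linForm_neg_left] at h
    simp only [e, Finset.mem_coe]
    rw [hcompl B (fun s => -D.coef w s)]
    linarith
  · intro t
    obtain ⟨B, hBS, hB⟩ := hlift _ subset_rfl hne
    obtain ⟨h, -, -⟩ := hcmp B hBS.le hB t
    have h' := hanti B hBS.le hB t
    rw [hη2] at h
    rw [← hBS]
    simp only [Finset.mem_coe]
    linarith
  · intro y hy A hA hne t
    obtain ⟨B, rfl, hB⟩ := hlift A hA hne
    have h := fun t => bootLaw_compare hW hH hw hy (hpsd y) hB hA hδ0 (by linarith) hδ1 hη.le h4 t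
    have hu := (h t).1
    have hl := (h (t - η)).2
    have h' := hanti B hA hB (t - η)
    rw [sub_add_cancel] at hl h'
    rw [abs_le]
    constructor <;> linarith [hanti B hA hB t]
  · rw [Model.dataLaw_real] at hcons
    refine le_trans (measureReal_mono fun e he => ?_) hcons
    change ¬ ∀ i : Fin n, _ at he
    push Not at he
    exact he
  · obtain ⟨B, hBS, hB⟩ := hlift _ subset_rfl hne
    have := one_sub_gaussCDF_le hW hH hw hBS.le (t := Q) (by linarith)
    rw [← Set.ncard_coe_finset, hBS] at this
    linarith
  · intro s hs
    rw [gaussCDF_singleton hW hH hw hs]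
    exact h6

/-- Sufficient conditions for the tail approximations. -/
theorem tailApprox_of_bounds (hI : D.TestPointConditions) (hp : 0 < p) {ε θ M l₀ b C₀ h : ℝ}
    {N : ℕ} (hM : 0 ≤ M) (hN : 0 < N) (hl₀ : 0 ≤ l₀) (hMl : 4 * M ≤ l₀)
    (h1 : stdNormalCDF (-M) ≤ θ) (h2 : stdNormalCDF 0 ^ N ≤ θ) (hb : 1 < b) (hC₀ : 0 < C₀)
    (hh : h ∈ D.H n) (hcard : C₀ * b ^ (D.H n).ncard ≤ (D.I n h).ncard) (hNI : N ≤ (D.I n h).ncard)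
    (hl : stdNormalCDF l₀ ^ (D.I n h).ncard < 1 / 4)
    (h3 : ∀ l ≥ l₀, N * Real.exp (-(l / 2) ^ 2 / 2) ≤ ε)
    (h4 : ∀ l ≥ l₀, p * N * (Real.log (6 / C₀) / Real.log b + 1 / (2 * Real.log b) * (l + 1) ^ 2) *
      Real.exp (-(l - 2 * M) ^ 2 / 2) ≤ ε) :
    TailApprox D w ε θ M N := by
  have hfin := finite_S hH n
  have hlift : ∀ A ⊆ D.S n, ∃ B : Finset (Fin n × Fin p × ℝ), (B : Set _) = A ∧
      B.card = A.ncard := fun A hA => by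
    obtain ⟨B, hB⟩ := (hfin.subset hA).exists_finset_coe
    exact ⟨B, hB, by rw [← hB, Set.ncard_coe_finset]⟩
  have hmany : ∀ A ⊆ D.S n, (∃ m h, ∀ s ∈ A, s.2 = (m, h)) → ∀ t,
      D.gaussCDF w A t = stdNormalCDF t ^ A.ncard := fun A hA ⟨m, h, hmh⟩ t => by
    obtain ⟨B, rfl, hc⟩ := hlift A hA
    rw [gaussCDF_eq_pow hW hH hw hK hI hA hmh, hc]
    rfl
  -- All test points of one bandwidth, for a single component: independent statistics that bound the
  -- distribution function of the full maximum by a power.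
  set A₀ : Set (Fin n × Fin p × ℝ) := (fun i => (i, (⟨0, hp⟩, h))) '' D.I n h with hA₀
  have hA₀S : A₀ ⊆ D.S n := by
    rintro _ ⟨i, hi, rfl⟩
    exact ⟨hh, hi⟩
  have hA₀card : A₀.ncard = (D.I n h).ncard :=
    Set.ncard_image_of_injective _ fun i j hij => (Prod.mk.inj hij).1
  have hSle : ∀ t, D.gaussCDF w (D.S n) t ≤ stdNormalCDF t ^ (D.I n h).ncard := fun t => by
    refine (gaussCDF_anti_left w hA₀S t).trans_eq ?_
    rw [hmany A₀ hA₀S ⟨⟨0, hp⟩, h, by rintro _ ⟨i, -, rfl⟩; rfl⟩, hA₀card]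
  have hlow : ∀ l, 1 / 4 ≤ D.gaussCDF w (D.S n) l → l₀ ≤ l := fun l hq => by
    by_contra hlt
    push Not at hlt
    have := pow_le_pow_left₀ (stdNormalCDF_nonneg l) (stdNormalCDF_mono hlt.le) (D.I n h).ncard
    linarith [hSle l]
  have htail : ∀ A ⊆ D.S n, ∀ t, 0 ≤ t →
      1 - A.ncard * Real.exp (-t ^ 2 / 2) ≤ D.gaussCDF w A t := fun A hA t ht => by
    obtain ⟨B, rfl, hc⟩ := hlift A hA
    have := one_sub_gaussCDF_le hW hH hw hA ht
    rw [hc] at this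
    linarith
  refine
    { M_nonneg := hM
      N_pos := hN
      single := fun s hs => by rw [gaussCDF_singleton hW hH hw hs]; exact h1
      many := fun A hA hc hmh => by rw [hmany A hA hmh, hc]; exact h2
      all := (hSle 0).trans ((pow_le_pow_of_le_one (stdNormalCDF_nonneg 0) (stdNormalCDF_le_one 0)
        hNI).trans h2)
      quantile_ge := fun l hq => hMl.trans (hlow l hq)
      half := fun l hq A hA hne hc => ?_
      sparse := fun l hq A hA hne hfib => ?_ }
  · have hl0 := hlow l hq
    have := htail A hA (l / 2) (by linarith)
    rw [hc] at this
    linarith [h3 l hl0]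
  · have hl0 := hlow l hq
    have hlpos : 0 ≤ l := hl₀.trans hl0
    refine le_trans ?_ (htail A hA (l - 2 * M) (by linarith))
    have hcardA : A.ncard ≤ (D.H n).ncard * p * N := by
      have hHf := finite_H hH n
      obtain ⟨F, hF⟩ := hHf.exists_finset_coe
      have hFc : F.card = (D.H n).ncard := by rw [← hF, Set.ncard_coe_finset]
      have hsub : A ⊆ ⋃ r ∈ (Finset.univ : Finset (Fin p)) ×ˢ F, {s ∈ A | s.2 = (r.1, r.2)} :=
        fun s hs => by
          simp only [Set.mem_iUnion]
          refine ⟨s.2, ?_, hs, rfl⟩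
          rw [Finset.mem_product]
          refine ⟨Finset.mem_univ _, ?_⟩
          rw [← Finset.mem_coe, hF]
          exact (hA hs).1
      have hfinU : (⋃ r ∈ (Finset.univ : Finset (Fin p)) ×ˢ F,
          {s ∈ A | s.2 = (r.1, r.2)}).Finite :=
        (hfin.subset hA).subset (Set.iUnion₂_subset fun r _ s hs => hs.1)
      refine (Set.ncard_le_ncard hsub hfinU).trans ?_
      refine (Finset.set_ncard_biUnion_le _ _).trans ?_
      refine (Finset.sum_le_card_nsmul _ _ N fun r _ => (hfib r.1 r.2).le).trans_eq ?_
      rw [Finset.card_product, Finset.card_univ, Fintype.card_fin, hFc, smul_eq_mul]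
      ring
    have hx := le_one_sub_stdNormalCDF hlpos
    -- With `1 - x ≤ exp (-x)` the quartile condition yields `(1 - Φ(l)) * #I ≤ 2`. The lower bound
    -- on the normal tail then gives `#I ≤ 6 exp ((l + 1)² / 2)`, and exponential growth of `#I` in
    -- `|H_n|` gives `|H_n| = O(l²)`.
    have hquart : (1 : ℝ) / 4 ≤ Real.exp (-((1 - stdNormalCDF l) * (D.I n h).ncard)) := by
      refine hq.trans ((hSle l).trans ?_)
      have : stdNormalCDF l ≤ Real.exp (-(1 - stdNormalCDF l)) := by
        linarith [Real.add_one_le_exp (-(1 - stdNormalCDF l))]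
      refine (pow_le_pow_left₀ (stdNormalCDF_nonneg l) this _).trans_eq ?_
      rw [← Real.exp_nat_mul]
      congr 1
      ring
    have hle2 : (1 - stdNormalCDF l) * (D.I n h).ncard ≤ 2 := by
      by_contra hcon
      push Not at hcon
      have h5 : Real.exp (-((1 - stdNormalCDF l) * (D.I n h).ncard)) < Real.exp (-2) := by
        gcongr
      have h6 : Real.exp (-2) < 1 / 4 := by
        have h7 : (2 : ℝ) < Real.exp 1 := by linarith [Real.exp_one_gt_d9]
        have h8 : Real.exp (-2) * (Real.exp 1 * Real.exp 1) = 1 := by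
          rw [← Real.exp_add, ← Real.exp_add]; norm_num
        have h9 := Real.exp_pos (-2)
        nlinarith [mul_pos h9 (sub_pos.2 h7)]
      linarith
    have hbK : C₀ * b ^ (D.H n).ncard ≤ 6 * Real.exp ((l + 1) ^ 2 / 2) := by
      refine hcard.trans ?_
      have h5 : Real.exp (-(l + 1) ^ 2 / 2) / 3 * (D.I n h).ncard ≤ 2 :=
        (mul_le_mul_of_nonneg_right hx (Nat.cast_nonneg _)).trans hle2
      have h6 : Real.exp ((l + 1) ^ 2 / 2) * Real.exp (-(l + 1) ^ 2 / 2) = 1 := by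
        rw [← Real.exp_add, neg_div, add_neg_cancel, Real.exp_zero]
      calc ((D.I n h).ncard : ℝ) = 3 * Real.exp ((l + 1) ^ 2 / 2) *
            (Real.exp (-(l + 1) ^ 2 / 2) / 3 * (D.I n h).ncard) := by
              linear_combination (-((D.I n h).ncard : ℝ)) * h6
        _ ≤ 3 * Real.exp ((l + 1) ^ 2 / 2) * 2 := by gcongr
        _ = _ := by ring
    have hKle : ((D.H n).ncard : ℝ) ≤
        Real.log (6 / C₀) / Real.log b + 1 / (2 * Real.log b) * (l + 1) ^ 2 := by
      have hlb : 0 < Real.log b := Real.log_pos hb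
      have h5 : b ^ (D.H n).ncard ≤ 6 / C₀ * Real.exp ((l + 1) ^ 2 / 2) := by
        rw [div_mul_eq_mul_div, le_div_iff₀ hC₀]; linarith
      have h6 := Real.log_le_log (by positivity) h5
      rw [Real.log_pow, Real.log_mul (by positivity) (Real.exp_pos _).ne', Real.log_exp] at h6
      have h7 : Real.log (6 / C₀) / Real.log b + 1 / (2 * Real.log b) * (l + 1) ^ 2
          = (Real.log (6 / C₀) + (l + 1) ^ 2 / 2) / Real.log b := by field_simp
      rw [h7, le_div_iff₀ hlb]
      exact h6
    have h5 : (A.ncard : ℝ) ≤ p * N * (Real.log (6 / C₀) / Real.log b +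
        1 / (2 * Real.log b) * (l + 1) ^ 2) := by
      calc (A.ncard : ℝ) ≤ ((D.H n).ncard * p * N : ℕ) := by exact_mod_cast hcardA
        _ = p * N * (D.H n).ncard := by push_cast; ring
        _ ≤ _ := by gcongr
    have h6 := h4 l hl0
    have h7 := mul_le_mul_of_nonneg_right h5 (Real.exp_pos (-(l - 2 * M) ^ 2 / 2)).le
    linarith

end Bounds

end TestSetup

/-! ### Choice of the parameters as the sample size grows -/

theorem eventually_pow_le_exp (k : ℕ) {κ C : ℝ} (hκ : 0 < κ) (hC : 0 < C) :
    ∀ᶠ x : ℝ in atTop, x ^ k ≤ C * Real.exp (κ * x) := by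
  filter_upwards [(isLittleO_pow_exp_pos_mul_atTop k hκ).bound hC, eventually_ge_atTop 0]
    with x hx hx0
  rwa [Real.norm_of_nonneg (pow_nonneg hx0 k), Real.norm_of_nonneg (Real.exp_pos _).le] at hx

theorem eventually_stdNormalCDF_neg_le {ε : ℝ} (hε : 0 < ε) :
    ∀ᶠ x : ℝ in atTop, stdNormalCDF (-x) ≤ ε :=
  (tendsto_stdNormalCDF_atBot.comp tendsto_neg_atTop_atBot).eventually (ge_mem_nhds hε)

/-- The conditions of the approximations that concern the choices `η = x⁻²`, `Q = x`,
`β = 6 x ^ 3` and `δ = exp (-κ x)`, where `x` is the logarithm of the sample size. -/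
theorem eventually_choices {ε κ Cvar v : ℝ} (hε : 0 < ε) (hκ : 0 < κ) (hCvar : 0 < Cvar)
    (hv : 0 < v) : ∀ᶠ x : ℝ in atTop, 1 ≤ x ∧ (x ^ 2)⁻¹ ≤ 1 / (x + 1) ∧
      Real.exp (-(κ * x)) ≤ Cvar / 4 ∧ Real.exp (-(κ * x)) ≤ 1 ∧
      x * (2 * (2 * Real.exp (-(κ * x)) / Cvar)) ≤ (x ^ 2)⁻¹ ∧
      Real.exp (2 * x) * Real.exp (-(6 * x ^ 3 * ((x ^ 2)⁻¹ / 2))) ≤ ε / 8 ∧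
      Real.exp 4 * (x ^ 2)⁻¹ * (x + 1) + Real.exp (2 * x) * Real.exp (-(x - 1) ^ 2 / 2) ≤ ε / 4 ∧
      Real.exp (2 * x) * Real.exp (-(x ^ 2)⁻¹ ^ 2 / (2 * (v * Real.exp (-(κ * x))))) ≤ ε / 2 ∧
      Real.exp (2 * x) * Real.exp (-x ^ 2 / 2) ≤ ε ∧ stdNormalCDF (-x) ≤ ε := by
  have hexp : ∀ {a}, 0 < a → ∀ᶠ x : ℝ in atTop, Real.exp (-x) ≤ a := fun ha =>
    (Real.tendsto_exp_atBot.comp tendsto_neg_atTop_atBot).eventually (ge_mem_nhds ha)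
  have hlin : Tendsto (fun x : ℝ => κ * x) atTop atTop := tendsto_id.const_mul_atTop hκ
  have hinv : Tendsto (fun x : ℝ => 2 * Real.exp 4 * x⁻¹) atTop (𝓝 0) := by
    simpa using tendsto_inv_atTop_zero.const_mul (2 * Real.exp 4)
  filter_upwards [eventually_ge_atTop 8, hlin.eventually (hexp (by positivity : 0 < Cvar / 4)),
    hlin.eventually (hexp one_pos), eventually_pow_le_exp 3 hκ (by positivity : 0 < Cvar / 4),
    eventually_pow_le_exp 5 hκ (by positivity : 0 < 1 / (6 * v)),
    hexp (by positivity : 0 < ε / 8), hinv.eventually (ge_mem_nhds (by positivity : 0 < ε / 8)),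
    eventually_stdNormalCDF_neg_le hε] with x hx h1 h2 h3 h4 h5 h6 h7
  have hx0 : 0 < x := by linarith
  have hprod : Real.exp (κ * x) * Real.exp (-(κ * x)) = 1 := by
    rw [← Real.exp_add, add_neg_cancel, Real.exp_zero]
  have hE := Real.exp_pos (-(κ * x))
  refine ⟨by linarith, ?_, h1, h2, ?_, ?_, ?_, ?_, ?_, h7⟩
  · rw [inv_eq_one_div]
    gcongr
    nlinarith
  · rw [← one_div, le_div_iff₀ (by positivity)]
    have := mul_le_mul_of_nonneg_right h3 hE.le
    rw [mul_assoc, hprod] at this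
    have e : x * (2 * (2 * Real.exp (-(κ * x)) / Cvar)) * x ^ 2
        = x ^ 3 * Real.exp (-(κ * x)) * (4 / Cvar) := by ring
    rw [e]
    calc _ ≤ Cvar / 4 * 1 * (4 / Cvar) := by gcongr
      _ = 1 := by field_simp
  · rw [← Real.exp_add]
    refine le_trans (Real.exp_le_exp.2 ?_) h5
    -- Here `exp (2 * x)` stands for `n ^ 2`, a bound on the number of triples; `β η / 2 = 3 x`
    -- leaves a factor `exp (-x)`.
    have : 6 * x ^ 3 * ((x ^ 2)⁻¹ / 2) = 3 * x := by field_simp; ring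
    rw [this]
    linarith
  · have h8 : Real.exp (2 * x) * Real.exp (-(x - 1) ^ 2 / 2) ≤ ε / 8 := by
      rw [← Real.exp_add]
      refine le_trans (Real.exp_le_exp.2 ?_) h5
      nlinarith
    have h9 : Real.exp 4 * (x ^ 2)⁻¹ * (x + 1) ≤ 2 * Real.exp 4 * x⁻¹ := by
      calc _ ≤ Real.exp 4 * (x ^ 2)⁻¹ * (2 * x) := by gcongr; linarith
        _ = _ := by field_simp
    linarith
  · rw [← Real.exp_add]
    refine le_trans (Real.exp_le_exp.2 ?_) (h5.trans (by linarith))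
    -- The variance of the coupling error is exponentially small in `x`, whereas `η` is only
    -- polynomially small.
    have h8 : 3 * x ≤ (x ^ 2)⁻¹ ^ 2 / (2 * (v * Real.exp (-(κ * x)))) := by
      rw [le_div_iff₀ (by positivity), inv_pow, ← one_div, le_div_iff₀ (by positivity)]
      have := mul_le_mul_of_nonneg_right h4 hE.le
      rw [mul_assoc, hprod] at this
      calc _ = 6 * v * (x ^ 5 * Real.exp (-(κ * x))) := by ring
        _ ≤ 6 * v * (1 / (6 * v) * 1) := by gcongr
        _ = 1 := by field_simp
    rw [neg_div]
    linarith
  · rw [← Real.exp_add]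
    refine le_trans (Real.exp_le_exp.2 ?_) (h5.trans (by linarith))
    nlinarith

namespace TestSetup

variable {d p : ℕ} {D : TestSetup d p}

theorem eventually_ncard_S_le (hH : D.BandwidthConditions) :
    ∀ᶠ n : ℕ in atTop, ((D.S n).ncard : ℝ) ≤ Real.exp (2 * Real.log n) := by
  obtain ⟨C, hC, hcard⟩ := hH.card
  have hlog : Tendsto (fun n : ℕ => Real.log n) atTop atTop :=
    Real.tendsto_log_atTop.comp tendsto_natCast_atTop_atTop
  filter_upwards [hcard, eventually_gt_atTop 0, hlog.eventually
    (eventually_pow_le_exp 1 one_pos (by positivity : 0 < 1 / (C * (p + 1))))] with n h1 h2 h3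
  have hn : (0 : ℝ) < n := by exact_mod_cast h2
  rw [one_mul, Real.exp_log hn, pow_one, div_mul_eq_mul_div, one_mul,
    le_div_iff₀ (by positivity)] at h3
  have e : Real.exp (2 * Real.log n) = n * n := by
    rw [two_mul, Real.exp_add, Real.exp_log hn]
  rw [e]
  calc ((D.S n).ncard : ℝ) ≤ (n * (p * (D.H n).ncard) : ℕ) := by exact_mod_cast ncard_S_le hH n
    _ = n * (p * (D.H n).ncard) := by push_cast; ring
    _ ≤ n * ((p + 1) * (C * Real.log n)) := by
        gcongr
        linarith
    _ = n * (Real.log n * (C * (p + 1))) := by ring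
    _ ≤ n * n := by gcongr

/-- With `β = 6 (log n)³` the replacement error is of order `n (log n)⁹ (n hmin ^ d) ^ (-3/2)`, the
square root of `(log n)¹⁸ / (hmin ^ (3 d) n)`. -/
theorem eventually_error_le (hH : D.BandwidthConditions)
    (hrate : Tendsto (fun n : ℕ => Real.log n ^ 19 / (D.hmin n ^ (3 * d) * n)) atTop (𝓝 0))
    {C' ε B : ℝ} (hC' : 0 < C') (hε : 0 < ε) (hB : 0 ≤ B) : ∀ᶠ n : ℕ in atTop,
      n * (26 * (6 * Real.log n ^ 3 * √(C' / (n * D.hmin n ^ d))) ^ 3 * B) ≤ ε := by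
  have hlog : Tendsto (fun n : ℕ => Real.log n) atTop atTop :=
    Real.tendsto_log_atTop.comp tendsto_natCast_atTop_atTop
  have h := ((hrate.const_mul (C' ^ 3)).sqrt).const_mul (26 * 216 * B)
  rw [mul_zero, Real.sqrt_zero, mul_zero] at h
  filter_upwards [h.eventually (ge_mem_nhds hε), eventually_gt_atTop 0,
    hlog.eventually_ge_atTop 1] with n h1 h2 h3
  refine le_trans ?_ h1
  have hn : (0 : ℝ) < n := by exact_mod_cast h2
  have hm := hH.hmin_pos n
  set x := Real.log n
  have hroot : n * √(C' / (n * D.hmin n ^ d)) ^ 3 * x ^ 9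
      ≤ √(C' ^ 3 * (x ^ 19 / (D.hmin n ^ (3 * d) * n))) := by
    refine Real.le_sqrt_of_sq_le ?_
    have e : (n * √(C' / (n * D.hmin n ^ d)) ^ 3 * x ^ 9) ^ 2
        = n ^ 2 * (√(C' / (n * D.hmin n ^ d)) ^ 2) ^ 3 * x ^ 18 := by ring
    rw [e, Real.sq_sqrt (by positivity)]
    have e2 : (n : ℝ) ^ 2 * (C' / (n * D.hmin n ^ d)) ^ 3 * x ^ 18
        = C' ^ 3 * (x ^ 18 / (D.hmin n ^ (3 * d) * n)) := by
      rw [pow_mul']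
      field_simp
    rw [e2]
    gcongr
    · norm_num
  calc _ = 26 * 216 * B * (n * √(C' / (n * D.hmin n ^ d)) ^ 3 * x ^ 9) := by ring
    _ ≤ _ := by gcongr

theorem eventually_approx {c : ClassConstants} {κ : ℝ} (hκ : 0 < κ) (hd : 0 < d) (hp : 0 < p)
    (hX : D.DesignConditions) (hH : D.BandwidthConditions)
    (hV : D.VarianceEstimatorConditions c κ) (hK : D.KernelConditions)
    (hI : D.TestPointConditions)
    (hrate : Tendsto (fun n : ℕ => Real.log n ^ 19 / (D.hmin n ^ (3 * d) * n)) atTop (𝓝 0))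
    {ε : ℝ} (hε : 0 < ε) : ∀ᶠ n : ℕ in atTop, ∃ η Q r, ∀ w ∈ nullClass p c D.X n,
      ∃ good, Approx D w ε η Q r good := by
  obtain ⟨C, hC⟩ := eventually_weightBounds hX hH hK
  obtain ⟨C₀, b, hC₀, hb, hmany⟩ := exists_many_testPoints hX hH hI hd
  obtain ⟨n₀, hn₀⟩ := hC.exists
  have hCpos := hn₀.pos
  have hcv := c.Cvar_pos
  have hcm := c.Cmom_pos
  have hlog : Tendsto (fun n : ℕ => Real.log n) atTop atTop :=
    Real.tendsto_log_atTop.comp tendsto_natCast_atTop_atTop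
  set M := 1 + c.Cmom + 12 * Real.exp ((1 + c.Cmom) / 2) with hM
  set v := 2 / c.Cvar * (1 + 4 / c.Cvar ^ 2 * (2 + c.Cmom)) with hv
  have hE := Real.exp_pos ((1 + c.Cmom) / 2)
  filter_upwards [hC, hmany, eventually_gt_atTop 0, eventually_ncard_S_le hH,
    eventually_error_le hH hrate (C' := C ^ 3 / c.Cvar) (ε := ε / 4) (B := p * M) (by positivity)
      (by positivity) (by positivity), hV.consistent 1 one_pos ε hε,
    hlog.eventually (eventually_choices hε hκ hcv (by positivity : 0 < v))]
    with n hW hI' hn hcard herr hcons hch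
  obtain ⟨c1, c2, c3, c4, c5, c6, c7, c8, c9, c10⟩ := hch
  obtain ⟨h, hh, hIh⟩ := hI'
  have hn' : (0 : ℝ) < n := by exact_mod_cast hn
  have hne : (D.S n).Nonempty := by
    have : (0 : ℝ) < (D.I n h).ncard := lt_of_lt_of_le (by positivity) hIh
    obtain ⟨i, hi⟩ := Set.nonempty_of_ncard_ne_zero (by exact_mod_cast this.ne')
    exact ⟨(i, ⟨0, hp⟩, h), hh, hi⟩
  -- The accuracy of the covariance estimators is taken at `n ^ (-κ)`, a negative exponential of
  -- `log n`.
  have hδ : (1 : ℝ) * (n : ℝ) ^ (-κ) = Real.exp (-(κ * Real.log n)) := by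
    rw [one_mul, Real.rpow_def_of_pos hn']
    congr 1
    ring
  rw [hδ] at hcons
  have hmul : ∀ {x y : ℝ}, Real.exp (2 * Real.log n) * Real.exp x ≤ y →
      (D.S n).ncard * Real.exp x ≤ y := fun h =>
    (mul_le_mul_of_nonneg_right hcard (Real.exp_pos _).le).trans h
  refine ⟨_, _, _, fun w hw => ⟨_, approx_of_bounds hW hH hK hw.1.1 hne (hV.posSemidef n) hε
    (η := (Real.log n ^ 2)⁻¹) (by positivity) c1 c2 (β := 6 * Real.log n ^ 3) (by positivity)
    (Real.exp_pos _) c3 c4 c5 (M := M) (by linarith) (by linarith) (hmul c6) herr ?_ (hmul c8)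
    (hmul c9) c10 (hcons w hw)⟩⟩
  exact le_trans (add_le_add_right (hmul le_rfl) _) c7

/-- `M` and `N` depend on `θ` but not on `ε`: they only bring one normal tail and a power of `Φ(0)`
below `θ`. Smallness in `ε` comes from `l`, which is forced above any fixed `l₀` by the growing
number of independent test points. -/
theorem eventually_tailApprox {c : ClassConstants} (hd : 0 < d) (hp : 0 < p)
    (hX : D.DesignConditions) (hH : D.BandwidthConditions) (hK : D.KernelConditions)
    (hI : D.TestPointConditions) {θ : ℝ} (hθ : 0 < θ) : ∃ M N, ∀ ε, 0 < ε →
      ∀ᶠ n : ℕ in atTop, ∀ w ∈ nullClass p c D.X n, TailApprox D w ε θ M N := by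
  obtain ⟨C, hC⟩ := eventually_weightBounds hX hH hK
  obtain ⟨C₀, b, hC₀, hb, hmany⟩ := exists_many_testPoints hX hH hI hd
  obtain ⟨M, hM0, hM⟩ := ((eventually_ge_atTop 0).and (eventually_stdNormalCDF_neg_le hθ)).exists
  have hpow : ∀ t, Tendsto (fun k : ℕ => stdNormalCDF t ^ k) atTop (𝓝 0) := fun t =>
    tendsto_pow_atTop_nhds_zero_of_lt_one (stdNormalCDF_nonneg t) (stdNormalCDF_lt_one t)
  obtain ⟨N, hN0, hN⟩ := ((eventually_gt_atTop 0).and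
    ((hpow 0).eventually (ge_mem_nhds hθ))).exists
  refine ⟨M, N, fun ε hε => ?_⟩
  have h3 : ∀ᶠ l : ℝ in atTop, N * Real.exp (-(l / 2) ^ 2 / 2) ≤ ε := by
    have h := (tendsto_exp_neg_sq_mul N 0 1 0).comp
      (tendsto_id.atTop_div_const (by norm_num : (0 : ℝ) < 2))
    filter_upwards [h.eventually (ge_mem_nhds hε)] with l hl
    simpa using hl
  have h4 := (tendsto_exp_neg_sq_mul (p * N) (2 * M) (Real.log (6 / C₀) / Real.log b)
    (1 / (2 * Real.log b))).eventually (ge_mem_nhds hε)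
  obtain ⟨l₁, hl₁⟩ := eventually_atTop.1 (h3.and h4)
  set l₀ := max l₁ (4 * M)
  obtain ⟨k₀, hk₀⟩ := eventually_atTop.1
    ((hpow l₀).eventually (gt_mem_nhds (by norm_num : (0 : ℝ) < 1 / 4)))
  have hgrow : Tendsto (fun n => C₀ * b ^ (D.H n).ncard) atTop atTop :=
    ((tendsto_pow_atTop_atTop_of_one_lt hb).comp (tendsto_ncard_H hH)).const_mul_atTop hC₀
  filter_upwards [hC, hmany, hgrow.eventually_ge_atTop (max k₀ N : ℕ)] with n hW hI' hg w hw
  obtain ⟨h, hh, hIh⟩ := hI'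
  have hcard : max k₀ N ≤ (D.I n h).ncard := by exact_mod_cast hg.trans hIh
  exact tailApprox_of_bounds hW hH hK hw.1.1 hI hp hM0 hN0
    ((by positivity : 0 ≤ 4 * M).trans (le_max_right _ _)) (le_max_right _ _) hM hN hb hC₀ hh hIh
    ((le_max_right _ _).trans hcard) (hk₀ _ ((le_max_left _ _).trans hcard))
    (fun l hl => (hl₁ l ((le_max_left _ _).trans hl)).1)
    (fun l hl => (hl₁ l ((le_max_left _ _).trans hl)).2)

end TestSetup

theorem abs_csSup_sub_le {s : Set ℝ} (hs : s.Nonempty) {x ε : ℝ} (h : ∀ y ∈ s, |y - x| ≤ ε) :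
    |sSup s - x| ≤ ε := by
  have hu : ∀ y ∈ s, y ≤ x + ε := fun y hy => by linarith [(abs_le.1 (h y hy)).2]
  obtain ⟨y, hy⟩ := hs
  have h1 := le_csSup ⟨x + ε, hu⟩ hy
  have h2 := csSup_le ⟨y, hy⟩ hu
  rw [abs_le]
  constructor <;> linarith [(abs_le.1 (h y hy)).1]

end CMITest

end

/-! ### The main theorem -/

theorem corollary1 (d p : ℕ) (hd : 0 < d) (hp : 0 < p)
    (α : ℝ) (hα0 : 0 < α) (hα1 : α < 1)
    (γ : ℕ → ℝ) (hγ : ∀ n, 0 < γ n ∧ γ n < α / 2)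
    (φ : ℝ) (hφ0 : 0 < φ) (hφ1 : φ < 1 / (2 + (d : ℝ)))
    (c : CMITest.ClassConstants) (D : CMITest.TestSetup d p)
    (hX : D.DesignConditions)
    (hH : D.BandwidthConditions)
    (hV : D.VarianceEstimatorConditions c (1 / (2 + (d : ℝ)) - φ))
    (hK : D.KernelConditions)
    (hI : D.TestPointConditions)
    (hrate : Tendsto (fun n : ℕ => Real.log n ^ 19 / (D.hmin n ^ (3 * d) * n)) atTop (𝓝 0)) :
    (∀ ε : ℝ, 0 < ε → ∀ᶠ n : ℕ in atTop, ∀ w ∈ CMITest.nullClass p c D.X n,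
      1 - α - ε ≤ D.acceptPIA α w) ∧
    (∀ ε : ℝ, 0 < ε → ∀ᶠ n : ℕ in atTop, ∀ w ∈ CMITest.nullClass p c D.X n,
      1 - α - ε ≤ D.acceptRMS α (γ n) w) ∧
    (∀ ε : ℝ, 0 < ε → ∀ᶠ n : ℕ in atTop, (CMITest.zeroClass p c D.X n).Nonempty →
      |sSup (D.acceptPIA α '' CMITest.zeroClass p c D.X n) - (1 - α)| ≤ ε) ∧
    (Tendsto γ atTop (𝓝 0) →
      ∀ ε : ℝ, 0 < ε → ∀ᶠ n : ℕ in atTop, (CMITest.zeroClass p c D.X n).Nonempty →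
        |sSup (D.acceptRMS α (γ n) '' CMITest.zeroClass p c D.X n) - (1 - α)| ≤ ε) := by
  have hκ : 0 < 1 / (2 + (d : ℝ)) - φ := sub_pos.2 hφ1
  -- Half of `1 - α` stays below `1 - α - ε'` whenever `4 * ε' ≤ 1 - α`, uniformly in `γ n`; so `M`
  -- and `N` can be fixed once.
  obtain ⟨M, N, hT⟩ := CMITest.TestSetup.eventually_tailApprox (c := c) hd hp hX hH hK hI
    (by linarith : 0 < (1 - α) / 2)
  have key : ∀ ε : ℝ, 0 < ε → ∃ ε' : ℝ, 0 < ε' ∧ 20 * ε' ≤ ε ∧ 12 * ε' ≤ 1 ∧ 5 * ε' ≤ α ∧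
      4 * ε' ≤ 1 - α ∧ ∀ᶠ n : ℕ in atTop, ∀ w ∈ CMITest.nullClass p c D.X n,
        CMITest.TestSetup.TailApprox D w ε' ((1 - α) / 2) M N ∧
        ∃ η Q r good, CMITest.TestSetup.Approx D w ε' η Q r good := fun ε hε => by
    refine ⟨min (min (ε / 20) (1 / 12)) (min (α / 5) ((1 - α) / 4)), ?_, ?_, ?_, ?_, ?_, ?_⟩
    · exact lt_min (lt_min (by linarith) (by norm_num)) (lt_min (by linarith) (by linarith))
    · linarith [(min_le_left (min (ε / 20) (1 / 12)) (min (α / 5) ((1 - α) / 4))).trans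
        (min_le_left _ _)]
    · linarith [(min_le_left (min (ε / 20) (1 / 12)) (min (α / 5) ((1 - α) / 4))).trans
        (min_le_right _ _)]
    · linarith [(min_le_right (min (ε / 20) (1 / 12)) (min (α / 5) ((1 - α) / 4))).trans
        (min_le_left _ _)]
    · linarith [(min_le_right (min (ε / 20) (1 / 12)) (min (α / 5) ((1 - α) / 4))).trans
        (min_le_right _ _)]
    · have hpos : 0 < min (min (ε / 20) (1 / 12)) (min (α / 5) ((1 - α) / 4)) :=
        lt_min (lt_min (by linarith) (by norm_num)) (lt_min (by linarith) (by linarith))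
      filter_upwards [hT _ hpos,
        CMITest.TestSetup.eventually_approx hκ hd hp hX hH hV hK hI hrate hpos] with n h1 h2 w hw
      obtain ⟨η, Q, r, h3⟩ := h2
      exact ⟨h1 w hw, η, Q, r, h3 w hw⟩
  have lowPIA : ∀ ε : ℝ, 0 < ε → ∀ᶠ n : ℕ in atTop, ∀ w ∈ CMITest.nullClass p c D.X n,
      1 - α - ε ≤ D.acceptPIA α w := fun ε hε => by
    obtain ⟨ε', h0, h1, h2, h3, h4, hev⟩ := key ε hε
    filter_upwards [hev] with n hn w hw
    obtain ⟨-, η, Q, r, good, a⟩ := hn w hw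
    exact le_trans (by linarith) (a.le_acceptPIA hw.2 hα0 (by linarith))
  have lowRMS : ∀ ε : ℝ, 0 < ε → ∀ᶠ n : ℕ in atTop, ∀ w ∈ CMITest.nullClass p c D.X n,
      1 - α - ε ≤ D.acceptRMS α (γ n) w := fun ε hε => by
    obtain ⟨ε', h0, h1, h2, h3, h4, hev⟩ := key ε hε
    filter_upwards [hev] with n hn w hw
    obtain ⟨b, η, Q, r, good, a⟩ := hn w hw
    exact le_trans (by linarith) (a.le_acceptRMS b hw.2 (hγ n).1 (hγ n).2 h2 (by linarith)
      (by linarith))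
  refine ⟨lowPIA, lowRMS, fun ε hε => ?_, fun hγ0 ε hε => ?_⟩
  · obtain ⟨ε', h0, h1, h2, h3, h4, hev⟩ := key ε hε
    filter_upwards [hev, lowPIA ε hε] with n hn hlow hne
    refine CMITest.abs_csSup_sub_le (hne.image _) ?_
    rintro _ ⟨w, hw, rfl⟩
    obtain ⟨-, η, Q, r, good, a⟩ := hn w hw.1
    have := a.acceptPIA_le hw.2 (α := α) (by linarith) (by linarith)
    rw [abs_le]
    constructor <;> linarith [hlow w hw.1]
  · obtain ⟨ε', h0, h1, h2, h3, h4, hev⟩ := key ε hε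
    -- With `2 * γ n ≤ ε'` the upper bound `1 - α + 2 * γ n + 9 * ε'` is at most `1 - α + ε`.
    filter_upwards [hev, lowRMS ε hε, hγ0.eventually (ge_mem_nhds (by linarith : 0 < ε' / 2))]
      with n hn hlow hγn hne
    refine CMITest.abs_csSup_sub_le (hne.image _) ?_
    rintro _ ⟨w, hw, rfl⟩
    obtain ⟨b, η, Q, r, good, a⟩ := hn w hw.1
    have := a.acceptRMS_le b hw.2 (α := α) (by linarith) (hγ n).1 (by linarith) (by linarith)
    rw [abs_le]
    constructor <;> linarith [hlow w hw.1]
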